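/- Let $d\ge 1$, $\kappa=\lfloor d/2\rfloor+1$, $a\in C^{\kappa}(\mathbb R^d)$ (complex valued) and $b\in C_0(\mathbb R^d)$ (complex valued, continuous, vanishing at infinity). Suppose that for some constant $k>0$ and every real $r>0$ $$\int_{\frac r2\le\|\xi\|\le r}|D^{\alpha}_{\xi}a(\xi)|^2\,d\xi\le k^2\,r^{\,d-2|\alpha|}$$ for every multi-index $\alpha\in\mathbb N_0^d$ with $|\alpha|=\alpha_1+\dots+\alpha_d\le\kappa$. Then there is exactly one bounded linear operator $\mathcal A$ on $L^2(\mathbb R^d)$ with $\mathcal F(\mathcal Au)(\xi)=a(\xi)\,\mathcal F(u)(\xi)$ for a.e. $\xi$ and all $u\in L^2(\mathbb R^d)$, where $\mathcal F$ is the Fourier transform (the Fourier multiplier with symbol $a$). Let $B$ be the operator of multiplication by $b$, $Bu(x)=b(x)u(x)$. Then for every $1<p_0<\infty$ the commutator $C=\mathcal AB-B\mathcal A$ is a compact linear operator from $L^\infty_0(\mathbb R^d)$ into $L^{p_0}_{loc}(\mathbb R^d)$. Here $L^\infty_0(\mathbb R^d)\subset L^2(\mathbb R^d)$ is the space of compactly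 supported functions in $L^\infty(\mathbb R^d)$ with the $L^\infty$ norm, $L^{p_0}_{loc}(\mathbb R^d)$ carries the topology of convergence in $L^{p_0}(K)$ for every compact set $K\subset\mathbb R^d$, and compactness means that $C$ maps some neighbourhood of $0$ (equivalently, every bounded set) into a compact set. -/

import Mathlib

open MeasureTheory Filter Topology
open scoped ENNReal FourierTransform ZeroAtInfty

/-- `ℝ^d` with its Euclidean norm and Lebesgue measure. -/
abbrev Rd (d : ℕ) : Type := EuclideanSpace ℝ (Fin d)

/-- The complex space `L²(ℝ^d)`. -/
abbrev L2 (d : ℕ) : Type := Lp (α := Rd d) ℂ 2 volume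

/-- The partial derivative `D^α a (ξ)` for a multi-index `α`: the derivative of order `∑ i, α i`,
evaluated at the list of vectors in which the `i`-th coordinate vector occurs `α i` times. -/
noncomputable def multiDeriv {d : ℕ} (α : Fin d → ℕ) (a : Rd d → ℂ) (ξ : Rd d) : ℂ :=
  iteratedFDeriv ℝ (∑ i, α i) a ξ
    (fun j => EuclideanSpace.single (finSigmaFinEquiv.symm j).1 (1 : ℝ))

/-- The Hörmander–Mikhlin type condition of order `κ` with constant `k`. -/
def HormanderMikhlin {d : ℕ} (κ : ℕ) (k : ℝ) (a : Rd d → ℂ) : Prop :=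
  ∀ r : ℝ, 0 < r → ∀ α : Fin d → ℕ, ∑ i, α i ≤ κ →
    ∫ ξ in {ξ : Rd d | r / 2 ≤ ‖ξ‖ ∧ ‖ξ‖ ≤ r}, ‖multiDeriv α a ξ‖ ^ 2 ≤
      k ^ 2 * r ^ ((d : ℤ) - 2 * ((∑ i, α i : ℕ) : ℤ))

/-- `A` is the Fourier multiplier with symbol `a` on `L²(ℝ^d)`: `𝓕 (A u) = a 𝓕 u` a.e.,
where `𝓕` is the Fourier–Plancherel transform. -/
def IsFourierMultiplier {d : ℕ} (a : Rd d → ℂ) (A : L2 d →L[ℂ] L2 d) : Prop :=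
  ∀ u : L2 d, ∀ᵐ ξ : Rd d, (𝓕 (A u) : L2 d) ξ = a ξ * (𝓕 u : L2 d) ξ

theorem memLp_mul_zeroAtInfty {d : ℕ} (b : C₀(Rd d, ℂ)) (u : L2 d) :
    MemLp (fun x => b x * u x) 2 (volume : Measure (Rd d)) := by
  have hb : MemLp (fun x => b x) ∞ (volume : Measure (Rd d)) :=
    memLp_top_of_bound b.continuous.aestronglyMeasurable ‖b.toBCF‖
      (Eventually.of_forall fun x => b.toBCF.norm_coe_le_norm x)
  exact (Lp.memLp u).mul hb

/-- Multiplication by `b ∈ C₀(ℝ^d)` on `L²(ℝ^d)`. -/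
noncomputable def mulOp {d : ℕ} (b : C₀(Rd d, ℂ)) (u : L2 d) : L2 d :=
  (memLp_mul_zeroAtInfty b u).toLp (fun x => b x * u x)

/-- The commutator `A B - B A` with the operator `B` of multiplication by `b`. -/
noncomputable def commutatorOp {d : ℕ} (A : L2 d →L[ℂ] L2 d) (b : C₀(Rd d, ℂ)) (u : L2 d) : L2 d :=
  A (mulOp b u) - mulOp b (A u)

/-- The space of compactly supported functions in `L^∞(ℝ^d)`, with the norm of `L^∞(ℝ^d)`. -/
def LinftyCompact (d : ℕ) : Submodule ℂ (Lp (α := Rd d) ℂ ∞ volume) where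
  carrier := {u | ∃ K : Set (Rd d), IsCompact K ∧ ∀ᵐ x : Rd d, x ∉ K → u x = 0}
  zero_mem' := ⟨∅, isCompact_empty, by
    filter_upwards [Lp.coeFn_zero ℂ ∞ (volume : Measure (Rd d))] with x hx _
    exact hx⟩
  add_mem' := by
    rintro u v ⟨K, hK, hu⟩ ⟨L, hL, hv⟩
    refine ⟨K ∪ L, hK.union hL, ?_⟩
    filter_upwards [hu, hv, Lp.coeFn_add u v] with x hu hv h hx
    rw [Set.mem_union, not_or] at hx
    exact h.trans (by rw [Pi.add_apply, hu hx.1, hv hx.2, add_zero])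
  smul_mem' := by
    rintro c u ⟨K, hK, hu⟩
    refine ⟨K, hK, ?_⟩
    filter_upwards [hu, Lp.coeFn_smul c u] with x hu h hx
    exact h.trans (by rw [Pi.smul_apply, hu hx, smul_zero])

theorem LinftyCompact.memLp_two {d : ℕ} (u : LinftyCompact d) :
    MemLp (fun x => (u : Lp (α := Rd d) ℂ ∞ volume) x) 2 (volume : Measure (Rd d)) := by
  obtain ⟨K, hK, hu⟩ := u.2
  have h1 : MemLp (fun x => (u : Lp (α := Rd d) ℂ ∞ volume) x) ∞
      (volume : Measure (Rd d)) := Lp.memLp _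
  have h2 : MemLp (K.indicator fun _ => (1 : ℂ)) 2 (volume : Measure (Rd d)) :=
    memLp_indicator_const 2 hK.measurableSet 1 (Or.inr hK.measure_lt_top.ne)
  refine (h2.mul (r := 2) h1).ae_eq ?_
  filter_upwards [hu] with x hx
  by_cases hxK : x ∈ K
  · simp [hxK]
  · simp [hxK, hx hxK]

/-- The inclusion of the compactly supported `L^∞` functions into `L²(ℝ^d)`. -/
noncomputable def LinftyCompact.toL2 {d : ℕ} (u : LinftyCompact d) : L2 d :=
  (LinftyCompact.memLp_two u).toLp _

/-- The functions (modulo equality a.e.) that are in `L^p` on every compact set. -/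
def lpLocSubmodule (d : ℕ) (p : ℝ≥0∞) : Submodule ℂ (Rd d →ₘ[volume] ℂ) where
  carrier := {f | ∀ K : Set (Rd d), IsCompact K → MemLp (⇑f) p (volume.restrict K)}
  zero_mem' := fun K _ =>
    (MemLp.zero (ε := ℂ) (p := p) (μ := volume.restrict K)).ae_eq
      (ae_restrict_of_ae AEEqFun.coeFn_zero.symm)
  add_mem' := fun {f g} hf hg K hK =>
    ((hf K hK).add (hg K hK)).ae_eq (ae_restrict_of_ae (AEEqFun.coeFn_add f g).symm)
  smul_mem' := fun c f hf K hK =>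
    ((hf K hK).const_smul c).ae_eq (ae_restrict_of_ae (AEEqFun.coeFn_smul c f).symm)

/-- The space `L^p_loc(ℝ^d)`. -/
def LpLoc (d : ℕ) (p : ℝ≥0∞) : Type := lpLocSubmodule d p

noncomputable instance (d : ℕ) (p : ℝ≥0∞) : AddCommGroup (LpLoc d p) :=
  inferInstanceAs (AddCommGroup (lpLocSubmodule d p))

noncomputable instance (d : ℕ) (p : ℝ≥0∞) : Module ℂ (LpLoc d p) :=
  inferInstanceAs (Module ℂ (lpLocSubmodule d p))

/-- The class of functions underlying an element of `L^p_loc(ℝ^d)`. -/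
def LpLoc.toAEEqFun {d : ℕ} {p : ℝ≥0∞} (f : LpLoc d p) : Rd d →ₘ[volume] ℂ :=
  Subtype.val (p := fun g => g ∈ lpLocSubmodule d p) f

theorem LpLoc.memLp {d : ℕ} {p : ℝ≥0∞} (f : LpLoc d p) {K : Set (Rd d)} (hK : IsCompact K) :
    MemLp (⇑f.toAEEqFun) p (volume.restrict K) :=
  Subtype.property (p := fun g => g ∈ lpLocSubmodule d p) f K hK

/-- Restriction of a function in `L^p_loc(ℝ^d)` to a compact set `K`, as an element of `L^p(K)`. -/
noncomputable def LpLoc.restrict {d : ℕ} {p : ℝ≥0∞} (K : TopologicalSpace.Compacts (Rd d))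
    (f : LpLoc d p) : Lp (α := Rd d) ℂ p (volume.restrict (K : Set (Rd d))) :=
  (f.memLp K.isCompact).toLp _

/-- The topology of `L^p_loc(ℝ^d)`: convergence in `L^p(K)` for every compact set `K`. -/
noncomputable instance (d : ℕ) (p : ℝ≥0∞) [Fact (1 ≤ p)] : TopologicalSpace (LpLoc d p) :=
  ⨅ K : TopologicalSpace.Compacts (Rd d),
    TopologicalSpace.induced (LpLoc.restrict K) inferInstance

/-! A Littlewood–Paley decomposition writes `a` as a low-frequency piece plus pieces living where
|ξ| is of order 2^j, with inverse Fourier transforms K_j. Since κ > d/2, Plancherel and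
Cauchy–Schwarz turn the L² bounds on derivatives of `a` into L¹ bounds on K_j: norm O(1), moment of
order 1/4 of size O(2^(-j/4)), translation modulus O(2^j |h|) (`exists_kernel_sequence`). The
partial sums T_N of the convolutions with K_j are thus Calderón–Zygmund operators, with bounds
independent of N.

T_N maps L^∞ into dyadic BMO uniformly in N (`exists_dav_oscillation_le`): the part of u near a cube
is handled in L², the far part by decay and regularity of the kernels. A Bellman function proof of
the John–Nirenberg inequality (`dav_exp_le`) upgrades this to L^m bounds on compact sets for every
m, uniform in N and in all u with sup norm at most 1, whatever their support
(`exists_eLpNorm_cv_le`). No interpolation is needed.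

Being in C₀, b is uniformly continuous, hence a uniform limit of bounded Lipschitz functions b'.
Replacing b by b' costs O(sup |b - b'|) in L^p(K), by the uniform bounds. For Lipschitz b' the
factor b'(y) - b'(x) is absorbed by the moment of K_j, so the commutator with the j-th piece is
O(2^(-j/4)) in sup norm and the commutators [T_N, b'] converge uniformly. For fixed N they send the
unit ball to a bounded equi-Lipschitz family, which has finite nets on K. Along a subsequence the
truncated commutators converge a.e. to C u, and Fatou's lemma transfers the estimates; so the image
of the unit ball is totally bounded in each L^p(K) (`exists_finite_net_commutator`). A Tychonoff
argument assembles these into one compact subset of L^p_loc (`LpLoc.exists_isCompact_superset`). -/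

/-! ### The Plancherel transform as an integral. -/

/-- Both sides are locally integrable, so it suffices to test against smooth compactly supported g.
As a tempered distribution the Plancherel transform moves onto g, and Fubini moves it back onto f as
an integral. -/
theorem fourier_toLp_ae_eq {d : ℕ} {f : Rd d → ℂ} (h1 : Integrable f) (h2 : MemLp f 2 volume) :
    (𝓕 (h2.toLp f) : L2 d) =ᵐ[volume] 𝓕 f := by
  have hcont : Continuous (𝓕 f) := by
    exact VectorFourier.fourierIntegral_continuous Real.continuous_fourierChar
      (by exact continuous_inner) h1
  refine ae_eq_of_integral_contDiff_smul_eq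
    ((Lp.memLp _).locallyIntegrable (by norm_num)) hcont.locallyIntegrable ?_
  intro g hg hgs
  have hgs' : HasCompactSupport (fun x => (g x : ℂ)) := hgs.comp_left (g := fun r : ℝ => (r : ℂ)) rfl
  have hg' : ContDiff ℝ ((⊤ : ℕ∞) : WithTop ℕ∞) (fun x => (g x : ℂ)) :=
    Complex.ofRealCLM.contDiff.comp hg
  let G : SchwartzMap (Rd d) ℂ := hgs'.toSchwartzMap hg'
  have hG : ∀ x, G x = (g x : ℂ) := fun x => rfl
  have key := congrArg (fun T : TemperedDistribution (Rd d) ℂ => T G)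
    (Lp.fourier_toTemperedDistribution_eq (h2.toLp f))
  simp only [TemperedDistribution.fourier_apply, Lp.toTemperedDistribution_apply] at key
  have e1 : ∫ x, g x • (𝓕 (h2.toLp f) : L2 d) x = ∫ x, G x • (𝓕 (h2.toLp f) : L2 d) x := by
    simp only [hG, Complex.coe_smul]
  rw [e1, ← key]
  have e2 : ∫ x, (𝓕 G) x • (h2.toLp f) x = ∫ x, (𝓕 (G : Rd d → ℂ)) x • f x := by
    refine integral_congr_ae ?_
    filter_upwards [h2.coeFn_toLp] with x hx
    rw [hx, SchwartzMap.fourier_coe]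
  rw [e2]
  have e3 := VectorFourier.integral_fourierIntegral_smul_eq_flip (μ := (volume : Measure (Rd d)))
    (ν := (volume : Measure (Rd d))) (e := Real.fourierChar) (L := innerₗ (Rd d))
    Real.continuous_fourierChar (by exact continuous_inner) G.integrable h1
  rw [flip_innerₗ] at e3
  refine Eq.trans e3 ?_
  refine integral_congr_ae (Eventually.of_forall fun x => ?_)
  simp only [hG, Complex.coe_smul]
  rfl

theorem memLp_fourier {d : ℕ} {f : Rd d → ℂ} (h1 : Integrable f) (h2 : MemLp f 2 volume) :
    MemLp (𝓕 f) 2 volume :=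
  (Lp.memLp _).ae_eq (fourier_toLp_ae_eq h1 h2)

theorem eLpNorm_fourier {d : ℕ} {f : Rd d → ℂ} (h1 : Integrable f) (h2 : MemLp f 2 volume) :
    eLpNorm (𝓕 f) 2 volume = eLpNorm f 2 volume := by
  rw [← eLpNorm_congr_ae (fourier_toLp_ae_eq h1 h2), ← eLpNorm_congr_ae h2.coeFn_toLp,
    ← Lp.enorm_def, ← Lp.enorm_def, ← ofReal_norm, ← ofReal_norm, Lp.norm_fourier_eq]

/-! ### Pure partial derivatives and Plancherel identities. -/

/-- The `n`-th partial derivative in the `i`-th coordinate direction. -/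
noncomputable def pderiv {d : ℕ} (i : Fin d) (n : ℕ) (f : Rd d → ℂ) (ξ : Rd d) : ℂ :=
  iteratedFDeriv ℝ n f ξ (fun _ => EuclideanSpace.single i (1 : ℝ))

/-- The symbol condition enters the proof only through pure derivatives: on the Fourier side these
give the weights |x i|^κ, which already control ‖x‖^κ. -/
theorem multiDeriv_single {d : ℕ} (i : Fin d) (n : ℕ) (f : Rd d → ℂ) (ξ : Rd d) :
    multiDeriv (Pi.single i n) f ξ = pderiv i n f ξ := by
  unfold multiDeriv pderiv
  have h : (fun j : Fin (∑ l, (Pi.single i n : Fin d → ℕ) l) =>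
      (EuclideanSpace.single (finSigmaFinEquiv.symm j).1 (1 : ℝ) : Rd d)) =
      fun _ => EuclideanSpace.single i (1 : ℝ) := by
    funext j
    have h1 := (finSigmaFinEquiv.symm j).2
    by_cases h2 : (finSigmaFinEquiv.symm j).1 = i
    · rw [h2]
    · have h3 : (Pi.single i n : Fin d → ℕ) (finSigmaFinEquiv.symm j).1 = 0 :=
        by rw [Pi.single_apply, if_neg h2]
      exact absurd h1.isLt (by omega)
  rw [h]
  have hs : ∑ l, (Pi.single i n : Fin d → ℕ) l = n := by simp
  generalize ∑ l, (Pi.single i n : Fin d → ℕ) l = N at hs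
  subst hs
  rfl

theorem pderiv_eq_iteratedDeriv {d : ℕ} (i : Fin d) (n : ℕ) {f : Rd d → ℂ}
    (hf : ContDiff ℝ n f) (ξ : Rd d) :
    pderiv i n f ξ =
      iteratedDeriv n (fun t : ℝ => f (ξ + t • EuclideanSpace.single i (1 : ℝ))) 0 := by
  let L : ℝ →L[ℝ] Rd d := ContinuousLinearMap.toSpanSingleton ℝ (EuclideanSpace.single i (1 : ℝ))
  have h1 : (fun t : ℝ => f (ξ + t • EuclideanSpace.single i (1 : ℝ))) =
      (fun y => f (ξ + y)) ∘ L := by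
    funext t; simp [L]
  have h2 : ContDiff ℝ n (fun y => f (ξ + y)) := hf.comp (contDiff_const.add contDiff_id)
  rw [h1, iteratedDeriv_eq_iteratedFDeriv, L.iteratedFDeriv_comp_right h2 0 le_rfl,
    iteratedFDeriv_comp_add_left]
  simp [pderiv, L]

theorem pderiv_mul {d : ℕ} (i : Fin d) (n : ℕ) {f g : Rd d → ℂ}
    (hf : ContDiff ℝ n f) (hg : ContDiff ℝ n g) (ξ : Rd d) :
    pderiv i n (fun x => f x * g x) ξ =
      ∑ j ∈ Finset.range (n + 1), (n.choose j : ℂ) * pderiv i j f ξ * pderiv i (n - j) g ξ := by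
  have hl : ContDiff ℝ n (fun t : ℝ => ξ + t • (EuclideanSpace.single i (1 : ℝ) : Rd d)) := by
    fun_prop
  rw [pderiv_eq_iteratedDeriv i n (hf.mul hg), iteratedDeriv_fun_mul
    (f := fun t : ℝ => f (ξ + t • EuclideanSpace.single i (1 : ℝ)))
    (g := fun t : ℝ => g (ξ + t • EuclideanSpace.single i (1 : ℝ)))
    (hf.comp hl).contDiffAt (hg.comp hl).contDiffAt]
  refine Finset.sum_congr rfl fun j hj => ?_
  have hj' : j ≤ n := by simpa [Nat.lt_succ_iff] using hj
  rw [pderiv_eq_iteratedDeriv i j (hf.of_le (by exact_mod_cast hj')),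
    pderiv_eq_iteratedDeriv i (n - j) (hg.of_le (by exact_mod_cast Nat.sub_le n j))]

theorem pderiv_comp_smul {d : ℕ} (i : Fin d) (n : ℕ) {f : Rd d → ℂ}
    (hf : ContDiff ℝ n f) (c : ℝ) (ξ : Rd d) :
    pderiv i n (fun x => f (c • x)) ξ = (c : ℂ) ^ n * pderiv i n f (c • ξ) := by
  have h := iteratedFDeriv_comp_const_smul c hf
  unfold pderiv
  rw [congrFun h ξ]
  simp

theorem continuous_pderiv {d : ℕ} (i : Fin d) (n : ℕ) {f : Rd d → ℂ} (hf : ContDiff ℝ n f) :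
    Continuous (pderiv i n f) :=
  (ContinuousMultilinearMap.apply ℝ (fun _ : Fin n => Rd d) ℂ
    (fun _ => EuclideanSpace.single i (1 : ℝ))).continuous.comp
    (hf.continuous_iteratedFDeriv le_rfl)

theorem hasCompactSupport_pderiv {d : ℕ} (i : Fin d) (n : ℕ) {f : Rd d → ℂ}
    (hf : HasCompactSupport f) : HasCompactSupport (pderiv i n f) :=
  (hf.iteratedFDeriv n).comp_left (g := fun T : ContinuousMultilinearMap ℝ
    (fun _ : Fin n => Rd d) ℂ => T (fun _ => EuclideanSpace.single i (1 : ℝ))) rfl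

theorem fourier_pderiv {d : ℕ} (i : Fin d) (n : ℕ) {f : Rd d → ℂ} (hf : ContDiff ℝ n f)
    (hs : HasCompactSupport f) (x : Rd d) :
    𝓕 (pderiv i n f) x = (2 * Real.pi * Complex.I * x i) ^ n * 𝓕 f x := by
  have hint : ∀ l : ℕ, (l : ℕ∞) ≤ (n : ℕ∞) → Integrable (iteratedFDeriv ℝ l f) volume := by
    intro l hl
    exact (hf.continuous_iteratedFDeriv (by exact_mod_cast hl)).integrable_of_hasCompactSupport
      (hs.iteratedFDeriv l)
  have h := Real.fourier_iteratedFDeriv (N := (n : ℕ∞)) (by exact_mod_cast hf) hint (n := n) le_rfl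
  have h2 := Real.fourier_continuousMultilinearMap_apply (f := iteratedFDeriv ℝ n f)
    (m := fun _ => EuclideanSpace.single i (1 : ℝ)) (v := x) (hint n le_rfl)
  rw [h] at h2
  have h3 : 𝓕 (pderiv i n f) x = _ := h2.symm
  rw [h3, VectorFourier.fourierPowSMulRight_apply]
  simp only [neg_apply, Finset.prod_const, Finset.card_univ, Fintype.card_fin, smul_eq_mul,
    Complex.real_smul]
  push_cast
  rw [← mul_assoc, ← mul_pow]
  congr 2
  have h4 : innerSL ℝ x (EuclideanSpace.single i (1 : ℝ)) = x i :=
    (EuclideanSpace.inner_single_right i (1 : ℝ) x).trans (by simp)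
  have h5 : (innerSL ℝ) x (EuclideanSpace.single i (1 : ℝ)) = x i := h4
  erw [h5]
  ring

theorem integrable_norm_sq_fourier {d : ℕ} {f : Rd d → ℂ} (h1 : Integrable f)
    (h2 : MemLp f 2 volume) : Integrable (fun x => ‖𝓕 f x‖ ^ 2) :=
  (memLp_fourier h1 h2).integrable_norm_pow two_ne_zero

theorem integral_norm_sq_eq_eLpNorm {d : ℕ} {f : Rd d → ℂ} (h2 : MemLp f 2 volume) :
    ∫ x, ‖f x‖ ^ 2 = (eLpNorm f 2 volume).toReal ^ 2 := by
  have h := h2.eLpNorm_eq_integral_rpow_norm two_ne_zero (by norm_num)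
  have h0 : 0 ≤ ∫ x, ‖f x‖ ^ 2 := integral_nonneg fun x => by positivity
  rw [h, ENNReal.toReal_ofReal (by positivity)]
  simp only [ENNReal.toReal_ofNat, Real.rpow_ofNat]
  rw [← Real.rpow_natCast, ← Real.rpow_mul h0]
  norm_num

theorem integral_norm_sq_fourier {d : ℕ} {f : Rd d → ℂ} (h1 : Integrable f)
    (h2 : MemLp f 2 volume) : ∫ x, ‖𝓕 f x‖ ^ 2 = ∫ x, ‖f x‖ ^ 2 := by
  rw [integral_norm_sq_eq_eLpNorm h2, integral_norm_sq_eq_eLpNorm (memLp_fourier h1 h2),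
    eLpNorm_fourier h1 h2]

theorem pderiv_eq_zero_of_notMem {d : ℕ} (i : Fin d) (n : ℕ) {f : Rd d → ℂ} {ξ : Rd d}
    (h : ξ ∉ tsupport f) : pderiv i n f ξ = 0 := by
  have h1 : iteratedFDeriv ℝ n f ξ = 0 := by
    by_contra h2
    exact h (support_iteratedFDeriv_subset n h2)
  simp [pderiv, h1]

/-! ### Weighted L¹ bounds for Fourier transforms of localized symbols. -/

/-- Leibniz rule, with g measured in L² on S and ψ in sup norm. Binomial coefficients are at most
2^κ, whence 4^κ after squaring; one factor κ + 1 comes from Cauchy–Schwarz on the sum, the other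
from adding up the integrals. -/
theorem integral_norm_sq_pderiv_mul_le {d : ℕ} {κ : ℕ} {g ψ : Rd d → ℂ} {S : Set (Rd d)}
    {C M : ℝ} (hg : ContDiff ℝ κ g) (hψ : ContDiff ℝ κ ψ) (hS : IsCompact S)
    (hψS : tsupport ψ ⊆ S)
    (hgS : ∀ i, ∀ l ≤ κ, ∫ ξ in S, ‖pderiv i l g ξ‖ ^ 2 ≤ C ^ 2)
    (hM : ∀ i, ∀ l ≤ κ, ∀ ξ, ‖pderiv i l ψ ξ‖ ≤ M) (i : Fin d) {n : ℕ} (hn : n ≤ κ) :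
    ∫ ξ, ‖pderiv i n (fun x => g x * ψ x) ξ‖ ^ 2 ≤ (κ + 1) ^ 2 * 4 ^ κ * (C * M) ^ 2 := by
  have hg' : ContDiff ℝ n g := hg.of_le (by exact_mod_cast hn)
  have hψ' : ContDiff ℝ n ψ := hψ.of_le (by exact_mod_cast hn)
  have hcomp : ∀ j ≤ κ, IntegrableOn (fun ξ => ‖pderiv i j g ξ‖ ^ 2) S := fun j hj =>
    ((continuous_pderiv i j (hg.of_le (by exact_mod_cast hj))).norm.pow 2).continuousOn.integrableOn_compact hS
  have h1 : ∫ ξ, ‖pderiv i n (fun x => g x * ψ x) ξ‖ ^ 2 =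
      ∫ ξ in S, ‖pderiv i n (fun x => g x * ψ x) ξ‖ ^ 2 := by
    symm
    apply setIntegral_eq_integral_of_forall_compl_eq_zero
    intro ξ hξ
    rw [pderiv_eq_zero_of_notMem]
    · simp
    · exact fun h => hξ (hψS (tsupport_mul_subset_right h))
  have h2 : ∀ ξ, ‖pderiv i n (fun x => g x * ψ x) ξ‖ ^ 2 ≤
      ∑ j ∈ Finset.range (n + 1), (κ + 1) * 4 ^ κ * M ^ 2 * ‖pderiv i j g ξ‖ ^ 2 := by
    intro ξ
    rw [pderiv_mul i n hg' hψ']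
    have hle : ‖∑ j ∈ Finset.range (n + 1),
        (n.choose j : ℂ) * pderiv i j g ξ * pderiv i (n - j) ψ ξ‖ ≤
        ∑ j ∈ Finset.range (n + 1), 2 ^ κ * M * ‖pderiv i j g ξ‖ := by
      refine norm_sum_le_of_le _ fun j hj => ?_
      have hc : (n.choose j : ℝ) ≤ 2 ^ κ := by
        calc (n.choose j : ℝ) ≤ 2 ^ n := by exact_mod_cast Nat.choose_le_two_pow n j
          _ ≤ 2 ^ κ := pow_le_pow_right₀ (by norm_num) hn
      have hMj := hM i (n - j) ((Nat.sub_le n j).trans hn) ξ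
      rw [norm_mul, norm_mul, Complex.norm_natCast]
      calc (n.choose j : ℝ) * ‖pderiv i j g ξ‖ * ‖pderiv i (n - j) ψ ξ‖
          ≤ 2 ^ κ * ‖pderiv i j g ξ‖ * M := by gcongr
        _ = _ := by ring
    calc _ ≤ (∑ j ∈ Finset.range (n + 1), 2 ^ κ * M * ‖pderiv i j g ξ‖) ^ 2 := by gcongr
      _ ≤ (Finset.range (n + 1)).card * ∑ j ∈ Finset.range (n + 1),
            (2 ^ κ * M * ‖pderiv i j g ξ‖) ^ 2 := sq_sum_le_card_mul_sum_sq
      _ ≤ (κ + 1) * ∑ j ∈ Finset.range (n + 1), (2 ^ κ * M * ‖pderiv i j g ξ‖) ^ 2 := by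
          gcongr
          rw [Finset.card_range]; exact_mod_cast Nat.succ_le_succ hn
      _ = _ := by
          rw [Finset.mul_sum]
          refine Finset.sum_congr rfl fun j _ => ?_
          have : (4 : ℝ) ^ κ = (2 ^ κ) ^ 2 := by rw [← pow_mul, mul_comm, pow_mul]; norm_num
          rw [this]; ring
  rw [h1]
  calc _ ≤ ∫ ξ in S, ∑ j ∈ Finset.range (n + 1),
            (κ + 1) * 4 ^ κ * M ^ 2 * ‖pderiv i j g ξ‖ ^ 2 := by
        refine integral_mono ?_ ?_ h2
        · exact ((continuous_pderiv i n (hg'.mul hψ')).norm.pow 2).continuousOn.integrableOn_compact hS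
        · refine integrable_finsetSum _ fun j hj => (hcomp j ?_).const_mul _
          have := Finset.mem_range.1 hj; omega
    _ = ∑ j ∈ Finset.range (n + 1), (κ + 1) * 4 ^ κ * M ^ 2 * ∫ ξ in S, ‖pderiv i j g ξ‖ ^ 2 := by
        rw [integral_finsetSum]
        · exact Finset.sum_congr rfl fun j _ => integral_const_mul _ _
        · refine fun j hj => (hcomp j ?_).const_mul _
          have := Finset.mem_range.1 hj; omega
    _ ≤ ∑ j ∈ Finset.range (n + 1), (κ + 1) * 4 ^ κ * M ^ 2 * C ^ 2 := by
        refine Finset.sum_le_sum fun j hj => ?_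
        gcongr
        refine hgS i j ?_
        have := Finset.mem_range.1 hj; omega
    _ = (n + 1) * ((κ + 1) * 4 ^ κ * M ^ 2 * C ^ 2) := by simp
    _ ≤ (κ + 1) * ((κ + 1) * 4 ^ κ * M ^ 2 * C ^ 2) := by
        gcongr
    _ = _ := by ring

theorem one_add_norm_pow_le {d : ℕ} (κ : ℕ) (hκ : 0 < κ) (x : Rd d) :
    (1 + ‖x‖) ^ (2 * κ) ≤ ((d : ℝ) + 1) ^ (2 * κ) * (1 + ∑ i, |x i| ^ (2 * κ)) := by
  have hx : ‖x‖ ≤ ∑ i, |x i| := by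
    rw [EuclideanSpace.norm_eq]
    refine Real.sqrt_le_iff.2 ⟨Finset.sum_nonneg fun i _ => abs_nonneg _, ?_⟩
    simpa using Finset.sum_sq_le_sq_sum_of_nonneg (s := Finset.univ) (f := fun i => |x i|)
      (fun i _ => abs_nonneg _)
  obtain ⟨n, hn⟩ : ∃ n, 2 * κ = n + 1 := ⟨2 * κ - 1, by omega⟩
  -- The summand 1 is treated as one more coordinate, so the power mean inequality runs over d + 1
  -- terms.
  let f : Option (Fin d) → ℝ := fun o => o.elim 1 fun i => |x i|
  have hf : ∀ o ∈ (Finset.univ : Finset (Option (Fin d))), 0 ≤ f o := by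
    rintro (_ | i) _ <;> simp [f]
  have h := pow_sum_div_card_le_sum_pow hf n
  rw [Fintype.sum_option, Fintype.sum_option, Finset.card_univ, Fintype.card_option,
    Fintype.card_fin, div_le_iff₀ (by positivity)] at h
  simp only [f, Option.elim_none, Option.elim_some, one_pow] at h
  push_cast at h
  have hS : 0 ≤ 1 + ∑ i, |x i| ^ (n + 1) := by positivity
  rw [hn]
  calc (1 + ‖x‖) ^ (n + 1) ≤ (1 + ∑ i, |x i|) ^ (n + 1) := by gcongr
    _ ≤ _ := h
    _ ≤ (1 + ∑ i, |x i| ^ (n + 1)) * ((d : ℝ) + 1) ^ (n + 1) := by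
        gcongr
        · linarith [(Nat.cast_nonneg d : (0 : ℝ) ≤ d)]
        · omega
    _ = _ := mul_comm _ _

/-- Plancherel bounds (1 + ‖x‖)^κ times the transform in L², and Cauchy–Schwarz pairs this with (1 +
‖x‖)^(1/4 - κ). The latter is square integrable because 2κ - 1/2 > d; any positive exponent below
1/2 could replace 1/4. -/
theorem exists_weighted_fourier_bound (d κ : ℕ) (hd : 0 < d) (hκ : d + 1 ≤ 2 * κ) :
    ∃ A : ℝ, 0 < A ∧ ∀ (g ψ : Rd d → ℂ) (S : Set (Rd d)) (C M : ℝ), ContDiff ℝ κ g →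
      ContDiff ℝ κ ψ → IsCompact S → tsupport ψ ⊆ S → 0 < C → 0 < M →
      (∀ i, ∀ l ≤ κ, ∫ ξ in S, ‖pderiv i l g ξ‖ ^ 2 ≤ C ^ 2) →
      (∀ i, ∀ l ≤ κ, ∀ ξ, ‖pderiv i l ψ ξ‖ ≤ M) →
      Integrable (fun x => (1 + ‖x‖) ^ (1 / 4 : ℝ) * ‖𝓕 (fun ξ => g ξ * ψ ξ) x‖) ∧
      ∫ x, (1 + ‖x‖) ^ (1 / 4 : ℝ) * ‖𝓕 (fun ξ => g ξ * ψ ξ) x‖ ≤ A * (C * M) := by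
  have hκ0 : 0 < κ := by omega
  set I : ℝ := ∫ x : Rd d, (1 + ‖x‖) ^ (-(2 * κ - 1 / 2 : ℝ)) with hI
  have hIint : Integrable (fun x : Rd d => (1 + ‖x‖) ^ (-(2 * κ - 1 / 2 : ℝ))) := by
    apply integrable_one_add_norm
    rw [finrank_euclideanSpace_fin]
    have : (d : ℝ) + 1 ≤ 2 * κ := by exact_mod_cast hκ
    linarith
  have hI0 : 0 ≤ I := integral_nonneg fun x => by positivity
  set B : ℝ := ((d : ℝ) + 1) ^ (2 * κ) with hB
  set D : ℝ := (κ + 1) ^ 2 * 4 ^ κ with hD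
  refine ⟨B * (d + 1) * D + I, by positivity, ?_⟩
  intro g ψ S C M hg hψ hS hψS hC hM hgS hMψ
  set m : Rd d → ℂ := fun ξ => g ξ * ψ ξ with hm
  have hmc : ContDiff ℝ κ m := hg.mul hψ
  have hms : HasCompactSupport m :=
    HasCompactSupport.of_support_subset_isCompact hS
      ((Function.support_mul_subset_right g ψ).trans ((subset_tsupport ψ).trans hψS))
  have hP : ∀ i : Fin d, ∀ n ≤ κ,
      Integrable (fun x : Rd d => ‖(2 * Real.pi * Complex.I * x i) ^ n * 𝓕 m x‖ ^ 2) ∧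
      ∫ x : Rd d, ‖(2 * Real.pi * Complex.I * x i) ^ n * 𝓕 m x‖ ^ 2 ≤ D * (C * M) ^ 2 := by
    intro i n hn
    have hmn : ContDiff ℝ n m := hmc.of_le (by exact_mod_cast hn)
    have hc := continuous_pderiv i n hmn
    have hcs := hasCompactSupport_pderiv i n hms
    have h1 := hc.integrable_of_hasCompactSupport hcs (μ := volume)
    have h2 := hc.memLp_of_hasCompactSupport hcs (μ := volume) (p := 2)
    have e : (fun x : Rd d => ‖(2 * Real.pi * Complex.I * x i) ^ n * 𝓕 m x‖ ^ 2) =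
        fun x => ‖𝓕 (pderiv i n m) x‖ ^ 2 := by
      funext x; rw [fourier_pderiv i n hmn hms]
    rw [e]
    refine ⟨integrable_norm_sq_fourier h1 h2, ?_⟩
    rw [integral_norm_sq_fourier h1 h2]
    exact integral_norm_sq_pderiv_mul_le hg hψ hS hψS hgS hMψ i hn
  set lam : ℝ := C * M with hlam
  have hlam0 : 0 < lam := mul_pos hC hM
  let P : Rd d → ℝ := fun x => ‖𝓕 m x‖ ^ 2 +
    ∑ i, ‖(2 * Real.pi * Complex.I * x i) ^ κ * 𝓕 m x‖ ^ 2
  have hP0 : Integrable (fun x : Rd d => ‖𝓕 m x‖ ^ 2) ∧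
      ∫ x : Rd d, ‖𝓕 m x‖ ^ 2 ≤ D * lam ^ 2 := by
    simpa using hP ⟨0, hd⟩ 0 (Nat.zero_le _)
  have hPint : Integrable P :=
    hP0.1.add (integrable_finsetSum _ fun i _ => (hP i κ le_rfl).1)
  have hPle : ∫ x, P x ≤ (d + 1) * D * lam ^ 2 := by
    have e : ∫ x, P x = (∫ x : Rd d, ‖𝓕 m x‖ ^ 2) +
        ∑ i, ∫ x : Rd d, ‖(2 * Real.pi * Complex.I * x i) ^ κ * 𝓕 m x‖ ^ 2 := by
      rw [← integral_finsetSum _ (fun i _ => (hP i κ le_rfl).1)]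
      exact integral_add hP0.1 (integrable_finsetSum _ fun i _ => (hP i κ le_rfl).1)
    rw [e]
    have := Finset.sum_le_sum (s := Finset.univ) fun (i : Fin d) _ => (hP i κ le_rfl).2
    simp only [Finset.sum_const, Finset.card_univ, Fintype.card_fin, nsmul_eq_mul] at this
    nlinarith [hP0.2]
  have hpt : ∀ x : Rd d, (1 + ‖x‖) ^ (1 / 4 : ℝ) * ‖𝓕 m x‖ ≤
      B * lam⁻¹ * P x + lam * (1 + ‖x‖) ^ (-(2 * κ - 1 / 2 : ℝ)) := by
    intro x
    have hx1 : 0 < 1 + ‖x‖ := by positivity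
    have hPx : (1 + ‖x‖) ^ (2 * κ) * ‖𝓕 m x‖ ^ 2 ≤ B * P x := by
      have h1 : (1 + ∑ i, |x i| ^ (2 * κ)) * ‖𝓕 m x‖ ^ 2 ≤ P x := by
        rw [add_mul, one_mul, Finset.sum_mul]
        refine add_le_add le_rfl (Finset.sum_le_sum fun i _ => ?_)
        rw [norm_mul, mul_pow]
        gcongr
        rw [norm_pow, ← pow_mul, mul_comm κ 2]
        gcongr
        simp only [norm_mul, Complex.norm_ofNat, Complex.norm_real, Complex.norm_I, mul_one,
          Real.norm_eq_abs, abs_of_pos Real.pi_pos]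
        nlinarith [abs_nonneg (x i), Real.pi_gt_three]
      calc _ ≤ B * (1 + ∑ i, |x i| ^ (2 * κ)) * ‖𝓕 m x‖ ^ 2 := by
            gcongr; exact one_add_norm_pow_le κ hκ0 x
        _ ≤ _ := by rw [mul_assoc]; gcongr
    set u := (1 + ‖x‖) ^ (κ : ℝ) * ‖𝓕 m x‖ with hu
    set v := (1 + ‖x‖) ^ (-(κ - 1 / 4 : ℝ)) with hv
    have huv : (1 + ‖x‖) ^ (1 / 4 : ℝ) * ‖𝓕 m x‖ = u * v := by
      have : (1 + ‖x‖) ^ (1 / 4 : ℝ) = (1 + ‖x‖) ^ (κ : ℝ) * v := by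
        rw [hv, ← Real.rpow_add hx1]; congr 1; ring
      rw [this, hu]; ring
    have hu2 : u ^ 2 = (1 + ‖x‖) ^ (2 * κ) * ‖𝓕 m x‖ ^ 2 := by
      rw [hu, mul_pow, Real.rpow_natCast, ← pow_mul, mul_comm κ 2]
    have hv2 : v ^ 2 = (1 + ‖x‖) ^ (-(2 * κ - 1 / 2 : ℝ)) := by
      rw [hv, ← Real.rpow_natCast, ← Real.rpow_mul hx1.le]; congr 1; push_cast; ring
    rw [huv, ← hv2]
    -- Young's inequality weighted by `lam = C * M`: the integral of `P` is quadratic in `lam`, so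
    -- both terms become linear in `lam` after integration.
    have h3 : u * v ≤ lam⁻¹ * u ^ 2 + lam * v ^ 2 := by
      have h4 : lam⁻¹ * u ^ 2 + lam * v ^ 2 - 2 * (u * v) = lam⁻¹ * (u - lam * v) ^ 2 := by
        field_simp; ring
      have h5 : 0 ≤ lam⁻¹ * (u - lam * v) ^ 2 := by positivity
      have h6 : 0 ≤ lam⁻¹ * u ^ 2 + lam * v ^ 2 := by positivity
      linarith
    have h7 : lam⁻¹ * u ^ 2 ≤ lam⁻¹ * (B * P x) := by rw [hu2]; gcongr
    linarith
  have hR : Integrable (fun x : Rd d => B * lam⁻¹ * P x +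
      lam * (1 + ‖x‖) ^ (-(2 * κ - 1 / 2 : ℝ))) := (hPint.const_mul _).add (hIint.const_mul _)
  have hcF : Continuous (𝓕 m) := VectorFourier.fourierIntegral_continuous
    Real.continuous_fourierChar (by exact continuous_inner)
    (hmc.continuous.integrable_of_hasCompactSupport hms)
  have hL : Integrable (fun x : Rd d => (1 + ‖x‖) ^ (1 / 4 : ℝ) * ‖𝓕 m x‖) := by
    refine hR.mono' (Continuous.aestronglyMeasurable ?_) (Eventually.of_forall fun x => ?_)
    · exact ((continuous_const.add continuous_norm).rpow_const
        (fun x => Or.inr (by norm_num))).mul hcF.norm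
    · rw [Real.norm_of_nonneg (by positivity)]; exact hpt x
  refine ⟨hL, (integral_mono hL hR hpt).trans ?_⟩
  rw [integral_add (hPint.const_mul _) (hIint.const_mul _), integral_const_mul, integral_const_mul]
  have h8 : B * lam⁻¹ * ∫ x, P x ≤ B * lam⁻¹ * ((d + 1) * D * lam ^ 2) := by gcongr
  have h9 : B * lam⁻¹ * ((d + 1) * D * lam ^ 2) = B * (d + 1) * D * lam := by field_simp
  rw [← hI]
  linarith

/-! ### Kernel bounds at one scale. -/

/-- Integrability, decay and regularity bounds of a convolution kernel at the scale `1 / R`. -/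
structure KernelBound {d : ℕ} (C R : ℝ) (K : Rd d → ℂ) : Prop where
  integrable : Integrable K
  integrable_weight : Integrable fun x => ‖x‖ ^ (1 / 4 : ℝ) * ‖K x‖
  norm_le : ∫ x, ‖K x‖ ≤ C
  weight_le : ∫ x, ‖x‖ ^ (1 / 4 : ℝ) * ‖K x‖ ≤ C * R ^ (-(1 / 4) : ℝ)
  shift_le : ∀ h, ∫ x, ‖K (x + h) - K x‖ ≤ C * (R * ‖h‖)

theorem integral_comp_smul_scale {d : ℕ} (f : Rd d → ℝ) {R : ℝ} (hR : 0 < R) :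
    ∫ x, R ^ d * f (R • x) = ∫ x, f x := by
  rw [integral_const_mul, Measure.integral_comp_smul, finrank_euclideanSpace_fin,
    abs_of_nonneg (by positivity), smul_eq_mul, mul_inv_cancel_left₀ (by positivity)]

/-- This dilation preserves the L¹ norm, multiplies the moment by R^(-1/4) and turns a shift by h
into a shift by R h. Hence every frequency piece can be estimated at scale one. -/
theorem KernelBound.rescale {d : ℕ} {C R : ℝ} {K : Rd d → ℂ} (h : KernelBound C 1 K)
    (hR : 0 < R) : KernelBound C R (fun x => (R : ℂ) ^ d * K (R • x)) := by
  have hnorm : ∀ x, ‖(R : ℂ) ^ d * K (R • x)‖ = R ^ d * ‖K (R • x)‖ := fun x => by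
    rw [norm_mul, norm_pow, Complex.norm_real, Real.norm_of_nonneg hR.le]
  have hw : ∀ x : Rd d, ‖x‖ ^ (1 / 4 : ℝ) * ‖(R : ℂ) ^ d * K (R • x)‖ =
      R ^ (-(1 / 4) : ℝ) * (R ^ d * (‖R • x‖ ^ (1 / 4 : ℝ) * ‖K (R • x)‖)) := by
    intro x
    have e : ‖x‖ ^ (1 / 4 : ℝ) = R ^ (-(1 / 4) : ℝ) * ‖R • x‖ ^ (1 / 4 : ℝ) := by
      rw [norm_smul, Real.norm_of_nonneg hR.le, Real.mul_rpow hR.le (norm_nonneg _), ← mul_assoc,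
        ← Real.rpow_add hR]
      norm_num
    rw [hnorm, e]; ring
  refine ⟨?_, ?_, ?_, ?_, ?_⟩
  · exact ((integrable_comp_smul_iff volume K hR.ne').2 h.integrable).const_mul _
  · simp_rw [hw]
    exact (((integrable_comp_smul_iff volume _ hR.ne').2 h.integrable_weight).const_mul _).const_mul _
  · simp_rw [hnorm]
    rw [integral_comp_smul_scale (fun x => ‖K x‖) hR]
    exact h.norm_le
  · simp_rw [hw]
    rw [integral_const_mul, integral_comp_smul_scale (fun x => ‖x‖ ^ (1 / 4 : ℝ) * ‖K x‖) hR,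
      mul_comm]
    have := h.weight_le
    rw [Real.one_rpow, mul_one] at this
    gcongr
  · intro y
    have e : ∀ x, ‖(R : ℂ) ^ d * K (R • (x + y)) - (R : ℂ) ^ d * K (R • x)‖ =
        R ^ d * ‖K (R • x + R • y) - K (R • x)‖ := fun x => by
      rw [← mul_sub, norm_mul, norm_pow, Complex.norm_real, Real.norm_of_nonneg hR.le, smul_add]
    simp_rw [e]
    rw [integral_comp_smul_scale (fun x => ‖K (x + R • y) - K x‖) hR]
    have := h.shift_le (R • y)
    rwa [norm_smul, Real.norm_of_nonneg hR.le, one_mul] at this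

theorem fourier_rescale {d : ℕ} (K : Rd d → ℂ) {R : ℝ} (hR : 0 < R) (ξ : Rd d) :
    𝓕 (fun x => (R : ℂ) ^ d * K (R • x)) ξ = 𝓕 K (R⁻¹ • ξ) := by
  rw [Real.fourier_eq', Real.fourier_eq']
  have e : ∀ x : Rd d, Complex.exp (↑(-2 * Real.pi * inner ℝ x ξ) * Complex.I) •
      ((R : ℂ) ^ d * K (R • x)) = (R ^ d : ℝ) •
      ((fun y => Complex.exp (↑(-2 * Real.pi * inner ℝ y (R⁻¹ • ξ)) * Complex.I) • K y)
        (R • x)) := by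
    intro x
    have : inner ℝ (R • x) (R⁻¹ • ξ) = inner ℝ x ξ := by
      rw [inner_smul_left, inner_smul_right]; simp [hR.ne']
    simp only [this, smul_eq_mul, Complex.real_smul]
    push_cast
    ring
  simp_rw [e]
  rw [integral_smul, Measure.integral_comp_smul volume (fun y =>
    Complex.exp (↑(-2 * Real.pi * inner ℝ y (R⁻¹ • ξ)) * Complex.I) • K y),
    finrank_euclideanSpace_fin, abs_of_nonneg (by positivity), smul_smul, mul_inv_cancel₀ (by positivity), one_smul]

theorem iteratedDeriv_cexp_sub_one (a b : ℂ) (n : ℕ) (t : ℝ) :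
    iteratedDeriv n (fun s : ℝ => Complex.exp (a + b * s)) t = b ^ n * Complex.exp (a + b * t) ∧
    iteratedDeriv (n + 1) (fun s : ℝ => Complex.exp (a + b * s) - 1) t =
      b ^ (n + 1) * Complex.exp (a + b * t) := by
  have hd : ∀ t : ℝ, HasDerivAt (fun s : ℝ => Complex.exp (a + b * s))
      (b * Complex.exp (a + b * t)) t := by
    intro t
    have h1 : HasDerivAt (fun s : ℝ => a + b * (s : ℂ)) b t := by
      simpa using ((Complex.ofRealCLM.hasDerivAt (x := t)).const_mul b).const_add a
    simpa [mul_comm] using h1.cexp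
  have hfirst : ∀ n : ℕ, iteratedDeriv n (fun s : ℝ => Complex.exp (a + b * s)) =
      fun t : ℝ => b ^ n * Complex.exp (a + b * t) := by
    intro n
    induction n with
    | zero => simp
    | succ n ih =>
      rw [iteratedDeriv_succ, ih]
      funext t
      rw [((hd t).const_mul (b ^ n)).deriv, pow_succ]; ring
  refine ⟨congrFun (hfirst n) t, ?_⟩
  rw [iteratedDeriv_succ']
  have : deriv (fun s : ℝ => Complex.exp (a + b * s) - 1) =
      fun s : ℝ => b * Complex.exp (a + b * s) := by
    funext s; exact ((hd s).sub_const 1).deriv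
  rw [this, iteratedDeriv_const_mul_field, congrFun (hfirst n) t, pow_succ]; ring

/-- The function `ξ ↦ exp (2πi ⟨ξ, h⟩) - 1`, the symbol of the difference operator. -/
noncomputable def shiftSymbol {d : ℕ} (h ξ : Rd d) : ℂ :=
  Complex.exp (Complex.I * ((2 * Real.pi * inner ℝ ξ h : ℝ) : ℂ)) - 1

theorem contDiff_shiftSymbol {d : ℕ} (h : Rd d) (n : WithTop ℕ∞) : ContDiff ℝ n (shiftSymbol h) := by
  unfold shiftSymbol
  refine ContDiff.sub (ContDiff.cexp (contDiff_const.mul ?_)) contDiff_const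
  exact Complex.ofRealCLM.contDiff.comp (contDiff_const.mul (contDiff_id.inner ℝ contDiff_const))

/-- All derivatives must be linear in ‖h‖. At order zero this is |exp(iθ) - 1| ≤ |θ|; at higher
orders each derivative produces a factor 2π h i, and ‖h‖ ≤ 1 allows all but one power of ‖h‖ to be
dropped. -/
theorem norm_pderiv_shiftSymbol_le {d κ : ℕ} (hκ : 0 < κ) {h ξ : Rd d} (hh : ‖h‖ ≤ 1)
    (hξ : ‖ξ‖ ≤ 2) (i : Fin d) {n : ℕ} (hn : n ≤ κ) :
    ‖pderiv i n (shiftSymbol h) ξ‖ ≤ 2 * (2 * Real.pi) ^ κ * ‖h‖ := by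
  have h2pi : 1 ≤ 2 * Real.pi := by linarith [Real.pi_gt_three]
  cases n with
  | zero =>
    have e : pderiv i 0 (shiftSymbol h) ξ = shiftSymbol h ξ := by simp [pderiv]
    rw [e]
    have h1 := Real.norm_exp_I_mul_ofReal_sub_one_le (x := 2 * Real.pi * inner ℝ ξ h)
    have h2 : ‖(2 * Real.pi * inner ℝ ξ h : ℝ)‖ ≤ 2 * Real.pi * (2 * ‖h‖) := by
      rw [norm_mul, Real.norm_of_nonneg (by positivity)]
      gcongr
      exact (norm_inner_le_norm ξ h).trans (by gcongr)
    have h3 : 2 * Real.pi ≤ (2 * Real.pi) ^ κ := le_self_pow₀ h2pi hκ.ne'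
    calc _ ≤ 2 * Real.pi * (2 * ‖h‖) := h1.trans h2
      _ = 2 * (2 * Real.pi) * ‖h‖ := by ring
      _ ≤ _ := by gcongr
  | succ n =>
    rw [pderiv_eq_iteratedDeriv i _ (contDiff_shiftSymbol h _)]
    have e : (fun t : ℝ => shiftSymbol h (ξ + t • EuclideanSpace.single i (1 : ℝ))) =
        fun t : ℝ => Complex.exp (Complex.I * ((2 * Real.pi * inner ℝ ξ h : ℝ) : ℂ) +
          (2 * Real.pi * h i * Complex.I) * t) - 1 := by
      funext t
      unfold shiftSymbol
      rw [inner_add_left, inner_smul_left, EuclideanSpace.inner_single_left]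
      congr 2
      simp
      ring
    rw [e, (iteratedDeriv_cexp_sub_one _ _ n 0).2]
    have hi : |h i| ≤ ‖h‖ := by simpa using PiLp.norm_apply_le h i
    have e2 : ‖Complex.exp (Complex.I * ((2 * Real.pi * inner ℝ ξ h : ℝ) : ℂ) +
          (2 * Real.pi * h i * Complex.I) * ((0 : ℝ) : ℂ))‖ = 1 := by
      rw [Complex.ofReal_zero, mul_zero, add_zero, mul_comm, Complex.norm_exp_ofReal_mul_I]
    rw [norm_mul, e2, mul_one, norm_pow]
    have e3 : ‖(2 * Real.pi * h i * Complex.I : ℂ)‖ = 2 * Real.pi * |h i| := by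
      simp [abs_of_pos Real.pi_pos]
    rw [e3, mul_pow]
    have h4 : (2 * Real.pi) ^ (n + 1) ≤ (2 * Real.pi) ^ κ := pow_le_pow_right₀ h2pi hn
    have h5 : |h i| ^ (n + 1) ≤ ‖h‖ := by
      calc |h i| ^ (n + 1) ≤ ‖h‖ ^ (n + 1) := by gcongr
        _ ≤ ‖h‖ := pow_le_of_le_one (norm_nonneg _) hh (by omega)
    calc (2 * Real.pi) ^ (n + 1) * |h i| ^ (n + 1) ≤ (2 * Real.pi) ^ κ * ‖h‖ := by gcongr
      _ ≤ 2 * (2 * Real.pi) ^ κ * ‖h‖ := by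
          have : 0 ≤ (2 * Real.pi) ^ κ * ‖h‖ := by positivity
          linarith

theorem exists_pderiv_bound {d κ : ℕ} {ψ : Rd d → ℂ} (hψ : ContDiff ℝ κ ψ)
    (hs : HasCompactSupport ψ) : ∃ M : ℝ, 0 < M ∧ ∀ i, ∀ l ≤ κ, ∀ ξ, ‖pderiv i l ψ ξ‖ ≤ M := by
  have h1 : ∀ i : Fin d, ∀ l : ℕ, ∃ M : ℝ, 0 ≤ M ∧ (l ≤ κ → ∀ ξ, ‖pderiv i l ψ ξ‖ ≤ M) := by
    intro i l
    by_cases hl : l ≤ κ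
    · obtain ⟨M, hM⟩ := (continuous_pderiv i l (hψ.of_le (by exact_mod_cast hl))).bounded_above_of_compact_support
        (hasCompactSupport_pderiv i l hs)
      exact ⟨M, (norm_nonneg _).trans (hM 0), fun _ => hM⟩
    · exact ⟨0, le_rfl, fun h => absurd h hl⟩
  choose M hM0 hM using h1
  refine ⟨1 + ∑ i, ∑ l ∈ Finset.range (κ + 1), M i l, ?_, ?_⟩
  · have : 0 ≤ ∑ i, ∑ l ∈ Finset.range (κ + 1), M i l :=
      Finset.sum_nonneg fun i _ => Finset.sum_nonneg fun l _ => hM0 i l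
    linarith
  · intro i l hl ξ
    have h2 : M i l ≤ ∑ l ∈ Finset.range (κ + 1), M i l :=
      Finset.single_le_sum (f := fun l => M i l) (fun l _ => hM0 i l)
        (Finset.mem_range.2 (by omega))
    have h3 : ∑ l ∈ Finset.range (κ + 1), M i l ≤ ∑ i, ∑ l ∈ Finset.range (κ + 1), M i l :=
      Finset.single_le_sum (f := fun i => ∑ l ∈ Finset.range (κ + 1), M i l)
        (fun i _ => Finset.sum_nonneg fun l _ => hM0 i l) (Finset.mem_univ i)
    have := hM i l hl ξ
    linarith

theorem norm_pderiv_mul_shiftSymbol_le {d κ : ℕ} (hκ : 0 < κ) {ψ : Rd d → ℂ}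
    (hψ : ContDiff ℝ κ ψ) (hs : tsupport ψ ⊆ Metric.closedBall 0 2) {M : ℝ}
    (hM : ∀ i, ∀ l ≤ κ, ∀ ξ, ‖pderiv i l ψ ξ‖ ≤ M) {h : Rd d} (hh : ‖h‖ ≤ 1) (i : Fin d)
    {n : ℕ} (hn : n ≤ κ) (ξ : Rd d) :
    ‖pderiv i n (fun x => ψ x * shiftSymbol h x) ξ‖ ≤
      (κ + 1) * 2 ^ κ * M * (2 * (2 * Real.pi) ^ κ) * ‖h‖ := by
  have hM0 : 0 ≤ M := (norm_nonneg _).trans (hM i 0 (Nat.zero_le _) 0)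
  by_cases hξ : ξ ∈ tsupport ψ
  · rw [pderiv_mul i n (hψ.of_le (by exact_mod_cast hn)) (contDiff_shiftSymbol h _)]
    have hle : ‖∑ j ∈ Finset.range (n + 1),
        (n.choose j : ℂ) * pderiv i j ψ ξ * pderiv i (n - j) (shiftSymbol h) ξ‖ ≤
        ∑ j ∈ Finset.range (n + 1), 2 ^ κ * M * (2 * (2 * Real.pi) ^ κ * ‖h‖) := by
      refine norm_sum_le_of_le _ fun j hj => ?_
      have hj' : j ≤ n := by have := Finset.mem_range.1 hj; omega
      have hc : (n.choose j : ℝ) ≤ 2 ^ κ := by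
        calc (n.choose j : ℝ) ≤ 2 ^ n := by exact_mod_cast Nat.choose_le_two_pow n j
          _ ≤ 2 ^ κ := pow_le_pow_right₀ (by norm_num) hn
      rw [norm_mul, norm_mul, Complex.norm_natCast]
      gcongr
      · exact hM i j (hj'.trans hn) ξ
      · exact norm_pderiv_shiftSymbol_le hκ hh (by simpa using hs hξ) i ((Nat.sub_le n j).trans hn)
    refine hle.trans ?_
    rw [Finset.sum_const, Finset.card_range, nsmul_eq_mul]
    calc ((n + 1 : ℕ) : ℝ) * (2 ^ κ * M * (2 * (2 * Real.pi) ^ κ * ‖h‖))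
        ≤ (κ + 1) * (2 ^ κ * M * (2 * (2 * Real.pi) ^ κ * ‖h‖)) := by
          gcongr; exact_mod_cast Nat.succ_le_succ hn
      _ = _ := by ring
  · rw [pderiv_eq_zero_of_notMem i n fun h' => hξ (tsupport_mul_subset_left h'), norm_zero]
    positivity

/-- Differences of the kernel correspond to multiplying the symbol by `shiftSymbol`. The result is
written as a forward transform so that the weighted L¹ bound applies to it. -/
theorem fourierInv_add_sub {d : ℕ} {m : Rd d → ℂ} (hm : Integrable m) (x h : Rd d) :
    𝓕⁻ m (x + h) - 𝓕⁻ m x = 𝓕 (fun ξ => m ξ * shiftSymbol h ξ) (-x) := by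
  rw [Real.fourierInv_eq', Real.fourierInv_eq', Real.fourier_eq', ← integral_sub]
  · refine integral_congr_ae (Eventually.of_forall fun ξ => ?_)
    simp only [shiftSymbol, smul_eq_mul, inner_add_right, inner_neg_right]
    have : Complex.exp (↑(2 * Real.pi * (inner ℝ ξ x + inner ℝ ξ h)) * Complex.I) =
        Complex.exp (↑(2 * Real.pi * inner ℝ ξ x) * Complex.I) *
        Complex.exp (Complex.I * ((2 * Real.pi * inner ℝ ξ h : ℝ) : ℂ)) := by
      rw [← Complex.exp_add]; congr 1; push_cast; ring
    rw [this]
    have e2 : (-2 * Real.pi * -inner ℝ ξ x : ℝ) = 2 * Real.pi * inner ℝ ξ x := by ring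
    rw [e2]; ring
  all_goals
    refine hm.bdd_mul (c := 1) ?_ ?_
    · fun_prop
    · exact Eventually.of_forall fun ξ => (Complex.norm_exp_ofReal_mul_I _).le

/-- The norm and moment bounds are the weighted bound for the cut-off ψ. For ‖h‖ ≤ 1 the translation
bound is the same estimate with ψ replaced by ψ times `shiftSymbol h`, whose derivatives are O(‖h‖);
for larger h the triangle inequality is enough. -/
theorem exists_kernelBound (d κ : ℕ) (hd : 0 < d) (hκ : d + 1 ≤ 2 * κ) {ψ : Rd d → ℂ}
    (hψ : ContDiff ℝ κ ψ) {S : Set (Rd d)} (hS : IsCompact S) (hψS : tsupport ψ ⊆ S)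
    (hS2 : S ⊆ Metric.closedBall 0 2) :
    ∃ A : ℝ, 0 < A ∧ ∀ (g : Rd d → ℂ) (C : ℝ), ContDiff ℝ κ g → 0 < C →
      (∀ i, ∀ l ≤ κ, ∫ ξ in S, ‖pderiv i l g ξ‖ ^ 2 ≤ C ^ 2) →
      KernelBound (A * C) 1 (𝓕⁻ fun ξ => g ξ * ψ ξ) ∧
      𝓕 (𝓕⁻ fun ξ => g ξ * ψ ξ) = fun ξ => g ξ * ψ ξ := by
  obtain ⟨A, hA, hW⟩ := exists_weighted_fourier_bound d κ hd hκ
  have hκ0 : 0 < κ := by omega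
  have hψs : HasCompactSupport ψ := hS.of_isClosed_subset (isClosed_tsupport ψ) hψS
  obtain ⟨M, hM0, hM⟩ := exists_pderiv_bound hψ hψs
  set E : ℝ := (κ + 1) * 2 ^ κ * (2 * (2 * Real.pi) ^ κ) with hE
  -- The lower bound 2 absorbs the factor from the triangle inequality in the case ‖h‖ > 1.
  have hE2 : 2 ≤ E := by
    have h1 : (1 : ℝ) ≤ (2 * Real.pi) ^ κ := one_le_pow₀ (by linarith [Real.pi_gt_three])
    have h2 : (1 : ℝ) ≤ (κ + 1) * 2 ^ κ := by
      have : (1 : ℝ) ≤ 2 ^ κ := one_le_pow₀ (by norm_num)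
      have h3 : (0 : ℝ) ≤ κ := Nat.cast_nonneg _
      nlinarith
    nlinarith
  refine ⟨A * M * E, by positivity, ?_⟩
  intro g C hg hC hgS
  set m : Rd d → ℂ := fun ξ => g ξ * ψ ξ with hm
  have hmc : Continuous m := hg.continuous.mul hψ.continuous
  have hms : HasCompactSupport m := hψs.mul_left
  have hmi : Integrable m := hmc.integrable_of_hasCompactSupport hms
  obtain ⟨hw1, hw2⟩ := hW g ψ S C M hg hψ hS hψS hC hM0 hgS hM
  have hcF : Continuous (𝓕 m) := VectorFourier.fourierIntegral_continuous
    Real.continuous_fourierChar (by exact continuous_inner) hmi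
  have hge1 : ∀ x : Rd d, 1 ≤ (1 + ‖x‖) ^ (1 / 4 : ℝ) := fun x =>
    Real.one_le_rpow (by linarith [norm_nonneg x]) (by norm_num)
  have hdom : ∀ (f : Rd d → ℂ), Continuous f →
      Integrable (fun x => (1 + ‖x‖) ^ (1 / 4 : ℝ) * ‖f x‖) →
      Integrable f ∧ Integrable (fun x => ‖x‖ ^ (1 / 4 : ℝ) * ‖f x‖) ∧
      ∫ x, ‖f x‖ ≤ ∫ x, (1 + ‖x‖) ^ (1 / 4 : ℝ) * ‖f x‖ ∧
      ∫ x, ‖x‖ ^ (1 / 4 : ℝ) * ‖f x‖ ≤ ∫ x, (1 + ‖x‖) ^ (1 / 4 : ℝ) * ‖f x‖ := by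
    intro f hf hfi
    have i1 : ∀ x, ‖f x‖ ≤ (1 + ‖x‖) ^ (1 / 4 : ℝ) * ‖f x‖ := fun x =>
      le_mul_of_one_le_left (norm_nonneg _) (hge1 x)
    have i2 : ∀ x, ‖x‖ ^ (1 / 4 : ℝ) * ‖f x‖ ≤ (1 + ‖x‖) ^ (1 / 4 : ℝ) * ‖f x‖ := fun x => by
      gcongr; linarith
    have h1 : Integrable f := hfi.mono' hf.aestronglyMeasurable (Eventually.of_forall i1)
    have h2 : Integrable (fun x => ‖x‖ ^ (1 / 4 : ℝ) * ‖f x‖) := by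
      refine hfi.mono' (Continuous.aestronglyMeasurable ?_) (Eventually.of_forall fun x => ?_)
      · exact (continuous_norm.rpow_const fun x => Or.inr (by norm_num)).mul hf.norm
      · rw [Real.norm_of_nonneg (by positivity)]; exact i2 x
    exact ⟨h1, h2, integral_mono h1.norm hfi i1, integral_mono h2 hfi i2⟩
  obtain ⟨d1, d2, d3, d4⟩ := hdom (𝓕 m) hcF hw1
  have hk : (𝓕⁻ m) = fun x => 𝓕 m (-x) := funext fun x => Real.fourierInv_eq_fourier_neg m x
  have hnn : 0 ≤ A * (C * M) := by positivity
  have hb1 : A * (C * M) ≤ A * M * E * C := by nlinarith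
  have hki : Integrable (𝓕⁻ m) := by rw [hk]; exact d1.comp_neg
  have hkn : ∫ x, ‖(𝓕⁻ m) x‖ ≤ A * (C * M) := by
    rw [hk, integral_neg_eq_self (fun x => ‖𝓕 m x‖)]; exact d3.trans hw2
  refine ⟨⟨hki, ?_, hkn.trans hb1, ?_, ?_⟩, hmc.fourier_fourierInv_eq hmi d1⟩
  · rw [hk]; simpa using d2.comp_neg
  · rw [hk, Real.one_rpow, mul_one]
    have : ∫ x : Rd d, ‖x‖ ^ (1 / 4 : ℝ) * ‖𝓕 m (-x)‖ = ∫ x, ‖x‖ ^ (1 / 4 : ℝ) * ‖𝓕 m x‖ := by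
      rw [← integral_neg_eq_self (fun x : Rd d => ‖x‖ ^ (1 / 4 : ℝ) * ‖𝓕 m x‖)]
      simp
    rw [this]; exact (d4.trans hw2).trans hb1
  · intro h
    rw [one_mul]
    by_cases hh : ‖h‖ ≤ 1
    · rcases eq_or_ne h 0 with rfl | hh0
      · simp
      simp_rw [fourierInv_add_sub hmi]
      have hh1 : 0 < ‖h‖ := norm_pos_iff.2 hh0
      have hψh : ContDiff ℝ κ (fun ξ => ψ ξ * shiftSymbol h ξ) :=
        hψ.mul (contDiff_shiftSymbol h _)
      obtain ⟨v1, v2⟩ := hW g (fun ξ => ψ ξ * shiftSymbol h ξ) S C (M * E * ‖h‖) hg hψh hS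
        (tsupport_mul_subset_left.trans hψS) hC (by positivity) hgS (fun i l hl ξ => by
          refine (norm_pderiv_mul_shiftSymbol_le hκ0 hψ (hψS.trans hS2) hM hh i hl ξ).trans_eq ?_
          rw [hE]; ring)
      have e : (fun ξ => g ξ * (ψ ξ * shiftSymbol h ξ)) = fun ξ => m ξ * shiftSymbol h ξ := by
        funext ξ; rw [hm, mul_assoc]
      rw [e] at v1 v2
      have hms' : Integrable (fun ξ => m ξ * shiftSymbol h ξ) :=
        (hmc.mul (contDiff_shiftSymbol h 0).continuous).integrable_of_hasCompactSupport hms.mul_right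
      have hc' : Continuous (𝓕 fun ξ => m ξ * shiftSymbol h ξ) :=
        VectorFourier.fourierIntegral_continuous Real.continuous_fourierChar
          (by exact continuous_inner) hms'
      obtain ⟨-, -, w3, -⟩ := hdom _ hc' v1
      rw [integral_neg_eq_self (fun x => ‖𝓕 (fun ξ => m ξ * shiftSymbol h ξ) x‖)]
      refine (w3.trans v2).trans_eq ?_
      ring
    · have hh' : 1 < ‖h‖ := not_le.1 hh
      have h1 : Integrable (fun x => (𝓕⁻ m) (x + h)) := hki.comp_add_right h
      calc ∫ x, ‖(𝓕⁻ m) (x + h) - (𝓕⁻ m) x‖ ≤ ∫ x, (‖(𝓕⁻ m) (x + h)‖ + ‖(𝓕⁻ m) x‖) :=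
            integral_mono (h1.sub hki).norm (h1.norm.add hki.norm) fun x => norm_sub_le _ _
        _ = (∫ x, ‖(𝓕⁻ m) (x + h)‖) + ∫ x, ‖(𝓕⁻ m) x‖ := integral_add h1.norm hki.norm
        _ = 2 * ∫ x, ‖(𝓕⁻ m) x‖ := by
            have := integral_add_right_eq_self (μ := volume) (fun x => ‖(𝓕⁻ m) x‖) h
            linarith
        _ ≤ 2 * (A * (C * M)) := by gcongr
        _ ≤ E * (A * (C * M)) := by gcongr
        _ ≤ E * (A * (C * M)) * ‖h‖ := le_mul_of_one_le_right (by positivity) hh'.le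
        _ = _ := by ring

theorem KernelBound.mono {d : ℕ} {C C' R : ℝ} {K : Rd d → ℂ} (h : KernelBound C R K)
    (hC : C ≤ C') (hR : 0 < R) : KernelBound C' R K :=
  ⟨h.integrable, h.integrable_weight, h.norm_le.trans hC,
    h.weight_le.trans (by gcongr), fun y => (h.shift_le y).trans (by gcongr)⟩

theorem norm_fourier_le {d : ℕ} (f : Rd d → ℂ) (ξ : Rd d) : ‖𝓕 f ξ‖ ≤ ∫ x, ‖f x‖ :=
  VectorFourier.norm_fourierIntegral_le_integral_norm _ _ _ _ _

/-! ### Littlewood–Paley decomposition of the symbol. -/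

theorem isClosed_annulus (d : ℕ) : IsClosed {ξ : Rd d | 1 / 2 ≤ ‖ξ‖ ∧ ‖ξ‖ ≤ 2} :=
  (isClosed_le continuous_const continuous_norm).inter
    (isClosed_le continuous_norm continuous_const)

theorem isCompact_annulus (d : ℕ) : IsCompact {ξ : Rd d | 1 / 2 ≤ ‖ξ‖ ∧ ‖ξ‖ ≤ 2} :=
  (isCompact_closedBall (0 : Rd d) 2).of_isClosed_subset (isClosed_annulus d)
    fun ξ hξ => by simpa using hξ.2

-- The condition is scale invariant: the powers R^(2l), R^(-d) and R^(d-2l) cancel. The dilated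
-- annulus has ratio 4, so it is covered by two dyadic annuli, the outer one contributing the factor
-- 2^(d-2l) ≤ 2^d.
open scoped Pointwise in
theorem integral_annulus_pderiv_comp_smul_le {d κ : ℕ} {a : Rd d → ℂ} (ha : ContDiff ℝ κ a)
    {k : ℝ} (hak : HormanderMikhlin κ k a) {R : ℝ} (hR : 0 < R) (i : Fin d) {l : ℕ} (hl : l ≤ κ) :
    ∫ ξ in {ξ : Rd d | 1 / 2 ≤ ‖ξ‖ ∧ ‖ξ‖ ≤ 2}, ‖pderiv i l (fun x => a (R • x)) ξ‖ ^ 2 ≤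
      (k * (1 + 2 ^ d)) ^ 2 := by
  have hal : ContDiff ℝ l a := ha.of_le (by exact_mod_cast hl)
  have hcont : Continuous fun ξ => ‖pderiv i l a ξ‖ ^ 2 := (continuous_pderiv i l hal).norm.pow 2
  have hsum : ∑ j, (Pi.single i l : Fin d → ℕ) j = l := by simp
  have hA : ∀ r : ℝ, 0 < r → IntegrableOn (fun ξ => ‖pderiv i l a ξ‖ ^ 2)
      {ξ : Rd d | r / 2 ≤ ‖ξ‖ ∧ ‖ξ‖ ≤ r} ∧
      ∫ ξ in {ξ : Rd d | r / 2 ≤ ‖ξ‖ ∧ ‖ξ‖ ≤ r}, ‖pderiv i l a ξ‖ ^ 2 ≤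
        k ^ 2 * r ^ ((d : ℤ) - 2 * l) := by
    intro r hr
    constructor
    · refine (hcont.continuousOn.integrableOn_compact (isCompact_closedBall (0 : Rd d) r)).mono_set ?_
      intro ξ hξ
      simpa using hξ.2
    · have := hak r hr (Pi.single i l) (by rw [hsum]; exact hl)
      simpa only [multiDeriv_single, hsum] using this
  have hset : R • {ξ : Rd d | 1 / 2 ≤ ‖ξ‖ ∧ ‖ξ‖ ≤ 2} ⊆
      {ξ : Rd d | R / 2 ≤ ‖ξ‖ ∧ ‖ξ‖ ≤ R} ∪ {ξ : Rd d | (2 * R) / 2 ≤ ‖ξ‖ ∧ ‖ξ‖ ≤ 2 * R} := by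
    rintro _ ⟨ξ, ⟨h1, h2⟩, rfl⟩
    simp only [Set.mem_union, Set.mem_ofPred_eq, norm_smul, Real.norm_of_nonneg hR.le]
    rcases le_total ‖ξ‖ 1 with h | h
    · left; constructor <;> nlinarith
    · right; constructor <;> nlinarith
  have e : ∀ ξ : Rd d, ‖pderiv i l (fun x => a (R • x)) ξ‖ ^ 2 =
      R ^ (2 * l) * ‖pderiv i l a (R • ξ)‖ ^ 2 := by
    intro ξ
    rw [pderiv_comp_smul i l hal, norm_mul, norm_pow, Complex.norm_real,
      Real.norm_of_nonneg hR.le, mul_pow, ← pow_mul, mul_comm l 2]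
  simp_rw [e]
  rw [integral_const_mul, Measure.setIntegral_comp_smul volume (fun ξ => ‖pderiv i l a ξ‖ ^ 2) _
    hR.ne', finrank_euclideanSpace_fin, abs_of_nonneg (by positivity), smul_eq_mul]
  have h1 := hA R hR
  have h2 := hA (2 * R) (by positivity)
  have h3 : ∫ ξ in R • {ξ : Rd d | 1 / 2 ≤ ‖ξ‖ ∧ ‖ξ‖ ≤ 2}, ‖pderiv i l a ξ‖ ^ 2 ≤
      k ^ 2 * R ^ ((d : ℤ) - 2 * l) + k ^ 2 * (2 * R) ^ ((d : ℤ) - 2 * l) := by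
    calc _ ≤ ∫ ξ in {ξ : Rd d | R / 2 ≤ ‖ξ‖ ∧ ‖ξ‖ ≤ R} ∪
              {ξ : Rd d | (2 * R) / 2 ≤ ‖ξ‖ ∧ ‖ξ‖ ≤ 2 * R}, ‖pderiv i l a ξ‖ ^ 2 :=
          setIntegral_mono_set (h1.1.union h2.1) (Eventually.of_forall fun ξ => by positivity)
            hset.eventuallyLE
      _ ≤ ∫ ξ, ‖pderiv i l a ξ‖ ^ 2 ∂(volume.restrict {ξ : Rd d | R / 2 ≤ ‖ξ‖ ∧ ‖ξ‖ ≤ R} +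
              volume.restrict {ξ : Rd d | (2 * R) / 2 ≤ ‖ξ‖ ∧ ‖ξ‖ ≤ 2 * R}) :=
          integral_mono_measure (Measure.restrict_union_le _ _)
            (Eventually.of_forall fun ξ => by positivity) (Integrable.add_measure h1.1 h2.1)
      _ = _ := integral_add_measure h1.1 h2.1
      _ ≤ _ := add_le_add h1.2 h2.2
  have hz : R ^ (2 * l) * ((R ^ d)⁻¹ * R ^ ((d : ℤ) - 2 * l)) = 1 := by
    rw [zpow_sub₀ hR.ne']
    have : R ^ (2 * (l : ℤ)) = R ^ (2 * l) := by exact_mod_cast zpow_natCast R (2 * l)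
    rw [this, zpow_natCast]
    field_simp
  have h4 : (2 : ℝ) ^ ((d : ℤ) - 2 * l) ≤ 2 ^ d := by
    rw [← zpow_natCast]
    exact zpow_le_zpow_right₀ (by norm_num) (by omega)
  calc R ^ (2 * l) * ((R ^ d)⁻¹ * ∫ ξ in R • {ξ : Rd d | 1 / 2 ≤ ‖ξ‖ ∧ ‖ξ‖ ≤ 2},
          ‖pderiv i l a ξ‖ ^ 2)
      ≤ R ^ (2 * l) * ((R ^ d)⁻¹ * (k ^ 2 * R ^ ((d : ℤ) - 2 * l) +
          k ^ 2 * (2 * R) ^ ((d : ℤ) - 2 * l))) := by gcongr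
    _ = (R ^ (2 * l) * ((R ^ d)⁻¹ * R ^ ((d : ℤ) - 2 * l))) *
          (k ^ 2 * (1 + 2 ^ ((d : ℤ) - 2 * l))) := by rw [mul_zpow]; ring
    _ = k ^ 2 * (1 + 2 ^ ((d : ℤ) - 2 * l)) := by rw [hz, one_mul]
    _ ≤ k ^ 2 * (1 + 2 ^ d) := by gcongr
    _ ≤ k ^ 2 * (1 + 2 ^ d) ^ 2 := by
        gcongr
        have : (0 : ℝ) < 2 ^ d := by positivity
        nlinarith
    _ = _ := by ring

/-- The cut-offs χ(2^(-N) ξ) telescope. Differences of consecutive ones are dilates of φ, supported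
in an annulus, where the symbol condition gives constants independent of the scale. The single piece
around the origin needs only that `a` is C^κ on a compact ball. -/
theorem exists_kernel_sequence {d : ℕ} (hd : 0 < d) {a : Rd d → ℂ}
    (ha : ContDiff ℝ (d / 2 + 1 : ℕ) a) {k : ℝ} (hk : 0 < k)
    (hak : HormanderMikhlin (d / 2 + 1) k a) :
    ∃ C : ℝ, 0 < C ∧ ∃ K : ℕ → Rd d → ℂ, (∀ j, KernelBound C (2 ^ j) (K j)) ∧
      (∀ ξ, ‖a ξ‖ ≤ C) ∧ (∀ N ξ, ‖∑ j ∈ Finset.range N, 𝓕 (K j) ξ‖ ≤ C) ∧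
      ∀ ξ, ∀ᶠ N in atTop, ∑ j ∈ Finset.range N, 𝓕 (K j) ξ = a ξ := by
  have hκ : d + 1 ≤ 2 * (d / 2 + 1) := by omega
  set κ := d / 2 + 1 with hκdef
  let bump : ContDiffBump (0 : Rd d) := ⟨1, 2, one_pos, one_lt_two⟩
  let χ : Rd d → ℂ := fun ξ => (bump ξ : ℂ)
  have hχ1 : ∀ ξ : Rd d, ‖ξ‖ ≤ 1 → χ ξ = 1 := fun ξ h => by
    have : bump ξ = 1 := bump.one_of_mem_closedBall (by simpa using h)
    simp [χ, this]
  have hχ0 : ∀ ξ : Rd d, 2 ≤ ‖ξ‖ → χ ξ = 0 := fun ξ h => by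
    have : bump ξ = 0 := bump.zero_of_le_dist (by simpa using h)
    simp [χ, this]
  have hχle : ∀ ξ : Rd d, ‖χ ξ‖ ≤ 1 := fun ξ => by
    simp only [χ, Complex.norm_real, Real.norm_of_nonneg bump.nonneg]
    exact bump.le_one
  have hχc : ContDiff ℝ κ χ := Complex.ofRealCLM.contDiff.comp (bump.contDiff (n := (κ : ℕ∞)))
  have hχs : tsupport χ ⊆ Metric.closedBall 0 2 := by
    refine closure_minimal (fun ξ hξ => ?_) Metric.isClosed_closedBall
    by_contra h
    exact hξ (hχ0 ξ (le_of_lt (by simpa using h)))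
  let φ : Rd d → ℂ := fun ξ => χ ξ - χ ((2 : ℝ) • ξ)
  have hφc : ContDiff ℝ κ φ := hχc.sub (hχc.comp (contDiff_const_smul (2 : ℝ)))
  have hφs : tsupport φ ⊆ {ξ : Rd d | 1 / 2 ≤ ‖ξ‖ ∧ ‖ξ‖ ≤ 2} := by
    refine closure_minimal (fun ξ hξ => ?_) (isClosed_annulus d)
    have h2 : ‖(2 : ℝ) • ξ‖ = 2 * ‖ξ‖ := by rw [norm_smul]; norm_num
    constructor
    · by_contra h
      rw [not_le] at h
      refine hξ ?_
      simp only [φ]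
      rw [hχ1 ξ (by linarith), hχ1 _ (by rw [h2]; linarith), sub_self]
    · by_contra h
      rw [not_le] at h
      refine hξ ?_
      simp only [φ]
      rw [hχ0 ξ (by linarith), hχ0 _ (by rw [h2]; linarith), sub_self]
  obtain ⟨A0, hA0, hK0⟩ := exists_kernelBound d κ hd hκ hχc (isCompact_closedBall (0 : Rd d) 2) hχs
    subset_rfl
  obtain ⟨A1, hA1, hK1⟩ := exists_kernelBound d κ hd hκ hφc (isCompact_annulus d) hφs
    (fun ξ hξ => by simpa using hξ.2)
  obtain ⟨C0, hC0, hC0'⟩ : ∃ C0 : ℝ, 0 < C0 ∧ ∀ i, ∀ l ≤ κ,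
      ∫ ξ in Metric.closedBall (0 : Rd d) 2, ‖pderiv i l a ξ‖ ^ 2 ≤ C0 ^ 2 := by
    have hnn : ∀ i l, 0 ≤ ∫ ξ in Metric.closedBall (0 : Rd d) 2, ‖pderiv i l a ξ‖ ^ 2 :=
      fun i l => integral_nonneg fun ξ => by positivity
    set T := ∑ i, ∑ l ∈ Finset.range (κ + 1),
      ∫ ξ in Metric.closedBall (0 : Rd d) 2, ‖pderiv i l a ξ‖ ^ 2 with hT
    have hT0 : 0 ≤ T := Finset.sum_nonneg fun i _ => Finset.sum_nonneg fun l _ => hnn i l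
    refine ⟨1 + T, by linarith, fun i l hl => ?_⟩
    have h2 := Finset.single_le_sum
      (f := fun l => ∫ ξ in Metric.closedBall (0 : Rd d) 2, ‖pderiv i l a ξ‖ ^ 2)
      (fun l _ => hnn i l) (Finset.mem_range.2 (show l < κ + 1 by omega))
    have h3 := Finset.single_le_sum (f := fun i => ∑ l ∈ Finset.range (κ + 1),
      ∫ ξ in Metric.closedBall (0 : Rd d) 2, ‖pderiv i l a ξ‖ ^ 2)
      (fun i _ => Finset.sum_nonneg fun l _ => hnn i l) (Finset.mem_univ i)
    nlinarith
  set C := max (A0 * C0) (A1 * (k * (1 + 2 ^ d))) with hCdef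
  have hCpos : 0 < C := lt_max_of_lt_left (by positivity)
  let cut : ℕ → Rd d → ℂ := fun N ξ => χ (((2 : ℝ) ^ N)⁻¹ • ξ)
  have hstep : ∀ j, ∃ K : Rd d → ℂ, KernelBound C (2 ^ (j + 1)) K ∧
      ∀ ξ, 𝓕 K ξ = a ξ * (cut (j + 1) ξ - cut j ξ) := by
    intro j
    set R : ℝ := 2 ^ (j + 1) with hR
    have hRpos : 0 < R := by positivity
    obtain ⟨hb, hF⟩ := hK1 (fun x => a (R • x)) (k * (1 + 2 ^ d))
      (ha.comp (contDiff_const_smul R)) (by positivity)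
      (fun i l hl => integral_annulus_pderiv_comp_smul_le ha hak hRpos i hl)
    refine ⟨_, (hb.mono (le_max_right _ _) one_pos).rescale hRpos, fun ξ => ?_⟩
    rw [fourier_rescale _ hRpos, hF]
    simp only [smul_smul, mul_inv_cancel₀ hRpos.ne', one_smul, φ, cut]
    have : 2 * R⁻¹ = ((2 : ℝ) ^ j)⁻¹ := by rw [hR, pow_succ]; field_simp
    rw [this]
  choose K' hK'1 hK'2 using hstep
  obtain ⟨hb0, hF0⟩ := hK0 a C0 ha hC0 hC0'
  let K : ℕ → Rd d → ℂ := fun j => Nat.casesOn j (𝓕⁻ fun ξ => a ξ * χ ξ) K'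
  have hKb : ∀ j, KernelBound C (2 ^ j) (K j) := by
    rintro (_ | j)
    · rw [pow_zero]
      exact hb0.mono (le_max_left _ _) one_pos
    · exact hK'1 j
  have hKF0 : ∀ ξ, 𝓕 (K 0) ξ = a ξ * cut 0 ξ := fun ξ => by
    have := congrFun hF0 ξ
    simpa [K, cut] using this
  have hsum : ∀ N ξ, ∑ j ∈ Finset.range (N + 1), 𝓕 (K j) ξ = a ξ * cut N ξ := by
    intro N ξ
    induction N with
    | zero => simpa using hKF0 ξ
    | succ N ih =>
      rw [Finset.sum_range_succ, ih, show K (N + 1) = K' N from rfl, hK'2]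
      ring
  have hFle : ∀ j ξ, ‖𝓕 (K j) ξ‖ ≤ C := fun j ξ => (norm_fourier_le _ _).trans (hKb j).norm_le
  have hcutnorm : ∀ (N : ℕ) (ξ : Rd d), ‖((2 : ℝ) ^ N)⁻¹ • ξ‖ = ‖ξ‖ / 2 ^ N := fun N ξ => by
    rw [norm_smul, norm_inv, norm_pow, Real.norm_ofNat]; field_simp
  have hcut1 : ∀ (N : ℕ) (ξ : Rd d), ‖ξ‖ ≤ 2 ^ N → cut N ξ = 1 := fun N ξ h =>
    hχ1 _ (by rw [hcutnorm, div_le_one (by positivity)]; exact h)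
  have hcut0 : ∀ (N : ℕ) (ξ : Rd d), 2 ^ (N + 1) ≤ ‖ξ‖ → cut N ξ = 0 := fun N ξ h =>
    hχ0 _ (by rw [hcutnorm, le_div_iff₀ (by positivity)]; rw [pow_succ] at h; linarith)
  have hale : ∀ ξ, ‖a ξ‖ ≤ 2 * C := by
    intro ξ
    rcases le_total ‖ξ‖ 1 with h | h
    · have e := hKF0 ξ
      rw [hcut1 0 ξ (by simpa using h), mul_one] at e
      rw [← e]
      linarith [hFle 0 ξ]
    -- For 2^n ≤ ‖ξ‖ < 2^(n+1) only the pieces n and n + 1 can contribute at ξ, which bounds `a ξ`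
    -- by twice the bound of one piece.
    · obtain ⟨n, hn1, hn2⟩ := exists_nat_pow_near h one_lt_two
      have e1 := hsum (n + 1) ξ
      rw [hcut1 (n + 1) ξ hn2.le, mul_one, Finset.sum_range_succ, Finset.sum_range_succ] at e1
      have e2 : ∑ j ∈ Finset.range n, 𝓕 (K j) ξ = 0 := by
        cases n with
        | zero => simp
        | succ n => rw [hsum n ξ, hcut0 n ξ hn1, mul_zero]
      rw [e2, zero_add] at e1
      rw [← e1]
      refine (norm_add_le _ _).trans ?_
      linarith [hFle n ξ, hFle (n + 1) ξ]
  refine ⟨2 * C, by positivity, K, fun j => (hKb j).mono (by linarith) (by positivity), hale, ?_, ?_⟩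
  · rintro (_ | N) ξ
    · simp; positivity
    · rw [hsum, norm_mul]
      calc ‖a ξ‖ * ‖cut N ξ‖ ≤ ‖a ξ‖ * 1 := by gcongr; exact hχle _
        _ ≤ 2 * C := by rw [mul_one]; exact hale ξ
  · intro ξ
    obtain ⟨n, hn⟩ := pow_unbounded_of_one_lt ‖ξ‖ one_lt_two
    filter_upwards [eventually_ge_atTop (n + 1)] with N hN
    obtain ⟨m, rfl⟩ : ∃ m, N = m + 1 := ⟨N - 1, by omega⟩
    rw [hsum, hcut1 m ξ, mul_one]
    exact hn.le.trans (pow_le_pow_right₀ one_le_two (by omega))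

/-! ### A Bellman function for the John–Nirenberg inequality. -/

/-- With q(t) = 1 + 4t - t², Taylor's formula at z has the exact remainder -(y - z)². This concavity
gain absorbs the cross term c δ (q(y) - q(z)), leaving only terms linear in y - z and δ and a
multiple of δ². -/
theorem bellman_pointwise {c y z δ : ℝ} (hc0 : 0 ≤ c) (hc : c ≤ 1 / 2) (hy0 : 0 ≤ y) (hy1 : y ≤ 1)
    (hz0 : 0 ≤ z) (hz1 : z ≤ 1) (hδ : |c * δ| ≤ 1) :
    Real.exp (c * δ) * (1 + 4 * y - y ^ 2) ≤ (1 + 4 * z - z ^ 2) + (4 - 2 * z) * (y - z) +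
      c * (1 + 4 * z - z ^ 2) * δ + 2 * δ ^ 2 := by
  have h1 : Real.exp (c * δ) ≤ 1 + c * δ + (c * δ) ^ 2 := by
    have := (abs_le.1 (Real.abs_exp_sub_one_sub_id_le hδ)).2
    linarith
  have hh0 : 0 ≤ 1 + 4 * y - y ^ 2 := by nlinarith
  have hh4 : 1 + 4 * y - y ^ 2 ≤ 4 := by nlinarith
  have h2 := mul_le_mul_of_nonneg_right h1 hh0
  refine h2.trans ?_
  have h3 : (c * δ) ^ 2 * (1 + 4 * y - y ^ 2) ≤ δ ^ 2 := by
    have : c ^ 2 ≤ 1 / 4 := by nlinarith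
    calc (c * δ) ^ 2 * (1 + 4 * y - y ^ 2) ≤ (c * δ) ^ 2 * 4 := by gcongr
      _ = c ^ 2 * (4 * δ ^ 2) := by ring
      _ ≤ 1 / 4 * (4 * δ ^ 2) := by gcongr
      _ = δ ^ 2 := by ring
  have h4 : c * δ * ((1 + 4 * y - y ^ 2) - (1 + 4 * z - z ^ 2)) ≤ (y - z) ^ 2 + δ ^ 2 := by
    have e : c * δ * ((1 + 4 * y - y ^ 2) - (1 + 4 * z - z ^ 2)) =
        (c * (4 - y - z)) * (δ * (y - z)) := by ring
    have h5 : 0 ≤ c * (4 - y - z) := mul_nonneg hc0 (by linarith)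
    have h6 : c * (4 - y - z) ≤ 2 := by nlinarith
    rw [e]
    have h7 : δ * (y - z) ≤ ((y - z) ^ 2 + δ ^ 2) / 2 := by nlinarith [sq_nonneg (δ - (y - z))]
    calc _ ≤ (c * (4 - y - z)) * (((y - z) ^ 2 + δ ^ 2) / 2) := by gcongr
      _ ≤ 2 * (((y - z) ^ 2 + δ ^ 2) / 2) := by gcongr
      _ = _ := by ring
  nlinarith

/-- One step of the Bellman induction for the function `exp (c x) (1 + 4 v - v ^ 2)` of the mean
`x` and the variance `v`. -/
theorem bellman_step {ι : Type*} [Fintype ι] [Nonempty ι] {c : ℝ}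
    (hc0 : 0 ≤ c) (hc : c * (2 * Fintype.card ι) ≤ 1) {m v : ι → ℝ} {m' v' : ℝ}
    (hv0 : ∀ i, 0 ≤ v i) (hv1 : ∀ i, v i ≤ 1) (hv' : v' ≤ 1)
    (hm' : ∑ i, m i = Fintype.card ι * m')
    (hvv : ∑ i, (v i + (m i - m') ^ 2) = Fintype.card ι * v') :
    ∑ i, Real.exp (c * m i) * (1 + 4 * v i - v i ^ 2) ≤
      Fintype.card ι * (Real.exp (c * m') * (1 + 4 * v' - v' ^ 2)) := by
  set N : ℝ := ((Fintype.card ι : ℕ) : ℝ) with hN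
  have hN1 : 1 ≤ N := by rw [hN]; exact_mod_cast Fintype.card_pos
  have hc2 : c ≤ 1 / 2 := by nlinarith
  set z : ℝ := (∑ i, v i) / N with hz
  set w : ℝ := (∑ i, (m i - m') ^ 2) / N with hw
  have hzN : ∑ i, v i = N * z := by rw [hz]; field_simp
  have hwN : ∑ i, (m i - m') ^ 2 = N * w := by rw [hw]; field_simp
  have hzw : z + w = v' := by
    rw [Finset.sum_add_distrib, hzN, hwN, ← mul_add] at hvv
    exact mul_left_cancel₀ (by positivity) hvv
  have hz0 : 0 ≤ z := div_nonneg (Finset.sum_nonneg fun i _ => hv0 i) (by positivity)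
  have hw0 : 0 ≤ w := div_nonneg (Finset.sum_nonneg fun i _ => sq_nonneg _) (by positivity)
  have hδ : ∀ i, |c * (m i - m')| ≤ 1 := by
    intro i
    have h1 : (m i - m') ^ 2 ≤ N := by
      have := Finset.single_le_sum (f := fun i => (m i - m') ^ 2) (fun i _ => sq_nonneg _)
        (Finset.mem_univ i)
      simp only [hwN] at this
      nlinarith
    have h2 : |m i - m'| ≤ N := abs_le_of_sq_le_sq (h1.trans (by nlinarith)) (by positivity)
    rw [abs_mul, abs_of_nonneg hc0]
    calc c * |m i - m'| ≤ c * N := by gcongr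
      _ ≤ 1 := by nlinarith
  have hterm : ∀ i, Real.exp (c * m i) * (1 + 4 * v i - v i ^ 2) ≤ Real.exp (c * m') *
      ((1 + 4 * z - z ^ 2) + (4 - 2 * z) * (v i - z) +
      c * (1 + 4 * z - z ^ 2) * (m i - m') + 2 * (m i - m') ^ 2) := by
    intro i
    have h1 := bellman_pointwise hc0 hc2 (hv0 i) (hv1 i) hz0 (by linarith) (hδ i)
    have e : Real.exp (c * m i) = Real.exp (c * m') * Real.exp (c * (m i - m')) := by
      rw [← Real.exp_add]; congr 1; ring
    rw [e, mul_assoc]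
    gcongr
  -- The linear terms vanish because z is the mean of the v i and m' the mean of the m i.
  have hsum : ∑ i, ((1 + 4 * z - z ^ 2) + (4 - 2 * z) * (v i - z) +
      c * (1 + 4 * z - z ^ 2) * (m i - m') + 2 * (m i - m') ^ 2) =
      N * ((1 + 4 * z - z ^ 2) + 2 * w) := by
    simp only [Finset.sum_add_distrib, ← Finset.mul_sum, Finset.sum_sub_distrib, hzN, hm', hwN,
      Finset.sum_const, Finset.card_univ, nsmul_eq_mul, ← hN]
    ring
  calc _ ≤ ∑ i, Real.exp (c * m') *
      ((1 + 4 * z - z ^ 2) + (4 - 2 * z) * (v i - z) +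
      c * (1 + 4 * z - z ^ 2) * (m i - m') + 2 * (m i - m') ^ 2) :=
        Finset.sum_le_sum fun i _ => hterm i
    _ = N * (Real.exp (c * m') * ((1 + 4 * z - z ^ 2) + 2 * w)) := by
        rw [← Finset.mul_sum, hsum]; ring
    _ ≤ _ := by
        -- Here v' = z + w, and the derivative 4 - 2t is at least 2 on [0, 1], so passing from z to
        -- v' gains at least 2w.
        gcongr
        rw [← hzw]
        nlinarith

/-! ### Dyadic cubes, averages and exponential integrability. -/

/-- The dyadic cube of side `2 ^ (-n)` with corner `2 ^ (-n) k`. -/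
def dcube {d : ℕ} (n : ℕ) (k : Fin d → ℤ) : Set (Rd d) :=
  {y | ∀ i, ⌊(2 : ℝ) ^ n * y i⌋ = k i}

theorem measurableSet_dcube {d : ℕ} (n : ℕ) (k : Fin d → ℤ) : MeasurableSet (dcube n k) := by
  have : dcube n k = ⋂ i, {y : Rd d | ⌊(2 : ℝ) ^ n * y i⌋ = k i} := by
    ext y; simp [dcube]
  rw [this]
  refine MeasurableSet.iInter fun i => ?_
  have hm : Measurable fun y : Rd d => ⌊(2 : ℝ) ^ n * y i⌋ := by
    refine Int.measurable_floor.comp (Continuous.measurable ?_)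
    fun_prop
  exact hm (measurableSet_singleton (k i))

theorem volume_dcube {d : ℕ} (n : ℕ) (k : Fin d → ℤ) :
    volume (dcube n k) = ENNReal.ofReal (((2 : ℝ) ^ (n * d))⁻¹) := by
  have h1 : dcube n k = (WithLp.ofLp : Rd d → Fin d → ℝ) ⁻¹'
      (Set.pi Set.univ fun i => Set.Ico ((k i : ℝ) / 2 ^ n) ((k i + 1 : ℝ) / 2 ^ n)) := by
    ext y
    simp only [dcube, Set.mem_ofPred_eq, Set.mem_preimage, Set.mem_pi, Set.mem_univ, true_imp_iff,
      Set.mem_Ico, Int.floor_eq_iff]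
    refine forall_congr' fun i => and_congr ?_ ?_
    · rw [div_le_iff₀ (by positivity), mul_comm]
    · rw [lt_div_iff₀ (by positivity), mul_comm]
  rw [h1, (PiLp.volume_preserving_ofLp (Fin d)).measure_preimage
    (MeasurableSet.univ_pi fun i => measurableSet_Ico).nullMeasurableSet, Real.volume_pi_Ico]
  have e : ∀ i, ((k i + 1 : ℝ) / 2 ^ n) - ((k i : ℝ) / 2 ^ n) = (2 ^ n)⁻¹ := fun i => by
    field_simp; ring
  simp only [e, Finset.prod_const, Finset.card_univ, Fintype.card_fin]
  rw [← ENNReal.ofReal_pow (by positivity), inv_pow, ← pow_mul]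

theorem norm_sub_le_of_mem_dcube {d n : ℕ} {k : Fin d → ℤ} {x y : Rd d} (hx : x ∈ dcube n k)
    (hy : y ∈ dcube n k) : ‖x - y‖ ≤ d * (2 ^ n)⁻¹ := by
  have h1 : ‖x - y‖ ≤ ∑ i, |(x - y) i| := by
    rw [EuclideanSpace.norm_eq]
    refine Real.sqrt_le_iff.2 ⟨Finset.sum_nonneg fun i _ => abs_nonneg _, ?_⟩
    simpa using Finset.sum_sq_le_sq_sum_of_nonneg (s := Finset.univ) (f := fun i => |(x - y) i|)
      (fun i _ => abs_nonneg _)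
  refine h1.trans ((Finset.sum_le_sum fun i _ => ?_).trans_eq (b := ∑ i : Fin d, (2 ^ n : ℝ)⁻¹)
    (by simp))
  have h2 := Int.abs_sub_lt_one_of_floor_eq_floor ((hx i).trans (hy i).symm)
  rw [← mul_sub, abs_mul, abs_of_pos (by positivity)] at h2
  rw [← one_div, le_div_iff₀ (by positivity), mul_comm]
  exact h2.le

theorem dcube_eq_iUnion {d : ℕ} (n : ℕ) (k : Fin d → ℤ) :
    dcube n k = ⋃ ε : Fin d → Fin 2, dcube (n + 1) (fun i => 2 * k i + (ε i : ℕ)) := by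
  ext y
  simp only [dcube, Set.mem_iUnion, Set.mem_ofPred_eq]
  have key : ∀ i, ∀ e : ℤ, ⌊(2 : ℝ) ^ (n + 1) * y i⌋ = e ↔
      (e : ℝ) ≤ 2 * (2 ^ n * y i) ∧ 2 * (2 ^ n * y i) < e + 1 := fun i e => by
    rw [Int.floor_eq_iff, pow_succ, mul_comm ((2 : ℝ) ^ n) 2, mul_assoc]
  constructor
  · intro h
    have h' : ∀ i, ∃ e : Fin 2, ⌊(2 : ℝ) ^ (n + 1) * y i⌋ = 2 * k i + (e : ℕ) := by
      intro i
      have hi := Int.floor_eq_iff.1 (h i)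
      by_cases hlt : 2 * (2 ^ n * y i) < 2 * k i + 1
      · refine ⟨0, (key i _).2 ⟨?_, ?_⟩⟩ <;> simp <;> linarith
      · refine ⟨1, (key i _).2 ⟨?_, ?_⟩⟩ <;> simp <;> linarith
    choose ε hε using h'
    exact ⟨ε, hε⟩
  · rintro ⟨ε, hε⟩ i
    have hi := (key i _).1 (hε i)
    have hle : ((ε i : ℕ) : ℝ) ≤ 1 := by exact_mod_cast Nat.lt_succ_iff.1 (ε i).2
    have hge : (0 : ℝ) ≤ ((ε i : ℕ) : ℝ) := Nat.cast_nonneg _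
    push_cast at hi
    rw [Int.floor_eq_iff]
    constructor <;> linarith

theorem pairwise_disjoint_dcube {d : ℕ} (n : ℕ) (k : Fin d → ℤ) :
    Pairwise (Function.onFun Disjoint fun ε : Fin d → Fin 2 =>
      (dcube (n + 1) (fun i => 2 * k i + (ε i : ℕ)) : Set (Rd d))) := by
  intro ε ε' hne
  refine Set.disjoint_left.2 fun y hy hy' => hne ?_
  funext i
  have := (hy i).symm.trans (hy' i)
  simp only at this
  ext
  omega

theorem integrableOn_dcube {d n : ℕ} (k : Fin d → ℤ) {f : Rd d → ℝ} (hf : Continuous f) :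
    IntegrableOn f (dcube n k) := by
  rcases (dcube n k : Set (Rd d)).eq_empty_or_nonempty with h | ⟨x, hx⟩
  · rw [h]; exact integrableOn_empty
  · refine (hf.continuousOn.integrableOn_compact
      (isCompact_closedBall x (d * (2 ^ n)⁻¹))).mono_set fun y hy => ?_
    rw [Metric.mem_closedBall, dist_eq_norm]
    exact norm_sub_le_of_mem_dcube hy hx

/-- The average of `f` over a dyadic cube. -/
noncomputable def dav {d : ℕ} (n : ℕ) (k : Fin d → ℤ) (f : Rd d → ℝ) : ℝ :=
  2 ^ (n * d) * ∫ x in dcube n k, f x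

theorem measureReal_dcube {d : ℕ} (n : ℕ) (k : Fin d → ℤ) :
    volume.real (dcube n k : Set (Rd d)) = (2 ^ (n * d))⁻¹ := by
  rw [measureReal_def, volume_dcube, ENNReal.toReal_ofReal (by positivity)]

theorem dav_const {d : ℕ} (n : ℕ) (k : Fin d → ℤ) (c : ℝ) :
    dav n k (fun _ : Rd d => c) = c := by
  rw [dav, setIntegral_const, measureReal_dcube, smul_eq_mul, mul_inv_cancel_left₀ (by positivity)]

theorem dav_mono {d n : ℕ} {k : Fin d → ℤ} {f g : Rd d → ℝ} (hf : Continuous f)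
    (hg : Continuous g) (h : ∀ x ∈ dcube n k, f x ≤ g x) : dav n k f ≤ dav n k g := by
  unfold dav
  refine mul_le_mul_of_nonneg_left ?_ (by positivity)
  exact setIntegral_mono_on (integrableOn_dcube k hf) (integrableOn_dcube k hg)
    (measurableSet_dcube n k) h

theorem dav_add {d n : ℕ} {k : Fin d → ℤ} {f g : Rd d → ℝ} (hf : Continuous f)
    (hg : Continuous g) : dav n k (fun x => f x + g x) = dav n k f + dav n k g := by
  unfold dav
  rw [integral_add (integrableOn_dcube k hf) (integrableOn_dcube k hg), mul_add]

theorem dav_const_mul {d n : ℕ} {k : Fin d → ℤ} (c : ℝ) (f : Rd d → ℝ) :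
    dav n k (fun x => c * f x) = c * dav n k f := by
  unfold dav
  rw [integral_const_mul]; ring

theorem sum_dav_children {d n : ℕ} {k : Fin d → ℤ} {f : Rd d → ℝ} (hf : Continuous f) :
    ∑ ε : Fin d → Fin 2, dav (n + 1) (fun i => 2 * k i + (ε i : ℕ)) f =
      (Fintype.card (Fin d → Fin 2) : ℝ) * dav n k f := by
  unfold dav
  rw [← Finset.mul_sum, dcube_eq_iUnion n k, integral_iUnion_fintype
    (fun ε => measurableSet_dcube _ _) (pairwise_disjoint_dcube n k)
    (fun ε => integrableOn_dcube _ hf)]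
  simp only [Fintype.card_pi, Fintype.card_fin, Finset.prod_const, Finset.card_univ]
  push_cast
  ring

/-- The variance of `f` over a dyadic cube. -/
noncomputable def dvar {d : ℕ} (n : ℕ) (k : Fin d → ℤ) (f : Rd d → ℝ) : ℝ :=
  dav n k (fun x => f x ^ 2) - dav n k f ^ 2

theorem dav_sub_sq {d n : ℕ} {k : Fin d → ℤ} {f : Rd d → ℝ} (hf : Continuous f) (c : ℝ) :
    dav n k (fun x => (f x - c) ^ 2) = dvar n k f + (dav n k f - c) ^ 2 := by
  have e : (fun x => (f x - c) ^ 2) = fun x => f x ^ 2 + ((-2 * c) * f x + c ^ 2) := by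
    funext x; ring
  rw [e, dav_add (f := fun x => f x ^ 2) (hf.pow 2) ((hf.const_mul _).add_const _), dav_add (hf.const_mul _)
    continuous_const, dav_const_mul, dav_const, dvar]
  ring

theorem dav_nonneg {d n : ℕ} {k : Fin d → ℤ} {f : Rd d → ℝ} (h : ∀ x, 0 ≤ f x) :
    0 ≤ dav n k f :=
  mul_nonneg (by positivity) (integral_nonneg h)

theorem dvar_nonneg {d n : ℕ} {k : Fin d → ℤ} {f : Rd d → ℝ} (hf : Continuous f) :
    0 ≤ dvar n k f := by
  have h1 := dav_sub_sq (n := n) (k := k) hf (dav n k f)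
  rw [sub_self, zero_pow two_ne_zero, add_zero] at h1
  rw [← h1]
  exact dav_nonneg fun x => sq_nonneg _

theorem dvar_le {d n : ℕ} {k : Fin d → ℤ} {f : Rd d → ℝ} (hf : Continuous f) (c : ℝ) :
    dvar n k f ≤ dav n k (fun x => (f x - c) ^ 2) := by
  rw [dav_sub_sq hf c]
  linarith [sq_nonneg (dav n k f - c)]

/-- The dyadic John–Nirenberg inequality for Lipschitz functions. -/
theorem dav_exp_le {d : ℕ} {f : Rd d → ℝ} {L : ℝ} (hL : ∀ x y, |f x - f y| ≤ L * ‖x - y‖)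
    (hf : Continuous f) (hvar : ∀ n k, dvar n k f ≤ 1) {c : ℝ} (hc0 : 0 ≤ c)
    (hc : c * (2 * 2 ^ d) ≤ 1) (n : ℕ) (k : Fin d → ℤ) :
    dav n k (fun x => Real.exp (c * f x)) ≤ 12 * Real.exp (c * dav n k f) := by
  have hcard : (Fintype.card (Fin d → Fin 2) : ℝ) = 2 ^ d := by simp
  have hc1 : c ≤ 1 := by
    have : (1 : ℝ) ≤ 2 ^ d := one_le_pow₀ one_le_two
    nlinarith
  have hexp : Continuous fun x => Real.exp (c * f x) := (hf.const_mul c).rexp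
  -- Induction on the number j of generations down to cubes on which f oscillates by at most 1. On
  -- these exp(c f) exceeds exp of c times the mean by at most a factor e < 3; going up is one
  -- Bellman step. So L determines j but not the constant, and 1 + 4v - v² ≤ 4 finally gives 12 = 3
  -- · 4.
  have main : ∀ j n : ℕ, L * (d * (2 ^ (n + j))⁻¹) ≤ 1 → ∀ k : Fin d → ℤ,
      dav n k (fun x => Real.exp (c * f x)) ≤
        3 * (Real.exp (c * dav n k f) * (1 + 4 * dvar n k f - dvar n k f ^ 2)) := by
    intro j
    induction j with
    | zero =>
      intro n hn k
      have hosc : ∀ x ∈ dcube n k, f x ≤ dav n k f + 1 := by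
        intro x hx
        have h1 : dav n k (fun _ => f x - 1) ≤ dav n k f := by
          refine dav_mono continuous_const hf fun y hy => ?_
          have h2 := norm_sub_le_of_mem_dcube hx hy
          have h3 := (abs_le.1 (hL x y)).2
          -- The sign of L is not assumed, but a negative L forces x = y.
          have h0 : 0 ≤ L ∨ ‖x - y‖ = 0 := by
            by_contra! h4
            have h5 := (abs_nonneg _).trans (hL x y)
            have h6 : 0 < ‖x - y‖ := lt_of_le_of_ne (norm_nonneg _) (Ne.symm h4.2)
            nlinarith
          rcases h0 with h0 | h0
          · have : L * ‖x - y‖ ≤ L * (d * (2 ^ (n + 0))⁻¹) := by gcongr; simpa using h2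
            linarith
          · rw [h0] at h3; linarith
        rw [dav_const] at h1
        linarith
      have h1 : dav n k (fun x => Real.exp (c * f x)) ≤ dav n k (fun _ : Rd d =>
          Real.exp (c * dav n k f + 1)) := by
        refine dav_mono hexp continuous_const fun x hx => Real.exp_le_exp.2 ?_
        have := hosc x hx
        nlinarith
      rw [dav_const, Real.exp_add] at h1
      have h2 : Real.exp 1 ≤ 3 := by linarith [Real.exp_one_lt_d9]
      have h3 : 1 ≤ 1 + 4 * dvar n k f - dvar n k f ^ 2 := by
        nlinarith [hvar n k, dvar_nonneg (n := n) (k := k) hf]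
      have h4 := Real.exp_pos (c * dav n k f)
      calc _ ≤ _ := h1
        _ ≤ Real.exp (c * dav n k f) * 3 := by gcongr
        _ = 3 * (Real.exp (c * dav n k f) * 1) := by ring
        _ ≤ _ := by gcongr
    | succ j ih =>
      intro n hn k
      have hstep := bellman_step (ι := Fin d → Fin 2) hc0 (by rw [hcard]; exact hc)
        (m := fun ε => dav (n + 1) (fun i => 2 * k i + (ε i : ℕ)) f)
        (v := fun ε => dvar (n + 1) (fun i => 2 * k i + (ε i : ℕ)) f)
        (m' := dav n k f) (v' := dvar n k f) (fun ε => dvar_nonneg hf) (fun ε => hvar _ _)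
        (hvar n k) (sum_dav_children hf) (by
          simp_rw [← dav_sub_sq hf (dav n k f)]
          rw [sum_dav_children (f := fun x => (f x - dav n k f) ^ 2)
            ((hf.sub continuous_const).pow 2), dav_sub_sq hf, sub_self]
          ring)
      have hN : (0 : ℝ) < Fintype.card (Fin d → Fin 2) := by rw [hcard]; positivity
      refine le_of_mul_le_mul_left ?_ hN
      rw [← sum_dav_children hexp]
      calc _ ≤ ∑ ε : Fin d → Fin 2, 3 * _ := Finset.sum_le_sum fun ε _ =>
            ih (n + 1) (by rwa [Nat.add_assoc, Nat.add_comm 1 j]) _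
        _ = 3 * ∑ ε : Fin d → Fin 2, _ := (Finset.mul_sum _ _ _).symm
        _ ≤ 3 * _ := mul_le_mul_of_nonneg_left hstep (by norm_num)
        _ = _ := by ring
  obtain ⟨j, hj⟩ : ∃ j : ℕ, L * (d * (2 ^ (n + j))⁻¹) ≤ 1 := by
    obtain ⟨j, hj⟩ := pow_unbounded_of_one_lt (L * d) one_lt_two
    refine ⟨j, ?_⟩
    rw [← mul_assoc, ← div_eq_mul_inv, div_le_one (by positivity)]
    exact hj.le.trans (pow_le_pow_right₀ one_le_two (by omega))
  refine (main j n hj k).trans ?_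
  have h3 : 1 + 4 * dvar n k f - dvar n k f ^ 2 ≤ 4 := by
    nlinarith [hvar n k, dvar_nonneg (n := n) (k := k) hf]
  calc _ ≤ 3 * (Real.exp (c * dav n k f) * 4) := by gcongr
    _ = _ := by ring

/-! ### Convolutions with bounded integrable functions. -/

/-- The convolution of a kernel with a function. -/
noncomputable def cv {d : ℕ} (K u : Rd d → ℂ) (x : Rd d) : ℂ :=
  ∫ y, K (x - y) * u y

/-- Integrable functions bounded almost everywhere by `R`. -/
structure BddInt {d : ℕ} (R : ℝ) (u : Rd d → ℂ) : Prop where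
  integrable : Integrable u
  bound : ∀ᵐ x, ‖u x‖ ≤ R

theorem BddInt.nonneg {d : ℕ} {R : ℝ} {u : Rd d → ℂ} (hu : BddInt R u) : 0 ≤ R := by
  obtain ⟨x, hx⟩ := hu.bound.exists
  exact (norm_nonneg _).trans hx

theorem BddInt.memLp_two {d : ℕ} {R : ℝ} {u : Rd d → ℂ} (hu : BddInt R u) : MemLp u 2 volume := by
  refine (memLp_two_iff_integrable_sq_norm hu.integrable.aestronglyMeasurable).2 ?_
  refine (hu.integrable.norm.const_mul R).mono'
    (hu.integrable.aestronglyMeasurable.norm.pow 2) ?_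
  filter_upwards [hu.bound] with x hx
  rw [Real.norm_of_nonneg (by positivity), sq]
  gcongr

theorem BddInt.mul {d : ℕ} {R B : ℝ} {u b : Rd d → ℂ} (hu : BddInt R u) (hb : Continuous b)
    (hB : ∀ x, ‖b x‖ ≤ B) : BddInt (B * R) (fun x => b x * u x) := by
  refine ⟨hu.integrable.bdd_mul hb.aestronglyMeasurable (Eventually.of_forall hB), ?_⟩
  filter_upwards [hu.bound] with x hx
  rw [norm_mul]
  have := hB x
  have h0 := (norm_nonneg _).trans this
  gcongr

theorem BddInt.indicator {d : ℕ} {R : ℝ} {u : Rd d → ℂ} (hu : BddInt R u) {s : Set (Rd d)}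
    (hs : MeasurableSet s) : BddInt R (s.indicator u) := by
  refine ⟨hu.integrable.indicator hs, ?_⟩
  filter_upwards [hu.bound] with x hx
  exact (norm_indicator_le_norm_self u x).trans hx

theorem integrable_cv_integrand {d : ℕ} {R : ℝ} {K u : Rd d → ℂ} (hK : Integrable K)
    (hu : BddInt R u) (x : Rd d) : Integrable (fun y => K (x - y) * u y) :=
  (hK.comp_sub_left x).mul_bdd hu.integrable.aestronglyMeasurable hu.bound

theorem norm_cv_le {d : ℕ} {R : ℝ} {K u : Rd d → ℂ} (hK : Integrable K) (hu : BddInt R u)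
    (x : Rd d) : ‖cv K u x‖ ≤ R * ∫ z, ‖K z‖ := by
  have h1 : ‖cv K u x‖ ≤ ∫ y, ‖K (x - y) * u y‖ := norm_integral_le_integral_norm _
  refine h1.trans ?_
  calc ∫ y, ‖K (x - y) * u y‖ ≤ ∫ y, R * ‖K (x - y)‖ := by
        refine integral_mono_ae (integrable_cv_integrand hK hu x).norm
          ((hK.comp_sub_left x).norm.const_mul R) ?_
        filter_upwards [hu.bound] with y hy
        rw [norm_mul, mul_comm]
        gcongr
    _ = R * ∫ z, ‖K z‖ := by
        rw [integral_const_mul, integral_sub_left_eq_self (fun z => ‖K z‖) volume x]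

theorem norm_cv_sub_cv_le {d : ℕ} {R : ℝ} {K u : Rd d → ℂ} (hK : Integrable K) (hu : BddInt R u)
    (x x' : Rd d) :
    ‖cv K u x - cv K u x'‖ ≤ R * ∫ z, ‖K (z + (x - x')) - K z‖ := by
  have e : cv K u x - cv K u x' = cv (fun z => K (z + (x - x')) - K z) u x' := by
    unfold cv
    rw [← integral_sub (integrable_cv_integrand hK hu x) (integrable_cv_integrand hK hu x')]
    refine integral_congr_ae (Eventually.of_forall fun y => ?_)
    have : x' - y + (x - x') = x - y := by abel
    simp only [this]
    ring
  rw [e]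
  exact norm_cv_le ((hK.comp_add_right (x - x')).sub hK) hu x'

/-- Where u does not vanish, (‖x - y‖ / δ)^(1/4) ≥ 1 can be inserted, which brings in the moment of
K. -/
theorem norm_cv_le_of_far {d : ℕ} {R δ : ℝ} {K u : Rd d → ℂ} (hδ : 0 < δ) (hK : Integrable K)
    (hw : Integrable fun x => ‖x‖ ^ (1 / 4 : ℝ) * ‖K x‖) (hu : BddInt R u) (x : Rd d)
    (hfar : ∀ y, ‖x - y‖ < δ → u y = 0) :
    ‖cv K u x‖ ≤ R * (δ ^ (-(1 / 4) : ℝ) * ∫ z, ‖z‖ ^ (1 / 4 : ℝ) * ‖K z‖) := by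
  have h1 : ‖cv K u x‖ ≤ ∫ y, ‖K (x - y) * u y‖ := norm_integral_le_integral_norm _
  refine h1.trans ?_
  have hR := hu.nonneg
  calc ∫ y, ‖K (x - y) * u y‖
      ≤ ∫ y, R * (δ ^ (-(1 / 4) : ℝ) * (‖x - y‖ ^ (1 / 4 : ℝ) * ‖K (x - y)‖)) := by
        refine integral_mono_ae (integrable_cv_integrand hK hu x).norm
          (((hw.comp_sub_left x).const_mul _).const_mul R) ?_
        filter_upwards [hu.bound] with y hy
        rw [norm_mul, mul_comm]
        by_cases h : ‖x - y‖ < δ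
        · rw [hfar y h, norm_zero, zero_mul]; positivity
        · have h2 : 1 ≤ δ ^ (-(1 / 4) : ℝ) * ‖x - y‖ ^ (1 / 4 : ℝ) := by
            rw [Real.rpow_neg hδ.le, ← div_eq_inv_mul, one_le_div (by positivity)]
            exact Real.rpow_le_rpow hδ.le (not_lt.1 h) (by norm_num)
          rw [← mul_assoc (δ ^ (-(1 / 4) : ℝ))]
          gcongr
          exact le_mul_of_one_le_left (norm_nonneg _) h2
    _ = _ := by
        rw [integral_const_mul, integral_const_mul,
          integral_sub_left_eq_self (fun z => ‖z‖ ^ (1 / 4 : ℝ) * ‖K z‖) volume x]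

theorem cv_eq_convolution {d : ℕ} (K u : Rd d → ℂ) :
    cv K u = convolution K u (ContinuousLinearMap.mul ℂ ℂ) volume := by
  funext x
  unfold cv
  rw [convolution_def, ← integral_sub_left_eq_self (fun t => (ContinuousLinearMap.mul ℂ ℂ) (K t)
    (u (x - t))) volume x]
  simp

theorem integrable_cv {d : ℕ} {K u : Rd d → ℂ} (hK : Integrable K) (hu : Integrable u) :
    Integrable (cv K u) := by
  rw [cv_eq_convolution]
  exact hK.integrable_convolution _ hu

theorem fourier_cv {d : ℕ} {K u : Rd d → ℂ} (hK : Integrable K) (hu : Integrable u) (ξ : Rd d) :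
    𝓕 (cv K u) ξ = 𝓕 K ξ * 𝓕 u ξ := by
  rw [cv_eq_convolution]
  exact Real.fourier_mul_convolution_eq hK hu ξ

theorem bddInt_cv {d : ℕ} {R : ℝ} {K u : Rd d → ℂ} (hK : Integrable K) (hu : BddInt R u) :
    BddInt (R * ∫ z, ‖K z‖) (cv K u) :=
  ⟨integrable_cv hK hu.integrable, Eventually.of_forall (norm_cv_le hK hu)⟩

/-- Plancherel. Only the sup norm of the symbol enters, not the L¹ norm of K, which is why the bound
is uniform over partial sums of kernels. -/
theorem integral_norm_sq_cv_le {d : ℕ} {R C : ℝ} {K u : Rd d → ℂ} (hK : Integrable K)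
    (hu : BddInt R u) (hC : ∀ ξ, ‖𝓕 K ξ‖ ≤ C) :
    ∫ x, ‖cv K u x‖ ^ 2 ≤ C ^ 2 * ∫ x, ‖u x‖ ^ 2 := by
  have hc := bddInt_cv hK hu
  have hu2 := integrable_norm_sq_fourier hu.integrable hu.memLp_two
  rw [← integral_norm_sq_fourier hc.integrable hc.memLp_two,
    ← integral_norm_sq_fourier hu.integrable hu.memLp_two, ← integral_const_mul]
  refine integral_mono (integrable_norm_sq_fourier hc.integrable hc.memLp_two)
    (hu2.const_mul _) fun ξ => ?_
  simp only [fourier_cv hK hu.integrable, norm_mul, mul_pow]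
  have := hC ξ
  gcongr

theorem cv_add {d : ℕ} {R R' : ℝ} {K u v : Rd d → ℂ} (hK : Integrable K) (hu : BddInt R u)
    (hv : BddInt R' v) (x : Rd d) : cv K (fun y => u y + v y) x = cv K u x + cv K v x := by
  unfold cv
  rw [← integral_add (integrable_cv_integrand hK hu x) (integrable_cv_integrand hK hv x)]
  simp only [mul_add]

theorem cv_const_mul {d : ℕ} (K u : Rd d → ℂ) (c : ℂ) (x : Rd d) :
    cv K (fun y => c * u y) x = c * cv K u x := by
  unfold cv
  rw [← integral_const_mul]
  congr 1
  funext y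
  ring

theorem cv_sum {d N : ℕ} {R : ℝ} {K : ℕ → Rd d → ℂ} {u : Rd d → ℂ} (hK : ∀ j, Integrable (K j))
    (hu : BddInt R u) (x : Rd d) :
    cv (fun z => ∑ j ∈ Finset.range N, K j z) u x = ∑ j ∈ Finset.range N, cv (K j) u x := by
  unfold cv
  rw [← integral_finsetSum _ fun j _ => integrable_cv_integrand (hK j) hu x]
  simp only [Finset.sum_mul]

theorem fourier_sum {d N : ℕ} {K : ℕ → Rd d → ℂ} (hK : ∀ j, Integrable (K j)) (ξ : Rd d) :
    𝓕 (fun z => ∑ j ∈ Finset.range N, K j z) ξ = ∑ j ∈ Finset.range N, 𝓕 (K j) ξ := by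
  simp only [Real.fourier_eq]
  rw [← integral_finsetSum _ fun j _ => (Real.fourierIntegral_convergent_iff ξ).2 (hK j)]
  simp only [Finset.smul_sum]

/-- Sums over all dyadic scales are bounded independently of δ. With s = t^(1/4) the term min(t,
t^(-1/4)) is at most min(s, 1/s), which is dominated by a multiple of G(q s) - G(s) for the bounded
increasing G(s) = s / (1 + s); consecutive scales multiply s by q, so the sum telescopes. -/
theorem exists_sum_min_le : ∃ C : ℝ, 0 < C ∧ ∀ δ : ℝ, 0 < δ → ∀ N : ℕ,
    ∑ j ∈ Finset.range N, min (2 ^ j * δ) ((2 ^ j * δ) ^ (-(1 / 4) : ℝ)) ≤ C := by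
  set q : ℝ := 2 ^ (1 / 4 : ℝ) with hq
  have hq1 : 1 < q := Real.one_lt_rpow one_lt_two (by norm_num)
  refine ⟨2 * (1 + q) / (q - 1), div_pos (by positivity) (by linarith), fun δ hδ N => ?_⟩
  let G : ℝ → ℝ := fun s => s / (1 + s)
  have hG : ∀ s : ℝ, 0 < s → min s s⁻¹ ≤ 2 * (1 + q) / (q - 1) * (G (q * s) - G s) := by
    intro s hs
    have e : 2 * (1 + q) / (q - 1) * (G (q * s) - G s) =
        2 * (1 + q) * s / ((1 + q * s) * (1 + s)) := by
      have h1 : q - 1 ≠ 0 := by linarith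
      have h2 : 1 + q * s ≠ 0 := by positivity
      have h3 : 1 + s ≠ 0 := by positivity
      simp only [G]
      field_simp
      ring
    rw [e, le_div_iff₀ (by positivity)]
    rcases le_total s 1 with h | h
    · calc min s s⁻¹ * ((1 + q * s) * (1 + s)) ≤ s * ((1 + q * 1) * (1 + 1)) := by
            gcongr; exact min_le_left _ _
        _ = _ := by ring
    · calc min s s⁻¹ * ((1 + q * s) * (1 + s)) ≤ s⁻¹ * ((s + q * s) * (s + s)) := by
            gcongr; exact min_le_right _ _
        _ = _ := by field_simp; ring
  let s : ℕ → ℝ := fun j => (2 ^ j * δ) ^ (1 / 4 : ℝ)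
  have hs0 : ∀ j, 0 < s j := fun j => by positivity
  have hs : ∀ j, s (j + 1) = q * s j := fun j => by
    simp only [s, hq]
    rw [pow_succ, mul_comm ((2 : ℝ) ^ j) 2, mul_assoc, Real.mul_rpow (by norm_num) (by positivity)]
  have hterm : ∀ j, min (2 ^ j * δ) ((2 ^ j * δ) ^ (-(1 / 4) : ℝ)) ≤
      2 * (1 + q) / (q - 1) * (G (s (j + 1)) - G (s j)) := by
    intro j
    rw [hs]
    refine le_trans ?_ (hG (s j) (hs0 j))
    have ht : (0 : ℝ) < 2 ^ j * δ := by positivity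
    refine le_min ?_ ?_
    · rcases le_total (2 ^ j * δ) 1 with h | h
      · exact (min_le_left _ _).trans (Real.self_le_rpow_of_le_one ht.le h (by norm_num))
      · exact (min_le_right _ _).trans
          (Real.rpow_le_rpow_of_exponent_le h (by norm_num))
    · rw [← Real.rpow_neg ht.le]
      exact min_le_right _ _
  calc _ ≤ ∑ j ∈ Finset.range N, 2 * (1 + q) / (q - 1) * (G (s (j + 1)) - G (s j)) :=
        Finset.sum_le_sum fun j _ => hterm j
    _ = 2 * (1 + q) / (q - 1) * (G (s N) - G (s 0)) := by
        rw [← Finset.mul_sum, Finset.sum_range_sub (fun j => G (s j))]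
    _ ≤ 2 * (1 + q) / (q - 1) * 1 := by
        have h1 : G (s N) ≤ 1 := by
          simp only [G]
          rw [div_le_one (by have := hs0 N; positivity)]
          linarith
        have h2 : 0 ≤ G (s 0) := by have := hs0 0; simp only [G]; positivity
        have h3 : 0 < q - 1 := by linarith
        gcongr
        linarith
    _ = _ := mul_one _

/-! ### The bound from L^∞ to dyadic BMO, uniform in the truncation. -/

/-- A sequence of kernels at the scales `2 ^ (-j)` whose partial sums have Fourier transforms
bounded by `C`. -/
structure KernelSeq {d : ℕ} (C : ℝ) (K : ℕ → Rd d → ℂ) : Prop where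
  pos : 0 < C
  bound : ∀ j, KernelBound C (2 ^ j) (K j)
  fourier_le : ∀ N ξ, ‖∑ j ∈ Finset.range N, 𝓕 (K j) ξ‖ ≤ C

/-- The partial sums of a sequence of kernels. -/
def pk {d : ℕ} (K : ℕ → Rd d → ℂ) (N : ℕ) (z : Rd d) : ℂ := ∑ j ∈ Finset.range N, K j z

namespace KernelSeq

variable {d : ℕ} {C : ℝ} {K : ℕ → Rd d → ℂ}

theorem integrable_pk (h : KernelSeq C K) (N : ℕ) : Integrable (pk K N) :=
  integrable_finsetSum _ fun j _ => (h.bound j).integrable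

theorem norm_fourier_pk_le (h : KernelSeq C K) (N : ℕ) (ξ : Rd d) : ‖𝓕 (pk K N) ξ‖ ≤ C := by
  have := fourier_sum (N := N) (fun j => (h.bound j).integrable) ξ
  unfold pk
  rw [this]
  exact h.fourier_le N ξ

theorem cv_pk (h : KernelSeq C K) {R : ℝ} {u : Rd d → ℂ} (hu : BddInt R u) (N : ℕ) (x : Rd d) :
    cv (pk K N) u x = ∑ j ∈ Finset.range N, cv (K j) u x :=
  cv_sum (fun j => (h.bound j).integrable) hu x

theorem norm_cv_sub_le (h : KernelSeq C K) {R : ℝ} {u : Rd d → ℂ} (hu : BddInt R u) (j : ℕ)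
    (x y : Rd d) : ‖cv (K j) u x - cv (K j) u y‖ ≤ R * (C * (2 ^ j * ‖x - y‖)) :=
  (norm_cv_sub_cv_le (h.bound j).integrable hu x y).trans
    (mul_le_mul_of_nonneg_left ((h.bound j).shift_le _) hu.nonneg)

/-- The constant grows with N and is used only where its size is harmless: for continuity, to start
the John–Nirenberg induction, and for finite nets at a fixed N. -/
theorem norm_cv_pk_sub_le (h : KernelSeq C K) {R : ℝ} {u : Rd d → ℂ} (hu : BddInt R u) (N : ℕ)
    (x y : Rd d) : ‖cv (pk K N) u x - cv (pk K N) u y‖ ≤ R * C * 2 ^ N * ‖x - y‖ := by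
  rw [h.cv_pk hu, h.cv_pk hu, ← Finset.sum_sub_distrib]
  have hR := hu.nonneg
  have hC := h.pos.le
  calc _ ≤ ∑ j ∈ Finset.range N, R * (C * (2 ^ j * ‖x - y‖)) :=
        norm_sum_le_of_le _ fun j _ => h.norm_cv_sub_le hu j x y
    _ = R * C * (∑ j ∈ Finset.range N, (2 : ℝ) ^ j) * ‖x - y‖ := by
        rw [Finset.mul_sum, Finset.sum_mul]
        exact Finset.sum_congr rfl fun j _ => by ring
    _ ≤ _ := by
        gcongr
        rw [geom_sum_eq (by norm_num)]
        norm_num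

theorem continuous_cv_pk (h : KernelSeq C K) {R : ℝ} {u : Rd d → ℂ} (hu : BddInt R u) (N : ℕ) :
    Continuous (cv (pk K N) u) := by
  have hR := hu.nonneg
  have hC := h.pos.le
  refine (LipschitzWith.of_dist_le_mul (K := ⟨R * C * 2 ^ N, by positivity⟩) fun x y => ?_).continuous
  rw [dist_eq_norm, dist_eq_norm]
  exact h.norm_cv_pk_sub_le hu N x y

theorem norm_cv_far_le (h : KernelSeq C K) {R : ℝ} {u : Rd d → ℂ} (hu : BddInt R u) (j : ℕ)
    {δ : ℝ} (hδ : 0 < δ) {x : Rd d} (hfar : ∀ y, ‖x - y‖ < δ → u y = 0) :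
    ‖cv (K j) u x‖ ≤ R * (C * (2 ^ j * δ) ^ (-(1 / 4) : ℝ)) := by
  refine (norm_cv_le_of_far hδ (h.bound j).integrable (h.bound j).integrable_weight hu x hfar).trans
    (mul_le_mul_of_nonneg_left ?_ hu.nonneg)
  calc _ ≤ δ ^ (-(1 / 4) : ℝ) * (C * (2 ^ j) ^ (-(1 / 4) : ℝ)) := by
        gcongr; exact (h.bound j).weight_le
    _ = _ := by rw [Real.mul_rpow (by positivity) hδ.le]; ring

theorem norm_cv_pk_far_le (h : KernelSeq C K) {C₀ : ℝ}
    (hC₀ : ∀ δ : ℝ, 0 < δ → ∀ N : ℕ,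
      ∑ j ∈ Finset.range N, min (2 ^ j * δ) ((2 ^ j * δ) ^ (-(1 / 4) : ℝ)) ≤ C₀)
    {R : ℝ} {u : Rd d → ℂ} (hu : BddInt R u) (N : ℕ) {δ : ℝ} (hδ : 1 ≤ δ) {x : Rd d}
    (hfar : ∀ y, ‖x - y‖ < δ → u y = 0) : ‖cv (pk K N) u x‖ ≤ R * C * C₀ := by
  have hδ0 : 0 < δ := by linarith
  have hR := hu.nonneg
  have hC := h.pos.le
  rw [h.cv_pk hu]
  calc _ ≤ ∑ j ∈ Finset.range N,
        R * C * min (2 ^ j * δ) ((2 ^ j * δ) ^ (-(1 / 4) : ℝ)) := by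
        refine norm_sum_le_of_le _ fun j _ => (h.norm_cv_far_le hu j hδ0 hfar).trans_eq ?_
        have h1 : 1 ≤ 2 ^ j * δ := one_le_mul_of_one_le_of_one_le (one_le_pow₀ one_le_two) hδ
        rw [min_eq_right, mul_assoc]
        exact (Real.rpow_le_one_of_one_le_of_nonpos h1 (by norm_num)).trans h1
    _ ≤ _ := by
        rw [← Finset.mul_sum]
        gcongr
        exact hC₀ δ hδ0 N

/-- The Calderón–Zygmund regularity estimate: scales with 2^j δ small are controlled by the
translation modulus, the others by decay away from the support of u. -/
theorem norm_cv_pk_osc_le (h : KernelSeq C K) {C₀ : ℝ}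
    (hC₀ : ∀ δ : ℝ, 0 < δ → ∀ N : ℕ,
      ∑ j ∈ Finset.range N, min (2 ^ j * δ) ((2 ^ j * δ) ^ (-(1 / 4) : ℝ)) ≤ C₀)
    {R : ℝ} {u : Rd d → ℂ} (hu : BddInt R u) (N : ℕ) {δ : ℝ} (hδ : 0 < δ) {x y : Rd d}
    (hxy : ‖x - y‖ ≤ δ) (hfar : ∀ z, ‖y - z‖ < 2 * δ → u z = 0) :
    ‖cv (pk K N) u x - cv (pk K N) u y‖ ≤ 2 * R * C * C₀ := by
  have hR := hu.nonneg
  have hC := h.pos.le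
  rw [h.cv_pk hu, h.cv_pk hu, ← Finset.sum_sub_distrib]
  calc _ ≤ ∑ j ∈ Finset.range N,
        2 * R * C * min (2 ^ j * δ) ((2 ^ j * δ) ^ (-(1 / 4) : ℝ)) := by
        refine norm_sum_le_of_le _ fun j _ => ?_
        rw [mul_min_of_nonneg _ _ (by positivity)]
        refine le_min ?_ ?_
        · calc _ ≤ R * (C * (2 ^ j * ‖x - y‖)) := h.norm_cv_sub_le hu j x y
            _ ≤ R * (C * (2 ^ j * δ)) := by gcongr
            _ ≤ 2 * (R * (C * (2 ^ j * δ))) := by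
                have : 0 ≤ R * (C * (2 ^ j * δ)) := by positivity
                linarith
            _ = _ := by ring
        · have h1 := h.norm_cv_far_le hu j hδ (x := x) fun z hz => hfar z (by
            have : y - z = (x - z) - (x - y) := by abel
            rw [this]
            linarith [norm_sub_le (x - z) (x - y)])
          have h2 := h.norm_cv_far_le hu j hδ (x := y) fun z hz => hfar z (by linarith)
          calc _ ≤ ‖cv (K j) u x‖ + ‖cv (K j) u y‖ := norm_sub_le _ _
            _ ≤ R * (C * (2 ^ j * δ) ^ (-(1 / 4) : ℝ)) + R * (C * (2 ^ j * δ) ^ (-(1 / 4) : ℝ)) :=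
                add_le_add h1 h2
            _ = _ := by ring
    _ ≤ _ := by
        rw [← Finset.mul_sum]
        gcongr
        exact hC₀ δ hδ N

end KernelSeq

theorem BddInt.integral_norm_sq_indicator_le {d : ℕ} {R : ℝ} {u : Rd d → ℂ} (hu : BddInt R u)
    {s : Set (Rd d)} (hs : MeasurableSet s) (hs' : volume s ≠ ∞) :
    ∫ x, ‖s.indicator u x‖ ^ 2 ≤ R ^ 2 * volume.real s := by
  have e : ∀ x, ‖s.indicator u x‖ ^ 2 = s.indicator (fun x => ‖u x‖ ^ 2) x := fun x => by
    by_cases h : x ∈ s <;> simp [h]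
  simp_rw [e]
  rw [integral_indicator hs]
  have hi : IntegrableOn (fun x => ‖u x‖ ^ 2) s :=
    (hu.memLp_two.integrable_norm_pow two_ne_zero).integrableOn
  calc _ ≤ ∫ x in s, R ^ 2 := by
        refine integral_mono_ae hi (integrableOn_const hs') (ae_restrict_of_ae ?_)
        filter_upwards [hu.bound] with x hx
        gcongr
    _ = _ := by rw [setIntegral_const, smul_eq_mul, mul_comm]

theorem nonempty_dcube {d : ℕ} (n : ℕ) (k : Fin d → ℤ) : (dcube n k : Set (Rd d)).Nonempty := by
  rw [Set.nonempty_iff_ne_empty]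
  intro h
  have := measureReal_dcube n k
  rw [h, measureReal_empty] at this
  have h2 : (0 : ℝ) < (2 ^ (n * d))⁻¹ := by positivity
  linarith

/-- The mean square oscillation of truncated convolutions over dyadic cubes. The last clause
bounds the constant for the cubes of side one. -/
theorem exists_dav_oscillation_le {d : ℕ} (hd : 0 < d) {C : ℝ} {K : ℕ → Rd d → ℂ}
    (hK : KernelSeq C K) :
    ∃ V : ℝ, 0 < V ∧ ∀ (u : Rd d → ℂ), BddInt 1 u → ∀ (N n : ℕ) (k : Fin d → ℤ), ∃ c : ℂ,
      dav n k (fun x => ‖cv (pk K N) u x - c‖ ^ 2) ≤ V ∧ (n = 0 → ‖c‖ ≤ V) := by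
  obtain ⟨C₀, hC₀0, hC₀⟩ := exists_sum_min_le
  set ω := volume.real (Metric.ball (0 : Rd d) 1) with hω
  have hC := hK.pos
  have hV1 : 0 ≤ 2 * (C ^ 2 * ((2 * d) ^ d * ω)) + 2 * (2 * C * C₀) ^ 2 := by positivity
  refine ⟨2 * (C ^ 2 * ((2 * d) ^ d * ω)) + 2 * (2 * C * C₀) ^ 2 + C * C₀,
    by have : 0 < C * C₀ := by positivity
       linarith, ?_⟩
  intro u hu N n k
  obtain ⟨x₀, hx₀⟩ := nonempty_dcube n k
  set δ : ℝ := d * (2 ^ n)⁻¹ with hδ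
  have hd' : (1 : ℝ) ≤ d := by exact_mod_cast hd
  have hδ0 : 0 < δ := by positivity
  -- δ bounds the diameter of the cube, and B has volume comparable to it. The part of u in B is
  -- handled by the L² bound; the part outside oscillates boundedly over the cube, so its value at
  -- `x₀` serves as the constant c.
  let B := Metric.ball x₀ (2 * δ)
  have hB : MeasurableSet B := measurableSet_ball
  have hu1 : BddInt 1 (B.indicator u) := hu.indicator hB
  have hu2 : BddInt 1 (Bᶜ.indicator u) := hu.indicator hB.compl
  have hsplit : ∀ x, cv (pk K N) u x =
      cv (pk K N) (B.indicator u) x + cv (pk K N) (Bᶜ.indicator u) x := by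
    intro x
    rw [← cv_add (hK.integrable_pk N) hu1 hu2]
    congr 1
    funext y
    exact (congrFun (Set.indicator_self_add_compl B u) y).symm
  have hfar : ∀ z, ‖x₀ - z‖ < 2 * δ → Bᶜ.indicator u z = 0 := fun z hz => by
    rw [Set.indicator_of_notMem]
    simp only [B, Set.mem_compl_iff, Metric.mem_ball, not_not]
    rwa [dist_comm, dist_eq_norm]
  refine ⟨cv (pk K N) (Bᶜ.indicator u) x₀, ?_, ?_⟩
  · have hc1 := hK.continuous_cv_pk hu1 N
    have hc := hK.continuous_cv_pk hu N
    have hpt : ∀ x ∈ dcube n k, ‖cv (pk K N) u x - cv (pk K N) (Bᶜ.indicator u) x₀‖ ^ 2 ≤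
        2 * ‖cv (pk K N) (B.indicator u) x‖ ^ 2 + 2 * (2 * C * C₀) ^ 2 := by
      intro x hx
      have h1 := hK.norm_cv_pk_osc_le hC₀ hu2 N hδ0 (norm_sub_le_of_mem_dcube hx hx₀) hfar
      rw [hsplit, add_sub_assoc]
      have h2 := norm_add_le (cv (pk K N) (B.indicator u) x)
        (cv (pk K N) (Bᶜ.indicator u) x - cv (pk K N) (Bᶜ.indicator u) x₀)
      rw [mul_one] at h1
      calc _ ≤ (‖cv (pk K N) (B.indicator u) x‖ + 2 * C * C₀) ^ 2 := by
            gcongr; linarith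
        _ ≤ _ := by nlinarith [sq_nonneg (‖cv (pk K N) (B.indicator u) x‖ - 2 * C * C₀)]
    have h3 : dav n k (fun x => ‖cv (pk K N) (B.indicator u) x‖ ^ 2) ≤
        C ^ 2 * ((2 * d) ^ d * ω) := by
      have i1 : ∫ x in dcube n k, ‖cv (pk K N) (B.indicator u) x‖ ^ 2 ≤
          ∫ x, ‖cv (pk K N) (B.indicator u) x‖ ^ 2 :=
        setIntegral_le_integral
          ((bddInt_cv (hK.integrable_pk N) hu1).memLp_two.integrable_norm_pow two_ne_zero)
          (Eventually.of_forall fun x => by positivity)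
      have i2 := integral_norm_sq_cv_le (hK.integrable_pk N) hu1 (hK.norm_fourier_pk_le N)
      have i3 := hu.integral_norm_sq_indicator_le hB measure_ball_lt_top.ne
      have i4 : volume.real B = (2 * δ) ^ d * ω := by
        simp only [B, measureReal_def, hω]
        rw [Measure.addHaar_ball_of_pos volume x₀ (by positivity), ENNReal.toReal_mul,
          ENNReal.toReal_ofReal (by positivity), finrank_euclideanSpace_fin]
      have i5 : (2 : ℝ) ^ (n * d) * (2 * δ) ^ d = (2 * d) ^ d := by
        rw [pow_mul, ← mul_pow, hδ]
        congr 1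
        field_simp
      rw [i4, one_pow, one_mul] at i3
      unfold dav
      calc _ ≤ 2 ^ (n * d) * (C ^ 2 * ((2 * δ) ^ d * ω)) := by
            gcongr
            exact (i1.trans i2).trans (by gcongr)
        _ = C ^ 2 * ((2 ^ (n * d) * (2 * δ) ^ d) * ω) := by ring
        _ = _ := by rw [i5]
    have h4 : dav n k (fun x => ‖cv (pk K N) u x - cv (pk K N) (Bᶜ.indicator u) x₀‖ ^ 2) ≤ _ :=
      dav_mono ((hc.sub continuous_const).norm.pow 2)
        (g := fun x => 2 * ‖cv (pk K N) (B.indicator u) x‖ ^ 2 + 2 * (2 * C * C₀) ^ 2)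
        (((hc1.norm.pow 2).const_mul 2).add continuous_const) hpt
    rw [dav_add (f := fun x => 2 * ‖cv (pk K N) (B.indicator u) x‖ ^ 2)
      ((hc1.norm.pow 2).const_mul 2) continuous_const, dav_const_mul, dav_const] at h4
    have : 0 < C * C₀ := by positivity
    linarith
  -- For a unit cube the far part lives at distance at least 2d ≥ 1, so decay alone bounds its
  -- value.
  · rintro rfl
    have h1 := hK.norm_cv_pk_far_le hC₀ hu2 N (δ := 2 * δ) (by rw [hδ]; norm_num; linarith) hfar
    rw [one_mul] at h1
    linarith

/-! ### Local L^m bounds. -/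

theorem dvar_const_mul {d n : ℕ} {k : Fin d → ℤ} (c : ℝ) (f : Rd d → ℝ) :
    dvar n k (fun x => c * f x) = c ^ 2 * dvar n k f := by
  simp only [dvar, mul_pow, dav_const_mul]
  ring

/-- Dividing by W = V + 1 makes all variances at most 1. The exponential inequality is then applied
to both signs of g / W and combined with t^m / m! ≤ exp t; the two signs account for 24 = 2 · 12. -/
theorem dav_abs_pow_le {d : ℕ} {g : Rd d → ℝ} {L V M : ℝ}
    (hL : ∀ x y, |g x - g y| ≤ L * ‖x - y‖) (hg : Continuous g) (hV0 : 0 ≤ V)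
    (hV : ∀ n k, dvar n k g ≤ V) (k : Fin d → ℤ) (hM : |dav 0 k g| ≤ M) (m : ℕ) :
    dav 0 k (fun x => |g x| ^ m) ≤
      m.factorial * (2 * 2 ^ d * (V + 1)) ^ m * (24 * Real.exp M) := by
  set W : ℝ := V + 1 with hW
  have hW1 : 1 ≤ W := by linarith
  set c : ℝ := (2 * 2 ^ d)⁻¹ with hc
  have hc0 : 0 < c := by positivity
  have hc1 : c ≤ 1 := by
    rw [hc]
    refine inv_le_one_of_one_le₀ ?_
    have : (1 : ℝ) ≤ 2 ^ d := one_le_pow₀ one_le_two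
    linarith
  have hM0 : 0 ≤ M := (abs_nonneg _).trans hM
  have hJN : ∀ s : ℝ, s ^ 2 = 1 → dav 0 k (fun x => Real.exp (c * (s * W⁻¹ * g x))) ≤
      12 * Real.exp M := by
    intro s hs
    have hsabs : |s| = 1 := by
      exact (pow_eq_one_iff_of_nonneg (abs_nonneg s) two_ne_zero).1 ((sq_abs s).trans hs)
    have hcont : Continuous fun x => s * W⁻¹ * g x := hg.const_mul _
    have h1 := dav_exp_le (f := fun x => s * W⁻¹ * g x) (L := W⁻¹ * L) (fun x y => by
        rw [← mul_sub, abs_mul, abs_mul, hsabs, one_mul, abs_of_pos (by positivity), mul_assoc]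
        exact mul_le_mul_of_nonneg_left (hL x y) (by positivity)) hcont (fun n k => by
        rw [dvar_const_mul, mul_pow, hs, one_mul, inv_pow, inv_mul_le_iff₀ (by positivity)]
        have := hV n k
        nlinarith) hc0.le (by rw [hc]; exact (inv_mul_cancel₀ (by positivity)).le) 0 k
    refine h1.trans ?_
    gcongr
    rw [dav_const_mul]
    have h2 : |c * (s * W⁻¹ * dav 0 k g)| ≤ M := by
      rw [abs_mul, abs_mul, abs_mul, hsabs, one_mul, abs_of_pos hc0,
        abs_of_pos (inv_pos.2 (by linarith : 0 < W))]
      calc c * (W⁻¹ * |dav 0 k g|) ≤ 1 * (1 * M) := by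
            gcongr
            exact inv_le_one_of_one_le₀ hW1
        _ = M := by ring
    exact (le_abs_self _).trans h2
  have hp := hJN 1 (by norm_num)
  have hn := hJN (-1) (by norm_num)
  have hE : ∀ s : ℝ, Continuous fun x => Real.exp (c * (s * W⁻¹ * g x)) := fun s => by fun_prop
  have hpt : ∀ x, |g x| ^ m ≤ m.factorial * (2 * 2 ^ d * W) ^ m *
      (Real.exp (c * (1 * W⁻¹ * g x)) + Real.exp (c * (-1 * W⁻¹ * g x))) := by
    intro x
    have h1 := Real.pow_div_factorial_le_exp (c * (W⁻¹ * |g x|)) (by positivity) m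
    have h2 : Real.exp (c * (W⁻¹ * |g x|)) ≤
        Real.exp (c * (1 * W⁻¹ * g x)) + Real.exp (c * (-1 * W⁻¹ * g x)) := by
      rcases abs_choice (g x) with h | h
      · rw [h, one_mul]
        linarith [Real.exp_pos (c * (-1 * W⁻¹ * g x))]
      · rw [h]
        have : c * (W⁻¹ * -g x) = c * (-1 * W⁻¹ * g x) := by ring
        rw [this]
        linarith [Real.exp_pos (c * (1 * W⁻¹ * g x))]
    have h3 : |g x| ^ m = m.factorial * (2 * 2 ^ d * W) ^ m *
        ((c * (W⁻¹ * |g x|)) ^ m / m.factorial) := by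
      have : |g x| = (2 * 2 ^ d * W) * (c * (W⁻¹ * |g x|)) := by
        rw [hc]; field_simp
      conv_lhs => rw [this, mul_pow]
      have : (m.factorial : ℝ) ≠ 0 := by positivity
      field_simp
    rw [h3]
    gcongr
    exact h1.trans h2
  calc dav 0 k (fun x => |g x| ^ m)
      ≤ dav 0 k (fun x => m.factorial * (2 * 2 ^ d * W) ^ m *
        (Real.exp (c * (1 * W⁻¹ * g x)) + Real.exp (c * (-1 * W⁻¹ * g x)))) :=
        dav_mono (hg.abs.pow m) (((hE 1).add (hE (-1))).const_mul _) fun x _ => hpt x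
    _ ≤ _ := by
        rw [dav_const_mul, dav_add (hE 1) (hE (-1))]
        gcongr
        linarith

theorem exists_dav_norm_pow_le {d : ℕ} (hd : 0 < d) {C : ℝ} {K : ℕ → Rd d → ℂ}
    (hK : KernelSeq C K) (m : ℕ) :
    ∃ D : ℝ, 0 ≤ D ∧ ∀ (u : Rd d → ℂ), BddInt 1 u → ∀ (N : ℕ) (k : Fin d → ℤ),
      dav 0 k (fun x => ‖cv (pk K N) u x‖ ^ m) ≤ D := by
  obtain ⟨V, hV0, hV⟩ := exists_dav_oscillation_le hd hK
  set E : ℝ := m.factorial * (2 * 2 ^ d * (V + 1)) ^ m * (24 * Real.exp (2 * V + 1)) with hE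
  refine ⟨2 ^ (m - 1) * (E + E), by positivity, fun u hu N k => ?_⟩
  have hc := hK.continuous_cv_pk hu N
  have hlip := hK.norm_cv_pk_sub_le hu N
  have key : ∀ T : ℂ →ₗ[ℝ] ℝ, (∀ z, |T z| ≤ ‖z‖) → Continuous (fun x => T (cv (pk K N) u x)) →
      dav 0 k (fun x => |T (cv (pk K N) u x)| ^ m) ≤ E := by
    intro T hT hTc
    have hosc : ∀ n k, ∃ c : ℂ, dav n k (fun x => (T (cv (pk K N) u x) - T c) ^ 2) ≤ V ∧
        (n = 0 → ‖c‖ ≤ V) := by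
      intro n k
      obtain ⟨c, h1, h2⟩ := hV u hu N n k
      refine ⟨c, le_trans (dav_mono ((hTc.sub continuous_const).pow 2)
        ((hc.sub continuous_const).norm.pow 2) fun x _ => ?_) h1, h2⟩
      have := hT (cv (pk K N) u x - c)
      rw [map_sub] at this
      exact sq_le_sq' (abs_le.1 this).1 (abs_le.1 this).2
    refine dav_abs_pow_le (L := 1 * C * 2 ^ N) (fun x y => ?_) hTc hV0.le (fun n k => ?_) k ?_ m
    · rw [← map_sub]
      exact (hT _).trans (hlip x y)
    · obtain ⟨c, h1, -⟩ := hosc n k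
      exact (dvar_le hTc _).trans h1
    -- On a unit cube the mean is within V + 1 of `T c` because the squared distance is at most V,
    -- and `T c` itself is at most V in absolute value.
    · obtain ⟨c, h1, h2⟩ := hosc 0 k
      rw [dav_sub_sq hTc] at h1
      have h3 := dvar_nonneg (n := 0) (k := k) hTc
      have h4 : |dav 0 k (fun x => T (cv (pk K N) u x)) - T c| ≤ V + 1 :=
        abs_le_of_sq_le_sq (by nlinarith) (by linarith)
      have h5 := (hT c).trans (h2 rfl)
      have h6 := abs_add_le (dav 0 k (fun x => T (cv (pk K N) u x)) - T c) (T c)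
      rw [sub_add_cancel] at h6
      linarith
  have hre := key Complex.reLm Complex.abs_re_le_norm (Complex.continuous_re.comp hc)
  have him := key Complex.imLm Complex.abs_im_le_norm (Complex.continuous_im.comp hc)
  have c1 : Continuous fun x => |Complex.reLm (cv (pk K N) u x)| ^ m :=
    (Complex.continuous_re.comp hc).abs.pow m
  have c2 : Continuous fun x => |Complex.imLm (cv (pk K N) u x)| ^ m :=
    (Complex.continuous_im.comp hc).abs.pow m
  calc dav 0 k (fun x => ‖cv (pk K N) u x‖ ^ m)
      ≤ dav 0 k (fun x => 2 ^ (m - 1) * (|Complex.reLm (cv (pk K N) u x)| ^ m +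
          |Complex.imLm (cv (pk K N) u x)| ^ m)) := by
        refine dav_mono (hc.norm.pow m) ((c1.add c2).const_mul _) fun x _ => ?_
        refine le_trans ?_ (add_pow_le (abs_nonneg _) (abs_nonneg _) m)
        gcongr
        exact Complex.norm_le_abs_re_add_abs_im _
    _ ≤ _ := by
        rw [dav_const_mul, dav_add c1 c2]
        gcongr

theorem exists_finset_dcube_cover {d : ℕ} {s : Set (Rd d)} (hs : IsCompact s) :
    ∃ F : Finset (Fin d → ℤ), s ⊆ ⋃ k ∈ F, dcube 0 k := by
  obtain ⟨r, hr⟩ := hs.isBounded.subset_closedBall (0 : Rd d)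
  obtain ⟨n, hn⟩ := exists_nat_ge r
  refine ⟨Fintype.piFinset fun _ => Finset.Icc (-(n : ℤ) - 1) (n + 1), fun y hy => ?_⟩
  have hy' : ‖y‖ ≤ n := by simpa using (Metric.mem_closedBall.1 (hr hy)).trans hn
  simp only [Set.mem_iUnion, exists_prop]
  refine ⟨fun i => ⌊(2 : ℝ) ^ 0 * y i⌋, Fintype.mem_piFinset.2 fun i => ?_, fun i => rfl⟩
  have h1 : |y i| ≤ n := (by simpa using PiLp.norm_apply_le y i : |y i| ≤ ‖y‖).trans hy'
  have h2 := abs_le.1 h1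
  rw [pow_zero, one_mul, Finset.mem_Icc]
  constructor
  · refine Int.le_floor.2 ?_
    push_cast
    linarith
  · have := Int.floor_le (y i)
    have h3 : ((⌊y i⌋ : ℤ) : ℝ) ≤ ((n + 1 : ℤ) : ℝ) := by push_cast; linarith
    exact_mod_cast h3

theorem exists_integral_norm_pow_le {d : ℕ} (hd : 0 < d) {C : ℝ} {K : ℕ → Rd d → ℂ}
    (hK : KernelSeq C K) (m : ℕ) {s : Set (Rd d)} (hs : IsCompact s) :
    ∃ D : ℝ, 0 ≤ D ∧ ∀ (u : Rd d → ℂ), BddInt 1 u → ∀ N : ℕ,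
      ∫ x in s, ‖cv (pk K N) u x‖ ^ m ≤ D := by
  obtain ⟨D, hD0, hD⟩ := exists_dav_norm_pow_le hd hK m
  obtain ⟨F, hF⟩ := exists_finset_dcube_cover hs
  refine ⟨F.card * D, by positivity, fun u hu N => ?_⟩
  have hc := (hK.continuous_cv_pk hu N).norm.pow m
  have hi : ∀ k ∈ F, IntegrableOn (fun x => ‖cv (pk K N) u x‖ ^ m) (dcube 0 k) :=
    fun k _ => integrableOn_dcube k hc
  have hdisj : Set.PairwiseDisjoint (F : Set (Fin d → ℤ)) fun k => (dcube 0 k : Set (Rd d)) := by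
    intro k _ k' _ hne
    refine Set.disjoint_left.2 fun y hy hy' => hne ?_
    funext i
    exact (hy i).symm.trans (hy' i)
  calc ∫ x in s, ‖cv (pk K N) u x‖ ^ m ≤ ∫ x in ⋃ k ∈ F, dcube 0 k, ‖cv (pk K N) u x‖ ^ m :=
        setIntegral_mono_set (integrableOn_finset_iUnion.2 hi)
          (Eventually.of_forall fun x => by positivity) hF.eventuallyLE
    _ = ∑ k ∈ F, ∫ x in dcube 0 k, ‖cv (pk K N) u x‖ ^ m :=
        integral_biUnion_finset F (fun k _ => measurableSet_dcube 0 k) hdisj hi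
    _ ≤ ∑ k ∈ F, D := by
        refine Finset.sum_le_sum fun k _ => ?_
        have := hD u hu N k
        simpa [dav] using this
    _ = _ := by simp

/-! ### Lipschitz approximation and finite nets. -/

/-- Inf-convolution of f with L ‖x - y‖. For L = 2B/δ the points y farther than δ from x pay a
penalty of at least 2B and cannot go below f(x); nearer ones differ from f(x) by at most ε. -/
theorem exists_lipschitz_approx_real {E : Type*} [NormedAddCommGroup E] {f : E → ℝ} {B ε : ℝ}
    (hf : UniformContinuous f) (hB : ∀ x, |f x| ≤ B) (hε : 0 < ε) :
    ∃ (g : E → ℝ) (L : ℝ), 0 ≤ L ∧ (∀ x y, |g x - g y| ≤ L * ‖x - y‖) ∧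
      ∀ x, |f x - g x| ≤ ε := by
  obtain ⟨δ, hδ, hfδ⟩ := Metric.uniformContinuous_iff.1 hf ε hε
  have hB0 : 0 ≤ B := (abs_nonneg _).trans (hB 0)
  set L : ℝ := 2 * B / δ with hL
  have hL0 : 0 ≤ L := by positivity
  have hbdd : ∀ x, BddBelow (Set.range fun y => f y + L * ‖x - y‖) := fun x => by
    refine ⟨-B, ?_⟩
    rintro _ ⟨y, rfl⟩
    have := (abs_le.1 (hB y)).1
    have : 0 ≤ L * ‖x - y‖ := by positivity
    simp only
    linarith
  let g : E → ℝ := fun x => ⨅ y, (f y + L * ‖x - y‖)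
  have hlip : ∀ x y, g x ≤ g y + L * ‖x - y‖ := by
    intro x y
    rw [← sub_le_iff_le_add]
    refine le_ciInf fun z => ?_
    have h1 : g x ≤ f z + L * ‖x - z‖ := ciInf_le (hbdd x) z
    have h2 : ‖x - z‖ ≤ ‖x - y‖ + ‖y - z‖ := by
      have : x - z = (x - y) + (y - z) := by abel
      rw [this]
      exact norm_add_le _ _
    nlinarith
  refine ⟨g, L, hL0, fun x y => ?_, fun x => ?_⟩
  · have h1 := hlip x y
    have h2 := hlip y x
    rw [norm_sub_rev] at h2
    rw [abs_le]
    constructor <;> linarith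
  · have h1 : g x ≤ f x := by
      have := ciInf_le (hbdd x) x
      simpa using this
    have h2 : f x - ε ≤ g x := by
      refine le_ciInf fun y => ?_
      rcases lt_or_ge ‖x - y‖ δ with h | h
      · have h3 := hfδ (a := x) (b := y) (by rwa [dist_eq_norm])
        rw [Real.dist_eq] at h3
        have h4 := (abs_lt.1 h3).2
        have : 0 ≤ L * ‖x - y‖ := by positivity
        linarith
      · have h3 : 2 * B ≤ L * ‖x - y‖ := by
          calc 2 * B = L * δ := by rw [hL]; field_simp
            _ ≤ _ := by gcongr
        have h4 := (abs_le.1 (hB x)).2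
        have h5 := (abs_le.1 (hB y)).1
        linarith
    rw [abs_le]
    constructor <;> linarith

theorem exists_lipschitz_approx {E : Type*} [NormedAddCommGroup E] {f : E → ℂ} {B ε : ℝ}
    (hf : UniformContinuous f) (hB : ∀ x, ‖f x‖ ≤ B) (hε : 0 < ε) :
    ∃ (g : E → ℂ) (L : ℝ), 0 ≤ L ∧ (∀ x y, ‖g x - g y‖ ≤ L * ‖x - y‖) ∧
      ∀ x, ‖f x - g x‖ ≤ ε := by
  obtain ⟨g₁, L₁, h₁, h₁', h₁''⟩ := exists_lipschitz_approx_real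
    (Complex.reCLM.uniformContinuous.comp hf) (fun x => (Complex.abs_re_le_norm _).trans (hB x))
    (half_pos hε)
  obtain ⟨g₂, L₂, h₂, h₂', h₂''⟩ := exists_lipschitz_approx_real
    (Complex.imCLM.uniformContinuous.comp hf) (fun x => (Complex.abs_im_le_norm _).trans (hB x))
    (half_pos hε)
  refine ⟨fun x => ⟨g₁ x, g₂ x⟩, L₁ + L₂, by positivity, fun x y => ?_, fun x => ?_⟩
  · refine (Complex.norm_le_abs_re_add_abs_im _).trans ?_
    rw [add_mul]
    exact add_le_add (h₁' x y) (h₂' x y)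
  · refine (Complex.norm_le_abs_re_add_abs_im _).trans ?_
    have := add_le_add (h₁'' x) (h₂'' x)
    rw [add_halves] at this
    exact this

/-- A bounded equi-Lipschitz family on a compact set has finite nets in the uniform norm. -/
theorem exists_finite_net_of_lipschitz {E ι : Type*} [NormedAddCommGroup E] {s : Set E}
    (hs : IsCompact s) {f : ι → E → ℂ} {B L ε : ℝ} (hL : 0 ≤ L) (hε : 0 < ε)
    (hB : ∀ i, ∀ x ∈ s, ‖f i x‖ ≤ B) (hf : ∀ i, ∀ x ∈ s, ∀ y ∈ s, ‖f i x - f i y‖ ≤ L * ‖x - y‖) :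
    ∃ J : Set ι, J.Finite ∧ ∀ i, ∃ j ∈ J, ∀ x ∈ s, ‖f i x - f j x‖ ≤ ε := by
  set η : ℝ := ε / (4 * (L + 1)) with hη
  have hη0 : 0 < η := by positivity
  have hLη : L * η ≤ ε / 4 := by
    have h1 : (L + 1) * η = ε / 4 := by rw [hη]; field_simp
    nlinarith
  obtain ⟨t, hts, htf, htc⟩ := hs.finite_cover_balls hη0
  have := htf.fintype
  -- Sampling on a finite η-net reduces the problem to a bounded set in a finite-dimensional space;
  -- the Lipschitz bound controls the values between sample points.
  let Φ : ι → (t → ℂ) := fun i x => f i x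
  have hbd : Bornology.IsBounded (Set.range Φ) := by
    refine (Metric.isBounded_closedBall (x := (0 : t → ℂ)) (r := max B 0)).subset ?_
    rintro _ ⟨i, rfl⟩
    rw [mem_closedBall_zero_iff, pi_norm_le_iff_of_nonneg (le_max_right _ _)]
    exact fun x => (hB i x (hts x.2)).trans (le_max_left _ _)
  obtain ⟨T, hT, hTf, hTc⟩ := Metric.finite_approx_of_totallyBounded
    (hbd.isCompact_closure.totallyBounded.subset subset_closure) (ε / 2)
    (half_pos hε)
  have hsel : ∀ z : T, ∃ i, Φ i = (z : t → ℂ) := fun z => hT z.2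
  choose σ hσ using hsel
  have := hTf.to_subtype
  refine ⟨Set.range σ, Set.finite_range σ, fun i => ?_⟩
  obtain ⟨z, hzT, hz⟩ := Set.mem_iUnion₂.1 (hTc ⟨i, rfl⟩)
  refine ⟨σ ⟨z, hzT⟩, ⟨_, rfl⟩, fun x hx => ?_⟩
  obtain ⟨y, hyt, hy⟩ := Set.mem_iUnion₂.1 (htc hx)
  rw [Metric.mem_ball, dist_eq_norm] at hy hz
  rw [← show Φ (σ ⟨z, hzT⟩) = z from hσ ⟨z, hzT⟩] at hz
  have h1 := (norm_le_pi_norm (Φ i - Φ (σ ⟨z, hzT⟩)) ⟨y, hyt⟩).trans hz.le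
  have h1' : ‖f i y - f (σ ⟨z, hzT⟩) y‖ ≤ ε / 2 := h1
  have h2 := hf i x hx y (hts hyt)
  have h3 := hf (σ ⟨z, hzT⟩) y (hts hyt) x hx
  rw [norm_sub_rev y x] at h3
  have h4 : L * ‖x - y‖ ≤ ε / 4 := (by gcongr : L * ‖x - y‖ ≤ L * η).trans hLη
  have e : f i x - f (σ ⟨z, hzT⟩) x = (f i x - f i y) + (f i y - f (σ ⟨z, hzT⟩) y) +
      (f (σ ⟨z, hzT⟩) y - f (σ ⟨z, hzT⟩) x) := by ring
  rw [e]
  refine (norm_add₃_le).trans ?_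
  linarith

/-! ### Truncated commutators. -/

/-- The commutator of the truncated convolution operator with multiplication by `b`. -/
noncomputable def truncComm {d : ℕ} (K : ℕ → Rd d → ℂ) (b : Rd d → ℂ) (N : ℕ) (u : Rd d → ℂ)
    (x : Rd d) : ℂ :=
  cv (pk K N) (fun y => b y * u y) x - b x * cv (pk K N) u x

theorem continuous_of_norm_sub_le {d : ℕ} {b : Rd d → ℂ} {L : ℝ} (hL0 : 0 ≤ L)
    (hL : ∀ x y, ‖b x - b y‖ ≤ L * ‖x - y‖) : Continuous b :=
  (LipschitzWith.of_dist_le_mul (K := ⟨L, hL0⟩) fun x y => by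
    rw [dist_eq_norm, dist_eq_norm]; exact hL x y).continuous

namespace KernelSeq

variable {d : ℕ} {C : ℝ} {K : ℕ → Rd d → ℂ}

/-- The commutator kernel carries the factor b(y) - b(x). Boundedness and the Lipschitz condition
make it Hölder of order 1/4, exactly what the moment of K j can absorb, and this yields decay in j.
-/
theorem norm_cv_comm_le (h : KernelSeq C K) {R : ℝ} {u : Rd d → ℂ} (hu : BddInt R u)
    {b : Rd d → ℂ} {B L : ℝ} (hB : ∀ x, ‖b x‖ ≤ B) (hL0 : 0 ≤ L)
    (hL : ∀ x y, ‖b x - b y‖ ≤ L * ‖x - y‖) (j : ℕ) (x : Rd d) :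
    ‖cv (K j) (fun y => b y * u y) x - b x * cv (K j) u x‖ ≤
      R * ((L + 2 * B) * (C * (2 ^ j) ^ (-(1 / 4) : ℝ))) := by
  have hbc := continuous_of_norm_sub_le hL0 hL
  have hKi := (h.bound j).integrable
  have hbu := hu.mul hbc hB
  have hR := hu.nonneg
  have hB0 : 0 ≤ B := (norm_nonneg _).trans (hB 0)
  have hhol : ∀ x y, ‖b y - b x‖ ≤ (L + 2 * B) * ‖x - y‖ ^ (1 / 4 : ℝ) := by
    intro x y
    rcases le_total ‖x - y‖ 1 with h1 | h1
    · have h2 := Real.self_le_rpow_of_le_one (norm_nonneg (x - y)) h1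
        (by norm_num : (1 / 4 : ℝ) ≤ 1)
      calc _ ≤ L * ‖x - y‖ := by rw [norm_sub_rev x y]; exact hL y x
        _ ≤ (L + 2 * B) * ‖x - y‖ ^ (1 / 4 : ℝ) := by gcongr; linarith
    · have h2 := Real.one_le_rpow h1 (by norm_num : (0 : ℝ) ≤ 1 / 4)
      calc _ ≤ ‖b y‖ + ‖b x‖ := norm_sub_le _ _
        _ ≤ (L + 2 * B) * 1 := by linarith [hB x, hB y]
        _ ≤ (L + 2 * B) * ‖x - y‖ ^ (1 / 4 : ℝ) := by gcongr
  have e : cv (K j) (fun y => b y * u y) x - b x * cv (K j) u x =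
      ∫ y, (b y - b x) * (K j (x - y) * u y) := by
    unfold cv
    rw [← integral_const_mul, ← integral_sub (integrable_cv_integrand hKi hbu x)
      ((integrable_cv_integrand hKi hu x).const_mul _)]
    refine integral_congr_ae (Eventually.of_forall fun y => ?_)
    simp only
    ring
  rw [e]
  have hw := (h.bound j).integrable_weight.comp_sub_left x
  calc _ ≤ ∫ y, R * ((L + 2 * B) * (‖x - y‖ ^ (1 / 4 : ℝ) * ‖K j (x - y)‖)) := by
        refine norm_integral_le_of_norm_le ((hw.const_mul _).const_mul R) ?_
        filter_upwards [hu.bound] with y hy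
        rw [norm_mul, norm_mul]
        calc ‖b y - b x‖ * (‖K j (x - y)‖ * ‖u y‖)
            ≤ ((L + 2 * B) * ‖x - y‖ ^ (1 / 4 : ℝ)) * (‖K j (x - y)‖ * R) := by
              gcongr; exact hhol x y
          _ = _ := by ring
    _ = R * ((L + 2 * B) * ∫ z, ‖z‖ ^ (1 / 4 : ℝ) * ‖K j z‖) := by
        rw [integral_const_mul, integral_const_mul,
          integral_sub_left_eq_self (fun z => ‖z‖ ^ (1 / 4 : ℝ) * ‖K j z‖) volume x]
    _ ≤ _ := by gcongr; exact (h.bound j).weight_le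

/-- Geometric tail of the previous decay: for Lipschitz b the truncated commutators converge
uniformly in x and in u with ‖u‖ ≤ R a.e. -/
theorem norm_truncComm_sub_le (h : KernelSeq C K) {R : ℝ} {u : Rd d → ℂ} (hu : BddInt R u)
    {b : Rd d → ℂ} {B L : ℝ} (hB : ∀ x, ‖b x‖ ≤ B) (hL0 : 0 ≤ L)
    (hL : ∀ x y, ‖b x - b y‖ ≤ L * ‖x - y‖) {M N : ℕ} (hMN : M ≤ N) (x : Rd d) :
    ‖truncComm K b N u x - truncComm K b M u x‖ ≤ R * ((L + 2 * B) * C) *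
      (((2 : ℝ) ^ (-(1 / 4) : ℝ)) ^ M / (1 - 2 ^ (-(1 / 4) : ℝ))) := by
  have hbc := continuous_of_norm_sub_le hL0 hL
  have hbu := hu.mul hbc hB
  have hR := hu.nonneg
  have hC := h.pos.le
  have hB0 : 0 ≤ B := (norm_nonneg _).trans (hB 0)
  set r : ℝ := (2 : ℝ) ^ (-(1 / 4) : ℝ) with hr
  have hr0 : 0 < r := by positivity
  have hr1 : r < 1 := Real.rpow_lt_one_of_one_lt_of_neg one_lt_two (by norm_num)
  have e : truncComm K b N u x - truncComm K b M u x = ∑ j ∈ Finset.Ico M N,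
      (cv (K j) (fun y => b y * u y) x - b x * cv (K j) u x) := by
    unfold truncComm
    rw [h.cv_pk hu, h.cv_pk hu, h.cv_pk hbu, h.cv_pk hbu, Finset.sum_sub_distrib, ← Finset.mul_sum,
      Finset.sum_Ico_eq_sub _ hMN, Finset.sum_Ico_eq_sub _ hMN]
    ring
  rw [e]
  calc _ ≤ ∑ j ∈ Finset.Ico M N, R * ((L + 2 * B) * C) * r ^ j := by
        refine norm_sum_le_of_le _ fun j _ => (h.norm_cv_comm_le hu hB hL0 hL j x).trans_eq ?_
        rw [hr, ← Real.rpow_natCast, ← Real.rpow_natCast, ← Real.rpow_mul (by norm_num),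
          ← Real.rpow_mul (by norm_num), mul_comm (j : ℝ)]
        ring
    _ ≤ _ := by
        rw [← Finset.mul_sum]
        gcongr
        exact geom_sum_Ico_le_of_lt_one hr0.le hr1

theorem norm_truncComm_sub_truncComm_le (h : KernelSeq C K) {R : ℝ} {u : Rd d → ℂ}
    (hu : BddInt R u) {b : Rd d → ℂ} {B L : ℝ} (hB : ∀ x, ‖b x‖ ≤ B) (hL0 : 0 ≤ L)
    (hL : ∀ x y, ‖b x - b y‖ ≤ L * ‖x - y‖) (N : ℕ) (x y : Rd d) :
    ‖truncComm K b N u x - truncComm K b N u y‖ ≤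
      (2 * B * R * C * 2 ^ N + L * (R * ∫ z, ‖pk K N z‖)) * ‖x - y‖ := by
  have hbc := continuous_of_norm_sub_le hL0 hL
  have hbu := hu.mul hbc hB
  have h1 := h.norm_cv_pk_sub_le hbu N x y
  have h2 := h.norm_cv_pk_sub_le hu N x y
  have h3 := norm_cv_le (h.integrable_pk N) hu y
  have h0 := hu.nonneg
  have hC := h.pos.le
  have hB0 : 0 ≤ B := (norm_nonneg _).trans (hB 0)
  have e : truncComm K b N u x - truncComm K b N u y =
      (cv (pk K N) (fun y => b y * u y) x - cv (pk K N) (fun y => b y * u y) y) -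
      (b x * (cv (pk K N) u x - cv (pk K N) u y) + (b x - b y) * cv (pk K N) u y) := by
    unfold truncComm; ring
  rw [e]
  calc _ ≤ ‖cv (pk K N) (fun y => b y * u y) x - cv (pk K N) (fun y => b y * u y) y‖ +
        (‖b x‖ * ‖cv (pk K N) u x - cv (pk K N) u y‖ + ‖b x - b y‖ * ‖cv (pk K N) u y‖) := by
        refine (norm_sub_le _ _).trans (add_le_add le_rfl ((norm_add_le _ _).trans ?_))
        rw [norm_mul, norm_mul]
    _ ≤ B * R * C * 2 ^ N * ‖x - y‖ + (B * (R * C * 2 ^ N * ‖x - y‖) +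
        L * ‖x - y‖ * (R * ∫ z, ‖pk K N z‖)) := by
        gcongr
        · exact hB x
        · exact hL x y
    _ = _ := by ring

theorem norm_truncComm_le (h : KernelSeq C K) {R : ℝ} {u : Rd d → ℂ}
    (hu : BddInt R u) {b : Rd d → ℂ} {B : ℝ} (hB : ∀ x, ‖b x‖ ≤ B) (hbc : Continuous b) (N : ℕ)
    (x : Rd d) : ‖truncComm K b N u x‖ ≤ 2 * B * (R * ∫ z, ‖pk K N z‖) := by
  have h1 := norm_cv_le (h.integrable_pk N) (hu.mul hbc hB) x
  have h3 := norm_cv_le (h.integrable_pk N) hu x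
  have hB0 : 0 ≤ B := (norm_nonneg _).trans (hB 0)
  calc _ ≤ ‖cv (pk K N) (fun y => b y * u y) x‖ + ‖b x‖ * ‖cv (pk K N) u x‖ := by
        rw [← norm_mul]; exact norm_sub_le _ _
    _ ≤ B * R * (∫ z, ‖pk K N z‖) + B * (R * ∫ z, ‖pk K N z‖) := by
        gcongr
        exact hB x
    _ = _ := by ring

end KernelSeq

/-- Hölder on the finite measure of s passes from an integer exponent above p to p; homogeneity
passes from R = 1 to general R. -/
theorem exists_eLpNorm_cv_le {d : ℕ} (hd : 0 < d) {C : ℝ} {K : ℕ → Rd d → ℂ}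
    (hK : KernelSeq C K) {p : ℝ≥0∞} (hp : 1 ≤ p) (hp' : p < ∞) {s : Set (Rd d)}
    (hs : IsCompact s) :
    ∃ D : ℝ, 0 ≤ D ∧ ∀ (R : ℝ) (u : Rd d → ℂ), 0 < R → BddInt R u → ∀ N : ℕ,
      eLpNorm (cv (pk K N) u) p (volume.restrict s) ≤ ENNReal.ofReal (D * R) := by
  obtain ⟨m, hm⟩ := exists_nat_gt p.toReal
  have hm0 : 0 < m := by exact_mod_cast ENNReal.toReal_nonneg.trans_lt hm
  have hpm : p ≤ (m : ℝ≥0∞) := by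
    rw [← ENNReal.ofReal_toReal hp'.ne, ← ENNReal.ofReal_natCast]
    exact ENNReal.ofReal_le_ofReal hm.le
  obtain ⟨D, hD0, hD⟩ := exists_integral_norm_pow_le hd hK m hs
  have : IsFiniteMeasure (volume.restrict s) := ⟨by simpa using hs.measure_lt_top⟩
  set E : ℝ≥0∞ := ENNReal.ofReal (D ^ ((m : ℝ)⁻¹)) *
    (volume.restrict s) Set.univ ^ (1 / p.toReal - 1 / (m : ℝ≥0∞).toReal) with hE
  have hEfin : E ≠ ∞ := by
    refine ENNReal.mul_ne_top ENNReal.ofReal_ne_top (ENNReal.rpow_ne_top_of_nonneg ?_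
      (measure_ne_top _ _))
    rw [sub_nonneg]
    have hp0 : 0 < p.toReal := ENNReal.toReal_pos (by positivity) hp'.ne
    rw [ENNReal.toReal_natCast]
    exact one_div_le_one_div_of_le hp0 hm.le
  have h1 : ∀ u : Rd d → ℂ, BddInt 1 u → ∀ N : ℕ,
      eLpNorm (cv (pk K N) u) p (volume.restrict s) ≤ E := by
    intro u hu N
    have hc := hK.continuous_cv_pk hu N
    have hmem : MemLp (cv (pk K N) u) m (volume.restrict s) :=
      MemLp.of_bound hc.aestronglyMeasurable _ (Eventually.of_forall fun x =>
        norm_cv_le (hK.integrable_pk N) hu x)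
    refine (eLpNorm_le_eLpNorm_mul_rpow_measure_univ hpm hc.aestronglyMeasurable).trans ?_
    rw [hE]
    gcongr
    rw [hmem.eLpNorm_eq_integral_rpow_norm (by exact_mod_cast hm0.ne') (by simp)]
    simp only [ENNReal.toReal_natCast, Real.rpow_natCast]
    gcongr
    exact hD u hu N
  refine ⟨E.toReal, ENNReal.toReal_nonneg, fun R u hR hu N => ?_⟩
  have hu' : BddInt 1 (fun x => ((R⁻¹ : ℝ) : ℂ) * u x) := by
    refine ⟨hu.integrable.const_mul _, ?_⟩
    filter_upwards [hu.bound] with x hx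
    rw [norm_mul, Complex.norm_real, Real.norm_of_nonneg (by positivity), inv_mul_le_iff₀ hR,
      mul_one]
    exact hx
  have h2 := h1 _ hu' N
  have e : cv (pk K N) u = (R : ℂ) • cv (pk K N) (fun x => ((R⁻¹ : ℝ) : ℂ) * u x) := by
    funext x
    rw [Pi.smul_apply, cv_const_mul, smul_eq_mul, ← mul_assoc]
    push_cast
    rw [mul_inv_cancel₀ (by exact_mod_cast hR.ne'), one_mul]
  rw [e, eLpNorm_const_smul, ENNReal.ofReal_mul ENNReal.toReal_nonneg, ENNReal.ofReal_toReal hEfin,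
    mul_comm]
  gcongr
  rw [← ofReal_norm, Complex.norm_real, Real.norm_of_nonneg hR.le]

/-! ### The multiplier on L² as a limit of truncations. -/

theorem memLp_mul_of_bound {d : ℕ} {a : Rd d → ℂ} {C : ℝ} (ha : Continuous a)
    (hC : ∀ ξ, ‖a ξ‖ ≤ C) (u : L2 d) : MemLp (fun ξ => a ξ * u ξ) 2 (volume : Measure (Rd d)) :=
  (Lp.memLp u).mul (memLp_top_of_bound ha.aestronglyMeasurable C (Eventually.of_forall hC))

/-- Multiplication by a bounded continuous function on `L²`. -/
noncomputable def mulCLM {d : ℕ} (a : Rd d → ℂ) {C : ℝ} (ha : Continuous a)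
    (hC : ∀ ξ, ‖a ξ‖ ≤ C) : L2 d →L[ℂ] L2 d :=
  LinearMap.mkContinuous
    { toFun := fun u => (memLp_mul_of_bound ha hC u).toLp _
      map_add' := fun u v => by
        rw [← MemLp.toLp_add]
        refine MemLp.toLp_congr _ _ ?_
        filter_upwards [Lp.coeFn_add u v] with x hx
        rw [hx, Pi.add_apply, Pi.add_apply, mul_add]
      map_smul' := fun c u => by
        rw [RingHom.id_apply, ← MemLp.toLp_const_smul]
        refine MemLp.toLp_congr _ _ ?_
        filter_upwards [Lp.coeFn_smul c u] with x hx
        rw [hx, Pi.smul_apply, Pi.smul_apply, smul_eq_mul, smul_eq_mul, mul_left_comm] } C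
    fun u => Lp.norm_le_mul_norm_of_ae_le_mul (by
      filter_upwards [(memLp_mul_of_bound ha hC u).coeFn_toLp] with x hx
      have := hC x
      simp only [LinearMap.coe_mk, AddHom.coe_mk]
      rw [hx, norm_mul]
      gcongr)

theorem coeFn_mulCLM {d : ℕ} {a : Rd d → ℂ} {C : ℝ} (ha : Continuous a)
    (hC : ∀ ξ, ‖a ξ‖ ≤ C) (u : L2 d) : mulCLM a ha hC u =ᵐ[volume] fun ξ => a ξ * u ξ :=
  (memLp_mul_of_bound ha hC u).coeFn_toLp

theorem existsUnique_fourierMultiplier {d : ℕ} {a : Rd d → ℂ} {C : ℝ} (ha : Continuous a)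
    (hC : ∀ ξ, ‖a ξ‖ ≤ C) : ∃! A : L2 d →L[ℂ] L2 d, IsFourierMultiplier a A := by
  let F := (Lp.fourierTransformₗᵢ (Rd d) ℂ).toContinuousLinearEquiv
  refine ⟨(F.symm : L2 d →L[ℂ] L2 d) ∘L mulCLM a ha hC ∘L (F : L2 d →L[ℂ] L2 d), ?_, ?_⟩
  · intro u
    have h : (𝓕 ((((F.symm : L2 d →L[ℂ] L2 d) ∘L mulCLM a ha hC ∘L (F : L2 d →L[ℂ] L2 d)) u)) :
        L2 d) = mulCLM a ha hC (𝓕 u) := F.apply_symm_apply _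
    rw [h]
    exact coeFn_mulCLM ha hC _
  · intro A hA
    refine ContinuousLinearMap.ext fun u => ?_
    have h : F (A u) = mulCLM a ha hC (F u) := by
      have h1 : (𝓕 (A u) : L2 d) =ᵐ[volume] fun ξ => a ξ * (𝓕 u : L2 d) ξ := hA u
      exact Lp.ext (h1.trans (coeFn_mulCLM ha hC (𝓕 u)).symm)
    exact (F.eq_symm_apply).2 h

theorem norm_toLp_sq {d : ℕ} {f : Rd d → ℂ} (hf : MemLp f 2 volume) :
    ‖hf.toLp f‖ ^ 2 = ∫ x, ‖f x‖ ^ 2 := by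
  rw [integral_norm_sq_eq_eLpNorm hf, Lp.norm_toLp]

namespace KernelSeq

variable {d : ℕ} {C : ℝ} {K : ℕ → Rd d → ℂ}

theorem memLp_cv_pk (h : KernelSeq C K) {R : ℝ} {u : Rd d → ℂ} (hu : BddInt R u) (N : ℕ) :
    MemLp (cv (pk K N) u) 2 volume :=
  (bddInt_cv (h.integrable_pk N) hu).memLp_two

/-- By Plancherel this is dominated convergence: at each ξ the truncated symbols eventually equal
a(ξ), and the error symbols are bounded by 2C. -/
theorem tendsto_toLp_cv (h : KernelSeq C K) {a : Rd d → ℂ}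
    (ha : Continuous a) (haC : ∀ ξ, ‖a ξ‖ ≤ C)
    (hlim : ∀ ξ, ∀ᶠ N in atTop, ∑ j ∈ Finset.range N, 𝓕 (K j) ξ = a ξ)
    {A : L2 d →L[ℂ] L2 d} (hA : IsFourierMultiplier a A) {R : ℝ} {u : Rd d → ℂ}
    (hu : BddInt R u) :
    Tendsto (fun N => (h.memLp_cv_pk hu N).toLp _) atTop (𝓝 (A (hu.memLp_two.toLp u))) := by
  rw [tendsto_iff_norm_sub_tendsto_zero]
  have hu2 := integrable_norm_sq_fourier hu.integrable hu.memLp_two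
  have hFi : ∀ {f : Rd d → ℂ}, Integrable f → Continuous (𝓕 f) := fun hf =>
    VectorFourier.fourierIntegral_continuous Real.continuous_fourierChar
      (by exact continuous_inner) hf
  have hmem : ∀ N, MemLp (fun ξ => (𝓕 (pk K N) ξ - a ξ) * 𝓕 u ξ) 2 volume := fun N => by
    refine (memLp_fourier hu.integrable hu.memLp_two).mul
      (memLp_top_of_bound ((hFi (h.integrable_pk N)).sub ha).aestronglyMeasurable (C + C)
        (Eventually.of_forall fun ξ => ?_))
    exact (norm_sub_le _ _).trans (add_le_add (h.norm_fourier_pk_le N ξ) (haC ξ))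
  have hnorm : ∀ N, ‖(h.memLp_cv_pk hu N).toLp _ - A (hu.memLp_two.toLp u)‖ ^ 2 =
      ∫ ξ, ‖(𝓕 (pk K N) ξ - a ξ) * 𝓕 u ξ‖ ^ 2 := by
    intro N
    rw [← norm_toLp_sq (hmem N), ← Lp.norm_fourier_eq]
    congr 2
    have hsub : (𝓕 ((h.memLp_cv_pk hu N).toLp _ - A (hu.memLp_two.toLp u)) : L2 d) =
        𝓕 ((h.memLp_cv_pk hu N).toLp _) - 𝓕 (A (hu.memLp_two.toLp u)) :=
      map_sub (Lp.fourierTransformₗᵢ (Rd d) ℂ) _ _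
    rw [hsub]
    refine Lp.ext ?_
    filter_upwards [Lp.coeFn_sub (𝓕 ((h.memLp_cv_pk hu N).toLp _) : L2 d)
      (𝓕 (A (hu.memLp_two.toLp u)) : L2 d), (hmem N).coeFn_toLp,
      hA (hu.memLp_two.toLp u), fourier_toLp_ae_eq hu.integrable hu.memLp_two,
      fourier_toLp_ae_eq (integrable_cv (h.integrable_pk N) hu.integrable)
        (h.memLp_cv_pk hu N)] with ξ h1 h2 h3 h4 h5
    rw [h1, h2, Pi.sub_apply, h3, h4, h5, fourier_cv (h.integrable_pk N) hu.integrable]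
    ring
  have hsq : Tendsto (fun N => ‖(h.memLp_cv_pk hu N).toLp _ - A (hu.memLp_two.toLp u)‖ ^ 2)
      atTop (𝓝 0) := by
    simp_rw [hnorm]
    have h0 : (0 : ℝ) = ∫ _ : Rd d, (0 : ℝ) := by simp
    rw [h0]
    refine tendsto_integral_of_dominated_convergence (fun ξ => (C + C) ^ 2 * ‖𝓕 u ξ‖ ^ 2)
      (fun N => ((hmem N).1.norm.pow 2)) (hu2.const_mul _) (fun N => Eventually.of_forall fun ξ => ?_)
      (Eventually.of_forall fun ξ => ?_)
    · rw [Real.norm_of_nonneg (by positivity), norm_mul, mul_pow]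
      gcongr
      exact (norm_sub_le _ _).trans (add_le_add (h.norm_fourier_pk_le N ξ) (haC ξ))
    · refine tendsto_const_nhds.congr' ?_
      filter_upwards [hlim ξ] with N hN
      have e : 𝓕 (pk K N) ξ = a ξ := by
        rw [← hN]
        exact fourier_sum (N := N) (fun j => (h.bound j).integrable) ξ
      rw [e]
      simp
  have := hsq.sqrt
  simpa [Real.sqrt_sq (norm_nonneg _)] using this

theorem exists_subseq_tendsto_ae (h : KernelSeq C K) {a : Rd d → ℂ}
    (ha : Continuous a) (haC : ∀ ξ, ‖a ξ‖ ≤ C)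
    (hlim : ∀ ξ, ∀ᶠ N in atTop, ∑ j ∈ Finset.range N, 𝓕 (K j) ξ = a ξ)
    {A : L2 d →L[ℂ] L2 d} (hA : IsFourierMultiplier a A) {R : ℝ} {u : Rd d → ℂ}
    (hu : BddInt R u) {ms : ℕ → ℕ} (hms : StrictMono ms) :
    ∃ ns : ℕ → ℕ, StrictMono ns ∧ ∀ᵐ x, Tendsto (fun i => cv (pk K (ms (ns i))) u x) atTop
      (𝓝 (A (hu.memLp_two.toLp u) x)) := by
  have h1 := (h.tendsto_toLp_cv ha haC hlim hA hu).comp hms.tendsto_atTop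
  obtain ⟨ns, hns, hlim'⟩ := (tendstoInMeasure_of_tendsto_Lp h1).exists_seq_tendsto_ae
  refine ⟨ns, hns, ?_⟩
  filter_upwards [hlim', ae_all_iff.2 fun N => (h.memLp_cv_pk hu N).coeFn_toLp] with x hx hx'
  refine hx.congr fun i => ?_
  exact hx' _

theorem exists_subseq_tendsto_commutator (h : KernelSeq C K) {a : Rd d → ℂ}
    (ha : Continuous a) (haC : ∀ ξ, ‖a ξ‖ ≤ C)
    (hlim : ∀ ξ, ∀ᶠ N in atTop, ∑ j ∈ Finset.range N, 𝓕 (K j) ξ = a ξ)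
    {A : L2 d →L[ℂ] L2 d} (hA : IsFourierMultiplier a A) (b : C₀(Rd d, ℂ)) {R : ℝ} {u : Rd d → ℂ}
    (hu : BddInt R u) :
    ∃ ns : ℕ → ℕ, StrictMono ns ∧ ∀ᵐ x, Tendsto (fun i => truncComm K b (ns i) u x) atTop
      (𝓝 (commutatorOp A b (hu.memLp_two.toLp u) x)) := by
  obtain ⟨n1, hn1, h1⟩ := h.exists_subseq_tendsto_ae ha haC hlim hA hu strictMono_id
  have hbu := hu.mul (b := b) (map_continuous b) (B := ‖b.toBCF‖)
    (fun x => b.toBCF.norm_coe_le_norm x)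
  -- Extracting along the first subsequence gives a.e. convergence for u and for b u simultaneously.
  obtain ⟨n2, hn2, h2⟩ := h.exists_subseq_tendsto_ae ha haC hlim hA hbu hn1
  have e : mulOp b (hu.memLp_two.toLp u) = hbu.memLp_two.toLp _ := by
    refine MemLp.toLp_congr _ _ ?_
    filter_upwards [hu.memLp_two.coeFn_toLp] with x hx
    rw [hx]
  refine ⟨n1 ∘ n2, hn1.comp hn2, ?_⟩
  have hc : commutatorOp A b (hu.memLp_two.toLp u) =ᵐ[volume] fun x =>
      A (hbu.memLp_two.toLp _) x - b x * A (hu.memLp_two.toLp u) x := by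
    unfold commutatorOp
    rw [e]
    filter_upwards [Lp.coeFn_sub (A (hbu.memLp_two.toLp _)) (mulOp b (A (hu.memLp_two.toLp u))),
      (memLp_mul_zeroAtInfty b (A (hu.memLp_two.toLp u))).coeFn_toLp] with x hx1 hx2
    rw [hx1, Pi.sub_apply]
    congr 1
  filter_upwards [h1, h2, hc] with x hx1 hx2 hx3
  rw [hx3]
  exact hx2.sub (tendsto_const_nhds.mul (hx1.comp hn2.tendsto_atTop))

end KernelSeq

/-! ### Compact subsets of L^p_loc. -/

namespace LpLoc

variable {d : ℕ} {p : ℝ≥0∞}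

/-- The restriction from `L^p(t)` to `L^p(s)` for `s ⊆ t`. -/
noncomputable def restrictLp {s t : Set (Rd d)} (hst : s ⊆ t)
    (v : Lp (α := Rd d) ℂ p (volume.restrict t)) : Lp (α := Rd d) ℂ p (volume.restrict s) :=
  ((Lp.memLp v).mono_measure (Measure.restrict_mono hst le_rfl)).toLp _

theorem continuous_restrictLp [Fact (1 ≤ p)] {s t : Set (Rd d)} (hst : s ⊆ t) :
    Continuous (restrictLp (p := p) hst) := by
  refine (LipschitzWith.of_dist_le_mul (K := 1) fun v w => ?_).continuous
  rw [NNReal.coe_one, one_mul, dist_eq_norm, dist_eq_norm]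
  unfold restrictLp
  rw [← MemLp.toLp_sub, Lp.norm_toLp, Lp.norm_def]
  refine ENNReal.toReal_mono (Lp.eLpNorm_ne_top _) ?_
  rw [eLpNorm_congr_ae (Lp.coeFn_sub v w)]
  exact eLpNorm_mono_measure _ (Measure.restrict_mono hst le_rfl)

theorem restrictLp_restrict {s t : TopologicalSpace.Compacts (Rd d)}
    (hst : (s : Set (Rd d)) ⊆ t) (f : LpLoc d p) :
    restrictLp hst (f.restrict t) = f.restrict s := by
  refine MemLp.toLp_congr _ _ ?_
  exact ae_mono (Measure.restrict_mono hst le_rfl) (f.memLp t.isCompact).coeFn_toLp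

theorem norm_restrict_sub [Fact (1 ≤ p)] (s : TopologicalSpace.Compacts (Rd d))
    (f g : LpLoc d p) : ‖f.restrict s - g.restrict s‖ =
      (eLpNorm (fun x => f.toAEEqFun x - g.toAEEqFun x) p
        (volume.restrict (s : Set (Rd d)))).toReal := by
  unfold LpLoc.restrict
  rw [← MemLp.toLp_sub, Lp.norm_toLp]
  rfl

/-- The closed ball of radius `n` as a compact set. -/
def ballCompacts (d n : ℕ) : TopologicalSpace.Compacts (Rd d) :=
  ⟨Metric.closedBall 0 n, isCompact_closedBall 0 n⟩

theorem exists_of_compatible (g : ∀ s : TopologicalSpace.Compacts (Rd d),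
      Lp (α := Rd d) ℂ p (volume.restrict (s : Set (Rd d))))
    (hg : ∀ (s t : TopologicalSpace.Compacts (Rd d)) (hst : (s : Set (Rd d)) ⊆ t),
      restrictLp hst (g t) = g s) :
    ∃ G : LpLoc d p, ∀ s, G.restrict s = g s := by
  have hae : ∀ (s t : TopologicalSpace.Compacts (Rd d)), (s : Set (Rd d)) ⊆ t →
      g t =ᵐ[volume.restrict (s : Set (Rd d))] g s := by
    intro s t hst
    rw [← hg s t hst]
    exact (MemLp.coeFn_toLp _).symm
  -- Gluing: x takes its value from the ball of radius ⌈‖x‖⌉. Countably many balls occur, so the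
  -- exceptional null sets can be united.
  let G0 : Rd d → ℂ := fun x => g (ballCompacts d ⌈‖x‖⌉₊) x
  have hball : ∀ n : ℕ, G0 =ᵐ[volume.restrict (ballCompacts d n : Set (Rd d))]
      g (ballCompacts d n) := by
    intro n
    have h1 : ∀ m : ℕ, ∀ᵐ x, m ≤ n → x ∈ (ballCompacts d m : Set (Rd d)) →
        g (ballCompacts d n) x = g (ballCompacts d m) x := by
      intro m
      by_cases hmn : m ≤ n
      · have h2 := hae (ballCompacts d m) (ballCompacts d n)
          (Metric.closedBall_subset_closedBall (by exact_mod_cast hmn))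
        filter_upwards [(ae_restrict_iff' (ballCompacts d m).isCompact.measurableSet).1 h2]
          with x hx _ using hx
      · exact Eventually.of_forall fun x h => absurd h hmn
    refine (ae_restrict_iff' (ballCompacts d n).isCompact.measurableSet).2 ?_
    filter_upwards [ae_all_iff.2 h1] with x hx hxn
    have hxn' : ‖x‖ ≤ n := by simpa [ballCompacts] using hxn
    refine (hx ⌈‖x‖⌉₊ (Nat.ceil_le.2 hxn') ?_).symm
    simpa [ballCompacts] using Nat.le_ceil ‖x‖
  have hsub : ∀ s : TopologicalSpace.Compacts (Rd d), ∃ n : ℕ,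
      (s : Set (Rd d)) ⊆ ballCompacts d n := by
    intro s
    obtain ⟨r, hr⟩ := s.isCompact.isBounded.subset_closedBall (0 : Rd d)
    obtain ⟨n, hn⟩ := exists_nat_ge r
    exact ⟨n, hr.trans (Metric.closedBall_subset_closedBall hn)⟩
  have hcompact : ∀ s : TopologicalSpace.Compacts (Rd d),
      G0 =ᵐ[volume.restrict (s : Set (Rd d))] g s := by
    intro s
    obtain ⟨n, hn⟩ := hsub s
    have h1 : G0 =ᵐ[volume.restrict (s : Set (Rd d))] g (ballCompacts d n) :=
      ae_mono (Measure.restrict_mono hn le_rfl) (hball n)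
    exact h1.trans (hae s _ hn)
  have hmeas : AEStronglyMeasurable G0 volume := by
    have huniv : ⋃ n : ℕ, (ballCompacts d n : Set (Rd d)) = Set.univ :=
      Metric.iUnion_closedBall_nat 0
    rw [← Measure.restrict_univ (μ := (volume : Measure (Rd d))), ← huniv]
    exact AEStronglyMeasurable.iUnion fun n => (Lp.aestronglyMeasurable _).congr (hball n).symm
  have hmk : ∀ s : TopologicalSpace.Compacts (Rd d),
      AEEqFun.mk G0 hmeas =ᵐ[volume.restrict (s : Set (Rd d))] g s := fun s =>
    EventuallyEq.trans (ae_restrict_of_ae (AEEqFun.coeFn_mk G0 hmeas)) (hcompact s)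
  let G : LpLoc d p := (⟨AEEqFun.mk G0 hmeas, fun K hK =>
    (Lp.memLp (g ⟨K, hK⟩)).ae_eq (hmk ⟨K, hK⟩).symm⟩ : lpLocSubmodule d p)
  refine ⟨G, fun s => Lp.ext ?_⟩
  exact (MemLp.coeFn_toLp (G.memLp s.isCompact)).trans (hmk s)

/-- Tychonoff's argument. An ultrafilter on Z converges in every L^p(s), by completeness and total
boundedness; the limits are compatible since restriction is continuous, so they glue to one G. The
topology is the initial one, so this is convergence to G. -/
theorem exists_isCompact_superset [Fact (1 ≤ p)] (T : Set (LpLoc d p))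
    (hT : ∀ s : TopologicalSpace.Compacts (Rd d), TotallyBounded (LpLoc.restrict s '' T)) :
    ∃ Z : Set (LpLoc d p), IsCompact Z ∧ T ⊆ Z := by
  refine ⟨⋂ s : TopologicalSpace.Compacts (Rd d),
    LpLoc.restrict s ⁻¹' closure (LpLoc.restrict s '' T), ?_, ?_⟩
  · rw [isCompact_iff_ultrafilter_le_nhds]
    intro F hF
    have hlim : ∀ s : TopologicalSpace.Compacts (Rd d),
        ∃ g ∈ closure (LpLoc.restrict s '' T), Tendsto (LpLoc.restrict s) F (𝓝 g) := by
      intro s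
      have hc : IsCompact (closure (LpLoc.restrict s '' T)) :=
        (hT s).closure.isCompact_of_isClosed isClosed_closure
      refine (isCompact_iff_ultrafilter_le_nhds.1 hc) (F.map (LpLoc.restrict s)) ?_
      have h1 : ⋂ s : TopologicalSpace.Compacts (Rd d),
          LpLoc.restrict s ⁻¹' closure (LpLoc.restrict s '' T) ∈ (F : Filter (LpLoc d p)) :=
        le_principal_iff.1 hF
      have h2 : LpLoc.restrict s ⁻¹' closure (LpLoc.restrict s '' T) ∈ (F : Filter (LpLoc d p)) :=
        mem_of_superset h1 fun f hf => Set.mem_iInter.1 hf s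
      exact le_principal_iff.2 h2
    choose g hgm hg using hlim
    obtain ⟨G, hG⟩ := exists_of_compatible g fun s t hst => by
      have h1 := ((continuous_restrictLp hst).tendsto (g t)).comp (hg t)
      refine tendsto_nhds_unique (h1.congr fun f => ?_) (hg s)
      exact restrictLp_restrict hst f
    refine ⟨G, Set.mem_iInter.2 fun s => ?_, ?_⟩
    · rw [Set.mem_preimage, hG s]
      exact hgm s
    · rw [nhds_iInf]
      refine le_iInf fun s => ?_
      rw [nhds_induced, hG s]
      exact (hg s).le_comap
  · exact fun f hf => Set.mem_iInter.2 fun s => subset_closure ⟨f, hf, rfl⟩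

end LpLoc

/-! ### Compactness of the commutator. -/

theorem LinftyCompact.bddInt {d : ℕ} (u : LinftyCompact d) :
    BddInt ‖u‖ (fun x => (u : Lp (α := Rd d) ℂ ∞ volume) x) := by
  constructor
  · obtain ⟨K, hK, hu⟩ := u.2
    have h2 : MemLp (K.indicator fun _ => (1 : ℂ)) 1 (volume : Measure (Rd d)) :=
      memLp_indicator_const 1 hK.measurableSet 1 (Or.inr hK.measure_lt_top.ne)
    have h1 : MemLp (fun x => (u : Lp (α := Rd d) ℂ ∞ volume) x) ∞ (volume : Measure (Rd d)) :=
      Lp.memLp _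
    refine memLp_one_iff_integrable.1 ((h2.mul (r := 1) h1).ae_eq ?_)
    filter_upwards [hu] with x hx
    by_cases hxK : x ∈ K
    · simp [hxK]
    · simp [hxK, hx hxK]
  · have h := ae_le_eLpNormEssSup (f := fun x => (u : Lp (α := Rd d) ℂ ∞ volume) x)
      (μ := (volume : Measure (Rd d)))
    filter_upwards [h] with x hx
    rw [← eLpNorm_exponent_top, ← Lp.enorm_def, ← ofReal_norm, ← ofReal_norm] at hx
    exact (ENNReal.ofReal_le_ofReal_iff (norm_nonneg _)).1 hx

theorem LinftyCompact.toL2_add {d : ℕ} (u v : LinftyCompact d) :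
    (LinftyCompact.toL2 (u + v)) = (LinftyCompact.toL2 u) + (LinftyCompact.toL2 v) := by
  unfold LinftyCompact.toL2
  rw [← MemLp.toLp_add]
  refine MemLp.toLp_congr _ _ ?_
  exact Lp.coeFn_add (u : Lp (α := Rd d) ℂ ∞ volume) v

theorem LinftyCompact.toL2_smul {d : ℕ} (c : ℂ) (u : LinftyCompact d) :
    (LinftyCompact.toL2 (c • u)) = c • (LinftyCompact.toL2 u) := by
  unfold LinftyCompact.toL2
  rw [← MemLp.toLp_const_smul]
  refine MemLp.toLp_congr _ _ ?_
  exact Lp.coeFn_smul c (u : Lp (α := Rd d) ℂ ∞ volume)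

theorem mulOp_eq_mulCLM {d : ℕ} (b : C₀(Rd d, ℂ)) (u : L2 d) :
    mulOp b u = mulCLM b (C := ‖b.toBCF‖) (map_continuous b)
      (fun x => b.toBCF.norm_coe_le_norm x) u :=
  rfl

theorem commutatorOp_add {d : ℕ} (A : L2 d →L[ℂ] L2 d) (b : C₀(Rd d, ℂ)) (u v : L2 d) :
    commutatorOp A b (u + v) = commutatorOp A b u + commutatorOp A b v := by
  simp only [commutatorOp, mulOp_eq_mulCLM, map_add]
  abel

theorem commutatorOp_smul {d : ℕ} (A : L2 d →L[ℂ] L2 d) (b : C₀(Rd d, ℂ)) (c : ℂ) (u : L2 d) :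
    commutatorOp A b (c • u) = c • commutatorOp A b u := by
  simp only [commutatorOp, mulOp_eq_mulCLM, map_smul, smul_sub]

namespace KernelSeq

variable {d : ℕ} {C : ℝ} {K : ℕ → Rd d → ℂ}

theorem continuous_truncComm (h : KernelSeq C K) {R : ℝ} {u : Rd d → ℂ} (hu : BddInt R u)
    {b : Rd d → ℂ} {B : ℝ} (hb : Continuous b) (hB : ∀ x, ‖b x‖ ≤ B) (N : ℕ) :
    Continuous (truncComm K b N u) :=
  (h.continuous_cv_pk (hu.mul hb hB) N).sub (hb.mul (h.continuous_cv_pk hu N))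

theorem eLpNorm_truncComm_le (h : KernelSeq C K) {p : ℝ≥0∞} (hp : 1 ≤ p) {s : Set (Rd d)} {D : ℝ}
    (hD0 : 0 ≤ D)
    (hD : ∀ (R : ℝ) (u : Rd d → ℂ), 0 < R → BddInt R u → ∀ N : ℕ,
      eLpNorm (cv (pk K N) u) p (volume.restrict s) ≤ ENNReal.ofReal (D * R))
    {R : ℝ} (hR : 0 < R) {u : Rd d → ℂ} (hu : BddInt R u) {b : Rd d → ℂ} {B : ℝ} (hB0 : 0 < B)
    (hb : Continuous b) (hB : ∀ x, ‖b x‖ ≤ B) (N : ℕ) :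
    eLpNorm (truncComm K b N u) p (volume.restrict s) ≤ ENNReal.ofReal (2 * D * B * R) := by
  have hbu := hu.mul hb hB
  have hc := h.continuous_cv_pk hu N
  have h1 := hD _ _ (by positivity) hbu N
  have h2 : eLpNorm (fun x => b x * cv (pk K N) u x) p (volume.restrict s) ≤
      ENNReal.ofReal B * ENNReal.ofReal (D * R) := by
    refine (eLpNorm_le_mul_eLpNorm_of_ae_le_mul (Eventually.of_forall fun x => ?_) p).trans
      (mul_le_mul_right (hD R u hR hu N) _)
    rw [norm_mul]
    have := hB x
    gcongr
  calc _ ≤ _ := eLpNorm_sub_le (h.continuous_cv_pk hbu N).aestronglyMeasurable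
        (hb.mul hc).aestronglyMeasurable hp
    _ ≤ ENNReal.ofReal (D * (B * R)) + ENNReal.ofReal B * ENNReal.ofReal (D * R) :=
        add_le_add h1 h2
    _ = _ := by
        rw [← ENNReal.ofReal_mul hB0.le, ← ENNReal.ofReal_add (by positivity) (by positivity)]
        congr 1
        ring

theorem truncComm_eq_add (h : KernelSeq C K) {R : ℝ} {u : Rd d → ℂ} (hu : BddInt R u)
    {b b' : Rd d → ℂ} {B B' : ℝ} (hb : Continuous b) (hB : ∀ x, ‖b x - b' x‖ ≤ B)
    (hb' : Continuous b') (hB' : ∀ x, ‖b' x‖ ≤ B') (N : ℕ) (x : Rd d) :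
    truncComm K b N u x = truncComm K (fun y => b y - b' y) N u x + truncComm K b' N u x := by
  unfold truncComm
  have h1 := cv_add (h.integrable_pk N) (hu.mul (b := fun y => b y - b' y) (hb.sub hb') hB)
    (hu.mul hb' hB') x
  have e : (fun y => (b y - b' y) * u y + b' y * u y) = fun y => b y * u y := by
    funext y; ring
  simp only [e] at h1
  rw [h1]
  ring

/-- Fatou's lemma. Shifting the index by M makes every term satisfy the bound, because a strictly
increasing `ns` has ns (i + M) ≥ M. -/
theorem eLpNorm_le_of_subseq_tendsto {s : Set (Rd d)} {p : ℝ≥0∞} {f : ℕ → Rd d → ℂ}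
    {g : Rd d → ℂ} {ns : ℕ → ℕ} (hns : StrictMono ns)
    (hlim : ∀ᵐ x, Tendsto (fun i => f (ns i) x) atTop (𝓝 (g x))) (hf : ∀ n, Continuous (f n))
    {M : ℕ} {c : ℝ≥0∞} (hc : ∀ n, M ≤ n → eLpNorm (f n) p (volume.restrict s) ≤ c) :
    eLpNorm g p (volume.restrict s) ≤ c := by
  refine (Lp.eLpNorm_lim_le_liminf_eLpNorm (f := fun i => f (ns (i + M)))
    (fun i => (hf _).aestronglyMeasurable) g ?_).trans ?_
  · filter_upwards [ae_restrict_of_ae hlim] with x hx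
    exact (tendsto_add_atTop_iff_nat (f := fun i => f (ns i) x) M).2 hx
  · refine liminf_le_of_le (by isBoundedDefault) fun t ht => ?_
    obtain ⟨i, hi⟩ := ht.exists
    exact hi.trans (hc _ ((Nat.le_add_left M i).trans (hns.le_apply)))

end KernelSeq

/-- Each C u i is approximated by a truncated commutator with a Lipschitz b' at one level M common
to all i, and at that level the family is equi-Lipschitz on s. The net is indexed by members of the
family. -/
theorem exists_finite_net_commutator {d : ℕ} (hd : 0 < d) {C : ℝ} {K : ℕ → Rd d → ℂ}
    (h : KernelSeq C K) {a : Rd d → ℂ} (ha : Continuous a) (haC : ∀ ξ, ‖a ξ‖ ≤ C)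
    (hlim : ∀ ξ, ∀ᶠ N in atTop, ∑ j ∈ Finset.range N, 𝓕 (K j) ξ = a ξ)
    {A : L2 d →L[ℂ] L2 d} (hA : IsFourierMultiplier a A) (b : C₀(Rd d, ℂ)) {p : ℝ≥0∞}
    (hp : 1 ≤ p) (hp' : p < ∞) {s : Set (Rd d)} (hs : IsCompact s) {ι : Type*}
    {u : ι → LinftyCompact d} (hu : ∀ i, ‖u i‖ ≤ 1) {ε : ℝ} (hε : 0 < ε) :
    ∃ J : Set ι, J.Finite ∧ ∀ i, ∃ j ∈ J,
      eLpNorm (fun x => commutatorOp A b (LinftyCompact.toL2 (u i)) x -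
        commutatorOp A b (LinftyCompact.toL2 (u j)) x) p
        (volume.restrict s) ≤ ENNReal.ofReal ε := by
  obtain ⟨D, hD0, hD⟩ := exists_eLpNorm_cv_le hd h hp hp' hs
  have hfin : IsFiniteMeasure (volume.restrict s) := ⟨by simpa using hs.measure_lt_top⟩
  set T : ℝ := ((volume.restrict s) Set.univ ^ p.toReal⁻¹).toReal with hT
  have hT0 : 0 ≤ T := ENNReal.toReal_nonneg
  have hTb : ∀ {f : Rd d → ℂ} {c : ℝ}, (∀ x ∈ s, ‖f x‖ ≤ c) →
      eLpNorm f p (volume.restrict s) ≤ ENNReal.ofReal (T * c) := by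
    intro f c hfc
    refine (eLpNorm_le_of_ae_bound (C := c) ?_).trans_eq ?_
    · exact (ae_restrict_iff' hs.measurableSet).2 (Eventually.of_forall hfc)
    · rw [ENNReal.ofReal_mul hT0, hT, ENNReal.ofReal_toReal]
      exact ENNReal.rpow_ne_top_of_nonneg (by positivity) (measure_ne_top _ _)
  have hbdd : ∀ i, BddInt 1 (fun x => ((u i : LinftyCompact d) : Lp (α := Rd d) ℂ ∞ volume) x) :=
    fun i => ⟨(LinftyCompact.bddInt (u i)).integrable,
      (LinftyCompact.bddInt (u i)).bound.mono fun x hx => hx.trans (hu i)⟩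
  set v : ι → Rd d → ℂ := fun i x => ((u i : LinftyCompact d) : Lp (α := Rd d) ℂ ∞ volume) x with hv
  have hbc : Continuous b := map_continuous b
  have hbB : ∀ x, ‖b x‖ ≤ ‖b.toBCF‖ := fun x => b.toBCF.norm_coe_le_norm x
  -- Chosen so that the commutator with b - b' costs 2 D ε₁ ≤ ε/8. The tail beyond M costs another
  -- ε/8, and the net below costs ε/4, for a total of 3ε/4.
  set ε₁ : ℝ := ε / (16 * (D + 1)) with hε₁
  have hε₁0 : 0 < ε₁ := by positivity
  obtain ⟨b', L, hL0, hL, hbb'⟩ := exists_lipschitz_approx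
    (ZeroAtInftyContinuousMap.uniformContinuous b) hbB hε₁0
  have hb'c := continuous_of_norm_sub_le hL0 hL
  set B' : ℝ := ‖b.toBCF‖ + ε₁ with hB'def
  have hB' : ∀ x, ‖b' x‖ ≤ B' := fun x => by
    have e : b' x = b x - (b x - b' x) := by ring
    rw [e]
    exact (norm_sub_le _ _).trans (add_le_add (hbB x) (hbb' x))
  have hB'0 : 0 ≤ B' := by positivity
  set r : ℝ := (2 : ℝ) ^ (-(1 / 4) : ℝ) with hr
  have hr0 : 0 ≤ r := by positivity
  have hr1 : r < 1 := Real.rpow_lt_one_of_one_lt_of_neg one_lt_two (by norm_num)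
  obtain ⟨M, hM⟩ : ∃ M : ℕ, T * (1 * ((L + 2 * B') * C) * (r ^ M / (1 - r))) ≤ ε / 8 := by
    have h1 : Tendsto (fun M : ℕ => T * (1 * ((L + 2 * B') * C) * (r ^ M / (1 - r)))) atTop
        (𝓝 (T * (1 * ((L + 2 * B') * C) * (0 / (1 - r))))) :=
      (((tendsto_pow_atTop_nhds_zero_of_lt_one hr0 hr1).div_const _).const_mul _).const_mul _
    rw [zero_div, mul_zero, mul_zero] at h1
    exact (h1.eventually_le_const (by positivity)).exists
  have happrox : ∀ i, eLpNorm (fun x => commutatorOp A b (LinftyCompact.toL2 (u i)) x -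
      truncComm K b' M (v i) x) p
      (volume.restrict s) ≤ ENNReal.ofReal (ε / 4) := by
    intro i
    obtain ⟨ns, hns, hns'⟩ := h.exists_subseq_tendsto_commutator ha haC hlim hA b (hbdd i)
    have hcb' := h.continuous_truncComm (hbdd i) hb'c hB' M
    refine KernelSeq.eLpNorm_le_of_subseq_tendsto
      (f := fun n x => truncComm K b n (v i) x - truncComm K b' M (v i) x) (M := M) hns
      (hns'.mono fun x hx => hx.sub tendsto_const_nhds)
      (fun n => (h.continuous_truncComm (hbdd i) hbc hbB n).sub hcb') fun n hn => ?_
    have hdc : Continuous fun y => b y - b' y := hbc.sub hb'c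
    have hcb := h.continuous_truncComm (hbdd i) hdc hbb' n
    have hcb'n := h.continuous_truncComm (hbdd i) hb'c hB' n
    have e : (fun x => truncComm K b n (v i) x - truncComm K b' M (v i) x) =
        truncComm K (fun y => b y - b' y) n (v i) +
        fun x => truncComm K b' n (v i) x - truncComm K b' M (v i) x := by
      funext x
      rw [Pi.add_apply, h.truncComm_eq_add (hbdd i) hbc hbb' hb'c hB' n x]
      ring
    rw [e]
    calc _ ≤ _ := eLpNorm_add_le hcb.aestronglyMeasurable (hcb'n.sub hcb').aestronglyMeasurable hp
      _ ≤ ENNReal.ofReal (2 * D * ε₁ * 1) + ENNReal.ofReal (ε / 8) := by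
          refine add_le_add (h.eLpNorm_truncComm_le hp hD0 hD one_pos (hbdd i) hε₁0 hdc hbb' n)
            ((hTb fun x _ => h.norm_truncComm_sub_le (hbdd i) hB' hL0 hL hn x).trans
              (ENNReal.ofReal_le_ofReal hM))
      _ ≤ ENNReal.ofReal (ε / 4) := by
          rw [← ENNReal.ofReal_add (by positivity) (by positivity)]
          refine ENNReal.ofReal_le_ofReal ?_
          have h3 : 2 * D * ε₁ ≤ ε / 8 := by
            have : (D + 1) * ε₁ = ε / 16 := by rw [hε₁]; field_simp
            nlinarith
          linarith
  set I : ℝ := ∫ z, ‖pk K M z‖ with hI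
  have hI0 : 0 ≤ I := integral_nonneg fun z => norm_nonneg _
  have hC := h.pos.le
  obtain ⟨J, hJ, hJ'⟩ := exists_finite_net_of_lipschitz hs
    (f := fun i => truncComm K b' M (v i)) (B := 2 * B' * (1 * I))
    (L := 2 * B' * 1 * C * 2 ^ M + L * (1 * I)) (ε := ε / (4 * (T + 1))) (by positivity)
    (by positivity) (fun i x _ => h.norm_truncComm_le (hbdd i) hB' hb'c M x)
    (fun i x _ y _ => h.norm_truncComm_sub_truncComm_le (hbdd i) hB' hL0 hL M x y)
  refine ⟨J, hJ, fun i => ?_⟩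
  obtain ⟨j, hj, hij⟩ := hJ' i
  refine ⟨j, hj, ?_⟩
  have hmeas : ∀ i, AEStronglyMeasurable
      (fun x => commutatorOp A b (LinftyCompact.toL2 (u i)) x - truncComm K b' M (v i) x)
      (volume.restrict s) :=
    fun i => ((Lp.aestronglyMeasurable _).mono_measure Measure.restrict_le_self).sub
      (h.continuous_truncComm (hbdd i) hb'c hB' M).aestronglyMeasurable
  have hmeas' : AEStronglyMeasurable (fun x => truncComm K b' M (v i) x - truncComm K b' M (v j) x)
      (volume.restrict s) :=
    ((h.continuous_truncComm (hbdd i) hb'c hB' M).sub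
      (h.continuous_truncComm (hbdd j) hb'c hB' M)).aestronglyMeasurable
  have e : (fun x => commutatorOp A b (LinftyCompact.toL2 (u i)) x -
        commutatorOp A b (LinftyCompact.toL2 (u j)) x) =
      ((fun x => commutatorOp A b (LinftyCompact.toL2 (u i)) x - truncComm K b' M (v i) x) +
      fun x => truncComm K b' M (v i) x - truncComm K b' M (v j) x) -
      fun x => commutatorOp A b (LinftyCompact.toL2 (u j)) x - truncComm K b' M (v j) x := by
    funext x
    simp only [Pi.add_apply, Pi.sub_apply]
    ring
  rw [e]
  calc _ ≤ _ := eLpNorm_sub_le ((hmeas i).add hmeas') (hmeas j) hp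
    _ ≤ (ENNReal.ofReal (ε / 4) + ENNReal.ofReal (ε / 4)) + ENNReal.ofReal (ε / 4) := by
        refine add_le_add ((eLpNorm_add_le (hmeas i) hmeas' hp).trans
          (add_le_add (happrox i) ((hTb hij).trans (ENNReal.ofReal_le_ofReal ?_)))) (happrox j)
        rw [← mul_div_assoc, div_le_iff₀ (by positivity)]
        nlinarith
    _ ≤ _ := by
        rw [← ENNReal.ofReal_add (by positivity) (by positivity),
          ← ENNReal.ofReal_add (by positivity) (by positivity)]
        exact ENNReal.ofReal_le_ofReal (by linarith)

theorem memLp_commutator {d : ℕ} (hd : 0 < d) {C : ℝ} {K : ℕ → Rd d → ℂ}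
    (h : KernelSeq C K) {a : Rd d → ℂ} (ha : Continuous a) (haC : ∀ ξ, ‖a ξ‖ ≤ C)
    (hlim : ∀ ξ, ∀ᶠ N in atTop, ∑ j ∈ Finset.range N, 𝓕 (K j) ξ = a ξ)
    {A : L2 d →L[ℂ] L2 d} (hA : IsFourierMultiplier a A) (b : C₀(Rd d, ℂ)) {p : ℝ≥0∞}
    (hp : 1 ≤ p) (hp' : p < ∞) {s : Set (Rd d)} (hs : IsCompact s) (u : LinftyCompact d) :
    MemLp (fun x => commutatorOp A b (LinftyCompact.toL2 u) x) p (volume.restrict s) := by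
  obtain ⟨D, hD0, hD⟩ := exists_eLpNorm_cv_le hd h hp hp' hs
  -- Adding 1 to the bounds of u and b keeps them strictly positive, as the L^p estimate of
  -- truncated commutators requires.
  have hu : BddInt (‖u‖ + 1) (fun x => (u : Lp (α := Rd d) ℂ ∞ volume) x) :=
    ⟨(LinftyCompact.bddInt u).integrable,
      (LinftyCompact.bddInt u).bound.mono fun x hx => hx.trans (by linarith)⟩
  have hbB : ∀ x, ‖b x‖ ≤ ‖b.toBCF‖ + 1 := fun x =>
    (b.toBCF.norm_coe_le_norm x).trans (by linarith)
  obtain ⟨ns, hns, hns'⟩ := h.exists_subseq_tendsto_commutator ha haC hlim hA b hu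
  have hle : ∀ n, 0 ≤ n → eLpNorm (truncComm K b n fun x => (u : Lp (α := Rd d) ℂ ∞ volume) x) p
      (volume.restrict s) ≤ ENNReal.ofReal (2 * D * (‖b.toBCF‖ + 1) * (‖u‖ + 1)) := fun n _ =>
    h.eLpNorm_truncComm_le hp hD0 hD (by positivity) hu (by positivity) (map_continuous b) hbB n
  have hlt := KernelSeq.eLpNorm_le_of_subseq_tendsto
    (f := fun n => truncComm K b n fun x => (u : Lp (α := Rd d) ℂ ∞ volume) x) hns hns'
    (fun n => h.continuous_truncComm hu (map_continuous b) hbB n) hle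
  have hmeas := (Lp.aestronglyMeasurable (commutatorOp A b (LinftyCompact.toL2 u))).mono_measure
    (Measure.restrict_le_self (s := s))
  exact ⟨hmeas, lt_of_le_of_lt hlt ENNReal.ofReal_lt_top⟩

theorem mainTheorem1 (d : ℕ) (hd : 0 < d) (a : Rd d → ℂ) (ha : ContDiff ℝ (d / 2 + 1 : ℕ) a)
    (k : ℝ) (hk : 0 < k) (hak : HormanderMikhlin (d / 2 + 1) k a) (b : C₀(Rd d, ℂ)) :
    (∃! A : L2 d →L[ℂ] L2 d, IsFourierMultiplier a A) ∧
    ∀ A : L2 d →L[ℂ] L2 d, IsFourierMultiplier a A →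
      ∀ (p : ℝ≥0∞) [Fact (1 ≤ p)], 1 < p → p < ∞ →
        ∃ C : LinftyCompact d →ₗ[ℂ] LpLoc d p,
          (∀ u : LinftyCompact d,
            (C u).toAEEqFun =
              ((commutatorOp A b (LinftyCompact.toL2 u) : L2 d) : Rd d →ₘ[volume] ℂ)) ∧
          IsCompactOperator C := by
  obtain ⟨C₀, hC₀, K, hK, haC, hKF, hlim⟩ := exists_kernel_sequence hd ha hk hak
  have h : KernelSeq C₀ K := ⟨hC₀, hK, hKF⟩
  refine ⟨existsUnique_fourierMultiplier ha.continuous haC, fun A hA p hp1 hp hp' => ?_⟩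
  let T : LinftyCompact d →ₗ[ℂ] lpLocSubmodule d p :=
    { toFun := fun u => ⟨(commutatorOp A b (LinftyCompact.toL2 u) : L2 d), fun s hs =>
        memLp_commutator hd h ha.continuous haC hlim hA b hp.le hp' hs u⟩
      map_add' := fun u v => Subtype.ext (by
        change ((commutatorOp A b (LinftyCompact.toL2 (u + v)) : L2 d) : Rd d →ₘ[volume] ℂ) = _
        rw [LinftyCompact.toL2_add, commutatorOp_add]
        rfl)
      map_smul' := fun c u => Subtype.ext (by
        change ((commutatorOp A b (LinftyCompact.toL2 (c • u)) : L2 d) : Rd d →ₘ[volume] ℂ) = _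
        rw [LinftyCompact.toL2_smul, commutatorOp_smul]
        rfl) }
  let T' : LinftyCompact d →ₗ[ℂ] LpLoc d p := T
  have hT' : ∀ u, (T' u).toAEEqFun =
      ((commutatorOp A b (LinftyCompact.toL2 u) : L2 d) : Rd d →ₘ[volume] ℂ) :=
    fun u => rfl
  refine ⟨T', hT', ?_⟩
  -- The neighbourhood of 0 is the closed unit ball, used as its own index set. The net is taken at
  -- ε/2 because total boundedness asks for open balls of radius ε.
  obtain ⟨Z, hZ, hTZ⟩ := LpLoc.exists_isCompact_superset (T' '' Metric.closedBall 0 1) fun s => by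
    rw [Metric.totallyBounded_iff]
    intro ε hε
    obtain ⟨J, hJ, hJ'⟩ := exists_finite_net_commutator hd h ha.continuous haC hlim hA b hp.le hp'
      s.isCompact (u := fun i : Metric.closedBall (0 : LinftyCompact d) 1 => (i : LinftyCompact d))
      (fun i => mem_closedBall_zero_iff.1 i.2) (half_pos hε)
    refine ⟨(fun i : Metric.closedBall (0 : LinftyCompact d) 1 =>
      (T' (i : LinftyCompact d)).restrict s) '' J, hJ.image _, ?_⟩
    rintro _ ⟨_, ⟨u, hu, rfl⟩, rfl⟩
    obtain ⟨j, hj, hij⟩ := hJ' ⟨u, hu⟩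
    refine Set.mem_iUnion₂.2 ⟨_, ⟨j, hj, rfl⟩, ?_⟩
    rw [Metric.mem_ball, dist_eq_norm, LpLoc.norm_restrict_sub]
    refine lt_of_le_of_lt (ENNReal.toReal_mono ENNReal.ofReal_ne_top hij) ?_
    rw [ENNReal.toReal_ofReal (by positivity)]
    linarith
  exact ⟨Z, hZ, mem_of_superset (Metric.closedBall_mem_nhds 0 one_pos)
    fun u hu => hTZ ⟨u, hu, rfl⟩⟩
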